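/- **Setting.** Let $M=(\mathcal S,\mathcal A,\mathcal W,H,\mathbb P,r)$ be a finite-horizon contextual MDP with measurable state space $\mathcal S$ and context space $\mathcal W$, finite nonempty action set $\mathcal A$, horizon $H\ge1$, transition kernels $\mathbb P_h(\cdot\mid s,a)$ and deterministic rewards $r_h(s,a,w)\in[0,1]$, $h\in[H]$. For a policy $\pi=(\pi_h)$, $\pi_h:\mathcal S\times\mathcal W\to\mathcal A$ (measurable in $s$), $V_h^\pi(s,w)$ is the expected reward collected from step $h$ on when starting at $s$ in context $w$, and $V_h^*=\sup_\pi V_h^\pi$. Let $d,m,K\ge1$, $T=KH$, and for positive definite $\mathbf A$ let $\|x\|_{\mathbf A}=\sqrt{x^\top \mathbf A x}$. **Assumptions.** There are measurable maps $\phi:\mathcal S\times\mathcal A\to\mathbb R^d$ and $\psi:\mathcal S\times\mathcal A\times\mathcal W\to\mathbb R^{md}$, known to the learner, such that: 1. (Linear MDP) for each $h$ there are $\eta_h\in\mathbb R^{md}$ and a vector $\mu_h$ of $d$ finite (nonnegative) measures on $\mathcal S$ with $\mathbb P_h(\cdot\mid s,a)=\langle\mu_h(\cdot),\phi(s,a)\rangle$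 and $r_h(s,a,w)=\langle\eta_h,\psi(s,a,w)\rangle$; 2. (Boundedness) $\|\phi\|_2\le1$, $\|\psi\|_2\le1$, $\|\mu_h(\mathcal S)\|_2\le\sqrt d$, $\|\eta_h\|_2\le\sqrt{md}$; 3. (Mappings) $\psi(s,a,w)=\phi(s,a)\otimes\rho(w)$ for some $\rho:\mathcal W\to\mathbb R^m$, and there are known contexts $w^{(1)},\dots,w^{(n)}$, $n\le m$, and a known constant $L$ such that every $\rho(w)$ equals $\sum_j c_j(w)\rho(w^{(j)})$ for some coefficients with $\sum_j|c_j(w)|\le L$; 4. (Completeness) for every function of the form $$f(s,w)=\min\Big\{\max_{a}\big\{\langle\nu,\psi(s,a,w)\rangle+b\|\phi(s,a)\|_{\Lambda^{-1}}+\tilde b\|\psi(s,a,w)\|_{\tilde\Lambda^{-1}}\big\}^+,H\Big\}$$ with $\nu\in\mathbb R^{md}$, $b,\tilde b\in\mathbb R$ and $\Lambda\in\mathbb R^{d\times d}$, $\tilde\Lambda\in\mathbb R^{md\times md}$ positive definite, and every $h\in[H]$, there is $\xi\in\mathbb R^{md}$ with $\|\xi\|_2\le H\sqrt{md}$ and $\int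 f(s',w)\,\mathbb P_h(ds'\mid s,a)=\langle\xi,\psi(s,a,w)\rangle$ for all $s,a,w$. Moreover a set $\mathcal D$ of $d$ state-action pairs whose features $\phi(s,a)$ are linearly independent is known. **Algorithm (UCBlvd with unknown rewards; inputs $\lambda>0$, $\beta$, $\tilde\beta$).** In episode $k=1,\dots,K$ a context $w^k$ and an initial state $s_1^k$ are revealed, chosen arbitrarily and possibly adaptively (depending on the past). Write $\phi_h^\tau=\phi(s_h^\tau,a_h^\tau)$, $\psi_h^\tau=\psi(s_h^\tau,a_h^\tau,w^\tau)$ and let $r_h^\tau=r_h(s_h^\tau,a_h^\tau,w^\tau)$ be the observed rewards. Put $$\Lambda_h^k=\lambda I+\sum_{\tau<k}\phi_h^\tau{\phi_h^\tau}^\top,\quad \tilde\Lambda_h^k=\lambda I+\sum_{\tau<k}\psi_h^\tau{\psi_h^\tau}^\top,\quad \tilde\eta_h^k=(\tilde\Lambda_h^k)^{-1}\sum_{\tau<k}\psi_h^\tau r_h^\tau,$$ $$Q_h^k(s,a,w)=\big\{\langle\tilde\eta_h^k+\hat\xi_h^k,\psi(s,a,w)\rangle+2L\beta\|\phi(s,a)\|_{(\Lambda_h^k)^{-1}}+\tilde\beta\|\psi(s,a,w)\|_{(\tilde\Lambda_h^k)^{-1}}\big\}^+,\qquad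 Q_{H+1}^k=0,$$ $V_h^k=\min\{\max_aQ_h^k(\cdot,a,\cdot),H\}$ and $\tilde\theta_h^k(w)=(\Lambda_h^k)^{-1}\sum_{\tau<k}\phi_h^\tau V_{h+1}^k(s_{h+1}^\tau,w)$. Here, for $h=H,\dots,1$, $\hat\xi_h^k$ is the $\xi$-part of any minimizer $(\xi,(\theta^{(j)})_j)$ of $$\sum_{j\le n}\sum_{(s,a)\in\mathcal D}\big(\langle\theta^{(j)},\phi(s,a)\rangle-\langle\xi,\psi(s,a,w^{(j)})\rangle\big)^2$$ subject to $\|\theta^{(j)}-\tilde\theta_h^k(w^{(j)})\|_{\Lambda_h^k}\le\beta$ for all $j$ and $\|\xi\|_2\le H\sqrt{md}$. Initially $\tilde k=1$. If in episode $k$ some $h$ satisfies $\det\Lambda_h^k/\det\Lambda_h^{\tilde k}>e$ or $\det\tilde\Lambda_h^k/\det\tilde\Lambda_h^{\tilde k}>e$, a planning call takes place: $\tilde k$ is set to $k$ and $\hat\xi_h^k$, $h=H,\dots,1$, is computed. (The data-free initial parameters $\hat\xi_h^1$ are not counted as a call.) In episode $k$ the learner then follows a policy $\pi^k$ that is greedy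 for $Q^{\tilde k}$: $\pi_h^k(s,w)\in\operatorname{argmax}_aQ_h^{\tilde k}(s,a,w)$. The regret is $R_K=\sum_{k=1}^K\big(V_1^*(s_1^k,w^k)-V_1^{\pi^k}(s_1^k,w^k)\big)$. **Theorem.** (i) For all inputs with $\lambda>0$, the number of planning calls is always at most $$dH\log\Big(1+\frac{K}{d\lambda}\Big)+mdH\log\Big(1+\frac{K}{md\lambda}\Big).$$ (ii) There are absolute constants $c,C>0$ such that for every $\delta\in(0,\tfrac12)$, if $\lambda=1$, $\beta=cHmd\sqrt{\log(mdT/\delta)}$ and $\tilde\beta=\sqrt{md}$, then with probability at least $1-2\delta$ both $$R_K\le B:=2H\sqrt{T\log(dT/\delta)}+4H\sqrt K\Big(L\beta\sqrt{2d\log(1+K)}+\tilde\beta\sqrt{2md\log(1+K)}\Big)$$ and $R_K\le C\,L\sqrt{m^2d^3H^3T}\,\log(mdT/\delta)$, i.e. $R_K\le\tilde O\big(L\sqrt{m^2d^3H^3T}\big)$; moreover, if $L\ge1$, then $B\le C\,L\sqrt{m^2d^3H^3T}\,\log(mdT/\delta)$. -/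

import Mathlib

open MeasureTheory ProbabilityTheory Finset
open scoped Matrix

noncomputable section

/-- The weighted norm `‖x‖_A = √(xᵀ A x)`. -/
def weightedNorm {ι : Type*} [Fintype ι] (A : Matrix ι ι ℝ) (x : EuclideanSpace ℝ ι) : ℝ :=
  Real.sqrt (x.ofLp ⬝ᵥ (A *ᵥ x.ofLp))

/-- The Kronecker product `x ⊗ y ∈ ℝ^{d m}` of two vectors. -/
def kronVec {d m : ℕ} (x : EuclideanSpace ℝ (Fin d)) (y : EuclideanSpace ℝ (Fin m)) :
    EuclideanSpace ℝ (Fin d × Fin m) :=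
  WithLp.toLp 2 fun p => x p.1 * y p.2

/-- The regularized Gram matrix `lam • I + ∑_{τ < k} x_τ x_τᵀ`. -/
def gramMatrix {ι : Type*} [DecidableEq ι] (lam : ℝ) (x : ℕ → EuclideanSpace ℝ ι) (k : ℕ) :
    Matrix ι ι ℝ :=
  lam • (1 : Matrix ι ι ℝ) + ∑ τ ∈ range k, Matrix.vecMulVec (x τ).ofLp (x τ).ofLp

/-- The regularized least squares estimate `Λ⁻¹ ∑_{τ < k} y_τ x_τ`, with `Λ` the Gram matrix. -/
def ridge {ι : Type*} [Fintype ι] [DecidableEq ι] (lam : ℝ) (x : ℕ → EuclideanSpace ℝ ι)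
    (y : ℕ → ℝ) (k : ℕ) : EuclideanSpace ℝ ι :=
  WithLp.toLp 2 ((gramMatrix lam x k)⁻¹ *ᵥ (∑ τ ∈ range k, y τ • x τ).ofLp)

/-! ### Contextual Markov decision processes -/

/-- A finite-horizon contextual MDP whose context influences the rewards only. The steps are
numbered `0, …, H - 1`; what `P` and `r` are at later steps is irrelevant. -/
structure ContextualMDP (S A W : Type*) [MeasurableSpace S] [MeasurableSpace A] where
  H : ℕ
  P : ℕ → Kernel (S × A) S
  markov : ∀ h, IsMarkovKernel (P h)
  r : ℕ → S → A → W → ℝ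
  r_mem : ∀ h < H, ∀ s a w, r h s a w ∈ Set.Icc (0 : ℝ) 1

namespace ContextualMDP

variable {S A W : Type*} [MeasurableSpace S] [MeasurableSpace A]

/-- The expected total reward of the policy `π` in context `w` when `n` steps remain, starting in
state `s` at step `h`. -/
def valueToGo (M : ContextualMDP S A W) (π : ℕ → S → W → A) (w : W) : ℕ → ℕ → S → ℝ
  | 0, _, _ => 0
  | n + 1, h, s => M.r h s (π h s w) w + ∫ s', M.valueToGo π w n (h + 1) s' ∂(M.P h (s, π h s w))

/-- The state value function `V_h^π(s, w)`. -/
def value (M : ContextualMDP S A W) (π : ℕ → S → W → A) (h : ℕ) (s : S) (w : W) : ℝ :=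
  M.valueToGo π w (M.H - h) h s

/-- The optimal value `V_h^*(s, w)`, the supremum of `V_h^π(s, w)` over all policies `π`. -/
def optValue (M : ContextualMDP S A W) (h : ℕ) (s : S) (w : W) : ℝ :=
  sSup {v | ∃ π : ℕ → S → W → A,
    (∀ h' w', Measurable fun s' => π h' s' w') ∧ v = M.value π h s w}

end ContextualMDP

/-! ### The structural assumptions -/

/-- What is known to the learner: the feature maps, the representative contexts
`w^(1), …, w^(n)`, the `d` state-action pairs that form the set `𝒟`, and the constant `L`. -/
structure Features (S A W : Type*) (d m n : ℕ) where
  φ : S → A → EuclideanSpace ℝ (Fin d)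
  ψ : S → A → W → EuclideanSpace ℝ (Fin d × Fin m)
  wrep : Fin n → W
  D : Fin d → S × A
  L : ℝ

section Assumptions

variable {S A W : Type*} [MeasurableSpace S] [MeasurableSpace A] {d m n : ℕ}

/-- Linear MDP: `P_h(· | s, a) = ⟨μ_h(·), φ(s, a)⟩` for `d` (nonnegative, finite) measures `μ_h`,
and `r_h(s, a, w) = ⟨η_h, ψ(s, a, w)⟩`. -/
structure IsLinearMDP (M : ContextualMDP S A W) (F : Features S A W d m n)
    (μ : ℕ → Fin d → Measure S) (η : ℕ → EuclideanSpace ℝ (Fin d × Fin m)) : Prop where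
  finite : ∀ h < M.H, ∀ i, IsFiniteMeasure (μ h i)
  transition : ∀ h < M.H, ∀ s a, ∀ B : Set S, MeasurableSet B →
    (M.P h (s, a)).real B = ∑ i, (μ h i).real B * F.φ s a i
  reward : ∀ h < M.H, ∀ s a w, M.r h s a w = inner ℝ (η h) (F.ψ s a w)

/-- Boundedness of the features and of the parameters of a linear MDP. -/
structure IsBoundedMDP (M : ContextualMDP S A W) (F : Features S A W d m n)
    (μ : ℕ → Fin d → Measure S) (η : ℕ → EuclideanSpace ℝ (Fin d × Fin m)) : Prop where
  phi : ∀ s a, ‖F.φ s a‖ ≤ 1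
  psi : ∀ s a w, ‖F.ψ s a w‖ ≤ 1
  measure : ∀ h < M.H,
    ‖(WithLp.toLp 2 fun i => (μ h i).real Set.univ : EuclideanSpace ℝ (Fin d))‖ ≤ √(d : ℝ)
  eta : ∀ h < M.H, ‖η h‖ ≤ √((m : ℝ) * d)

/-- Mappings: `ψ(s, a, w) = φ(s, a) ⊗ ρ(w)`, and every `ρ(w)` is a linear combination of the
`ρ(w^(j))` whose coefficients have absolute sum at most `L`. -/
structure IsMapping (F : Features S A W d m n) (ρ : W → EuclideanSpace ℝ (Fin m)) : Prop where
  kron : ∀ s a w, F.ψ s a w = kronVec (F.φ s a) (ρ w)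
  card_le : n ≤ m
  span : ∀ w, ∃ c : Fin n → ℝ, ρ w = ∑ j, c j • ρ (F.wrep j) ∧ ∑ j, |c j| ≤ F.L

/-- The function class of the completeness assumption, with bonuses in terms of `φ` and of `ψ`. -/
def functionClass [Fintype A] [Nonempty A] (H : ℕ) (F : Features S A W d m n) : Set (S → W → ℝ) :=
  {f | ∃ (ν : EuclideanSpace ℝ (Fin d × Fin m)) (Λ : Matrix (Fin d) (Fin d) ℝ)
      (Λt : Matrix (Fin d × Fin m) (Fin d × Fin m) ℝ) (β βt : ℝ), Λ.PosDef ∧ Λt.PosDef ∧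
      ∀ s w, f s w = min (univ.sup' univ_nonempty fun a =>
        max (inner ℝ ν (F.ψ s a w) + β * weightedNorm Λ⁻¹ (F.φ s a)
          + βt * weightedNorm Λt⁻¹ (F.ψ s a w)) 0) (H : ℝ)}

/-- Completeness: the backup of each function of the class is linear in `ψ`, with a parameter of
norm at most `H √(m d)`. -/
def IsBackupComplete [Fintype A] [Nonempty A] (M : ContextualMDP S A W)
    (F : Features S A W d m n) : Prop :=
  ∀ f ∈ functionClass M.H F, ∀ h < M.H, ∃ ξ : EuclideanSpace ℝ (Fin d × Fin m),
    ‖ξ‖ ≤ M.H * √((m : ℝ) * d) ∧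
    ∀ s a w, ∫ s', f s' w ∂(M.P h (s, a)) = inner ℝ ξ (F.ψ s a w)

/-- The standing assumptions, for some `μ`, `η` and `ρ`; the features are measurable, and the
features of the pairs in `𝒟` are `d` linearly independent vectors. -/
structure StandingAssumptions [MeasurableSpace W] [Fintype A] [Nonempty A]
    (M : ContextualMDP S A W) (F : Features S A W d m n) : Prop where
  phi_meas : ∀ a, Measurable fun s => F.φ s a
  psi_meas : ∀ a, Measurable fun p : S × W => F.ψ p.1 a p.2
  linear : ∃ μ η, IsLinearMDP M F μ η ∧ IsBoundedMDP M F μ η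
  mapping : ∃ ρ, IsMapping F ρ
  complete : IsBackupComplete M F
  indep : LinearIndependent ℝ fun i => F.φ (F.D i).1 (F.D i).2

end Assumptions

/-! ### UCBlvd with unknown rewards -/

/-- A record of the interaction: in episode `k` (numbered from `0`) the context is `ctx k`, and
`st k h`, `ac k h`, `rew k h` are the state, action and observed reward at step `h`. -/
structure History (S A W : Type*) where
  ctx : ℕ → W
  st : ℕ → ℕ → S
  ac : ℕ → ℕ → A
  rew : ℕ → ℕ → ℝ

/-- The inputs of the algorithm. -/
structure UCBlvd (S A W : Type*) (d m n : ℕ) where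
  F : Features S A W d m n
  H : ℕ
  lam : ℝ
  β : ℝ
  βt : ℝ

namespace UCBlvd

variable {S A W : Type*} {d m n : ℕ} (U : UCBlvd S A W d m n) (X : History S A W)

/-- `φ_h^τ` -/
def phiAt (h τ : ℕ) : EuclideanSpace ℝ (Fin d) := U.F.φ (X.st τ h) (X.ac τ h)

/-- `ψ_h^τ` -/
def psiAt (h τ : ℕ) : EuclideanSpace ℝ (Fin d × Fin m) :=
  U.F.ψ (X.st τ h) (X.ac τ h) (X.ctx τ)

/-- `Λ_h^k` -/
def Lam (k h : ℕ) : Matrix (Fin d) (Fin d) ℝ := gramMatrix U.lam (U.phiAt X h) k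

/-- `Λ̃_h^k` -/
def LamT (k h : ℕ) : Matrix (Fin d × Fin m) (Fin d × Fin m) ℝ :=
  gramMatrix U.lam (U.psiAt X h) k

/-- The reward parameter estimate `η̃_h^k`. -/
def etaT (k h : ℕ) : EuclideanSpace ℝ (Fin d × Fin m) :=
  ridge U.lam (U.psiAt X h) (fun τ => X.rew τ h) k

/-- The action-value function `Q_h^k`, computed from the parameters `ξ h = ξ̂_h^k`; it vanishes
after the last step. -/
def Q (k : ℕ) (ξ : ℕ → EuclideanSpace ℝ (Fin d × Fin m)) (h : ℕ) (s : S) (a : A) (w : W) : ℝ :=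
  if h < U.H then
    max (inner ℝ (U.etaT X k h + ξ h) (U.F.ψ s a w)
      + 2 * U.F.L * U.β * weightedNorm (U.Lam X k h)⁻¹ (U.F.φ s a)
      + U.βt * weightedNorm (U.LamT X k h)⁻¹ (U.F.ψ s a w)) 0
  else 0

/-- The state value function `V_h^k = min {max_a Q_h^k, H}`. -/
def V [Fintype A] [Nonempty A] (k : ℕ) (ξ : ℕ → EuclideanSpace ℝ (Fin d × Fin m)) (h : ℕ) (s : S)
    (w : W) : ℝ :=
  min (univ.sup' univ_nonempty fun a => U.Q X k ξ h s a w) (U.H : ℝ)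

/-- The least squares estimate `θ̃_h^k(w)`, with targets `V_{h+1}^k(s_{h+1}^τ, w)`. -/
def thetaT [Fintype A] [Nonempty A] (k : ℕ) (ξ : ℕ → EuclideanSpace ℝ (Fin d × Fin m)) (h : ℕ)
    (w : W) : EuclideanSpace ℝ (Fin d) :=
  ridge U.lam (U.phiAt X h) (fun τ => U.V X k ξ (h + 1) (X.st τ (h + 1)) w) k

/-- The objective of the planning program. -/
def objective (x : EuclideanSpace ℝ (Fin d × Fin m)) (θ : Fin n → EuclideanSpace ℝ (Fin d)) : ℝ :=
  ∑ j, ∑ i, (inner ℝ (θ j) (U.F.φ (U.F.D i).1 (U.F.D i).2)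
    - inner ℝ x (U.F.ψ (U.F.D i).1 (U.F.D i).2 (U.F.wrep j))) ^ 2

/-- The constraints of the planning program at step `h`; they involve the parameters `ξ (h + 1)`
that have been found for the next step. -/
def Feasible [Fintype A] [Nonempty A] (k : ℕ) (ξ : ℕ → EuclideanSpace ℝ (Fin d × Fin m)) (h : ℕ)
    (x : EuclideanSpace ℝ (Fin d × Fin m)) (θ : Fin n → EuclideanSpace ℝ (Fin d)) : Prop :=
  (∀ j, weightedNorm (U.Lam X k h) (θ j - U.thetaT X k ξ h (U.F.wrep j)) ≤ U.β) ∧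
    ‖x‖ ≤ U.H * √((m : ℝ) * d)

/-- `ξ` is a possible outcome of the planning loop in episode `k`: for every step `h`, `ξ h` is
the `ξ`-part of a minimizer of the planning program. -/
def IsPlan [Fintype A] [Nonempty A] (k : ℕ)
    (ξ : ℕ → EuclideanSpace ℝ (Fin d × Fin m)) : Prop :=
  ∀ h < U.H, ∃ θ, U.Feasible X k ξ h (ξ h) θ ∧
    ∀ x' θ', U.Feasible X k ξ h x' θ' → U.objective (ξ h) θ ≤ U.objective x' θ'

/-- The replanning criterion in episode `k`, if episode `k'` is the one of the current plan. -/
def Replan (k k' : ℕ) : Prop :=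
  ∃ h < U.H, Real.exp 1 < (U.Lam X k h).det / (U.Lam X k' h).det ∨
    Real.exp 1 < (U.LamT X k h).det / (U.LamT X k' h).det

open Classical in
/-- The value of the variable `k̃` when episode `k` begins; initially, it is the first episode. -/
def planBefore : ℕ → ℕ
  | 0 => 0
  | k + 1 => if U.Replan X k (planBefore k) then k else planBefore k

/-- The value of the variable `k̃` that is used for acting in episode `k`. -/
def planIndex (k : ℕ) : ℕ := U.planBefore X (k + 1)

open Classical in
/-- The number of planning calls in the first `K` episodes: how often the criterion is met. -/
def numPlanningCalls (K : ℕ) : ℕ :=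
  #{k ∈ range K | U.Replan X k (U.planBefore X k)}

/-- The number of the time at which the action at step `h` of episode `k` is chosen. -/
def clock (k h : ℕ) : ℕ := k * (U.H + 1) + h

/-- `K` episodes of the algorithm in the environment `M`, on a probability space with a filtration
`𝓕`, where `𝓕 (U.clock k h)` is the information available when the action at step `h` of
episode `k` is chosen. The context and the initial state of an episode are an arbitrary
(adaptive, possibly randomized) function of the past. `ξ k` are the planned parameters and `π k` is
the policy of episode `k`, any greedy policy with respect to the current action-value function. -/
structure IsRun {Ω : Type*} [MeasurableSpace S] [MeasurableSpace A] [MeasurableSpace W]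
    [Fintype A] [Nonempty A] [mΩ : MeasurableSpace Ω]
    (M : ContextualMDP S A W) (K : ℕ) (μ : Measure Ω) (𝓕 : Filtration ℕ mΩ)
    (X : Ω → History S A W) (ξ : ℕ → Ω → ℕ → EuclideanSpace ℝ (Fin d × Fin m))
    (π : ℕ → Ω → ℕ → S → W → A) : Prop where
  ctx_meas : ∀ k < K, Measurable[𝓕 (U.clock k 0)] fun ω => (X ω).ctx k
  st_meas : ∀ k < K, ∀ h ≤ U.H, Measurable[𝓕 (U.clock k h)] fun ω => (X ω).st k h
  plan_meas : ∀ k < K, ∀ h < U.H, Measurable[𝓕 (U.clock k 0)] fun ω => ξ k ω h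
  policy_meas : ∀ k < K, ∀ h < U.H,
    Measurable[(𝓕 (U.clock k 0)).prod (inferInstanceAs (MeasurableSpace (S × W)))]
      fun p : Ω × (S × W) => π k p.1 h p.2.1 p.2.2
  plan : ∀ ω, ∀ k < K, U.planIndex (X ω) k = k → U.IsPlan (X ω) k (ξ k ω)
  greedy : ∀ ω, ∀ k < K, ∀ h < U.H, ∀ s w a,
    U.Q (X ω) (U.planIndex (X ω) k) (ξ (U.planIndex (X ω) k) ω) h s a w ≤
      U.Q (X ω) (U.planIndex (X ω) k) (ξ (U.planIndex (X ω) k) ω) h s (π k ω h s w) w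
  action : ∀ ω, ∀ k < K, ∀ h < U.H, (X ω).ac k h = π k ω h ((X ω).st k h) ((X ω).ctx k)
  reward : ∀ ω, ∀ k < K, ∀ h < U.H,
    (X ω).rew k h = M.r h ((X ω).st k h) ((X ω).ac k h) ((X ω).ctx k)
  transition : ∀ k < K, ∀ h < U.H, ∀ B : Set S, MeasurableSet B →
    μ[Set.indicator {ω | (X ω).st k (h + 1) ∈ B} (fun _ => (1 : ℝ)) | 𝓕 (U.clock k h)]
      =ᵐ[μ] fun ω => (M.P h ((X ω).st k h, (X ω).ac k h)).real B

end UCBlvd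

/-- The regret of the policies `π k`, `k < K`, on the initial states and contexts of `X`. -/
def regret {S A W : Type*} [MeasurableSpace S] [MeasurableSpace A] (M : ContextualMDP S A W)
    (K : ℕ) (X : History S A W) (π : ℕ → ℕ → S → W → A) : ℝ :=
  ∑ k ∈ range K,
    (M.optValue 0 (X.st k 0) (X.ctx k) - M.value (π k) 0 (X.st k 0) (X.ctx k))

/-- The explicit regret bound for `lam = 1`, with `T = K H`. -/
def regretBound (d m H K : ℕ) (L β βt δ : ℝ) : ℝ :=
  2 * H * √(((K : ℝ) * H) * Real.log (d * ((K : ℝ) * H) / δ))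
    + 4 * H * √(K : ℝ) * (L * β * √(2 * d * Real.log (1 + K))
      + βt * √(2 * (m * d) * Real.log (1 + K)))

/-- The rate `L √(m² d³ H³ T)` times the logarithm `log (m d T / δ)`, with `T = K H`. -/
def regretRate (d m H K : ℕ) (L δ : ℝ) : ℝ :=
  L * √((m : ℝ) ^ 2 * (d : ℝ) ^ 3 * (H : ℝ) ^ 3 * ((K : ℝ) * H))
    * Real.log (m * d * ((K : ℝ) * H) / δ)

end

set_option linter.unusedSectionVars false

/-! ### Positive definite matrices and Gram matrices -/

section PosDef

variable {ι : Type*} [Fintype ι] [DecidableEq ι]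

/-! Planning calls. A call is triggered only when one of the `2H` Gram determinants has grown by a
factor `e` since the last plan, so each call raises the sum of their logarithms by at least `1`. By
the inequality between determinant and trace that sum stays below the stated bound
(`numPlanningCalls_le_logPotential`, `gramMatrix_log_det_le`).

Regret. Write `G = m d T / δ`. Three facts are combined.

Concentration. The regression targets of `θ̃_h^k` come from a value function built from the same
data, so the deviation bound must hold uniformly over a class containing it. For a fixed direction
and a fixed function, the noise compensated by its predictable square has exponential moment at most
`1` (`integral_exp_sum_sub_sq_le_one`). A union bound over a grid of directions and class
parameters, whose dimension is of order `(m d)²`, gives `exists_confidence_event`. Taking as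
direction the rescaled error of the estimate itself then bounds that error in the norm of `Λ`
(`weightedNorm_ridge_sub_sq_le`), with a radius of order `H m d √(log G)`.

Planning. By completeness the true backup is linear in `ψ`, with a parameter `x`. Its contractions
with the `ρ(w^(j))` lie in the confidence sets, so the planning program has value zero and every
minimizer attains it. Linear independence on `𝒟` forces the minimizing `θ^(j)` to be the
contractions of the planned `ξ̂`. Hence `ξ̂` is accurate in the representative contexts, and in all
contexts at the cost of a factor `L` (`abs_inner_plan_sub_le`). Rewards are observed exactly, so
their estimate suffers only from regularization.

Regret decomposition. Accuracy gives optimism (`value_le_V`), and the gap between optimistic and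
actual value satisfies a one-step recursion (`V_sub_value_le`). Its telescoping leaves the bonuses
along the run and a martingale. The bonuses are taken in the Gram matrices of an outdated plan;
`sum_le_log_of_lazy` shows that this raises the constant of the potential argument only to `2.7`.
This is sharp enough for the explicit bound, with slack that also pays for the martingale.

The argument needs `1 ≤ L ≤ √K`. For `L ≥ √K` the bound exceeds the trivial `K H`; for `L < 1` all
rewards vanish. -/

theorem dotProduct_mulVec_comm_of_posDef {A : Matrix ι ι ℝ} (hA : A.PosDef) (x y : ι → ℝ) :
    x ⬝ᵥ (A *ᵥ y) = y ⬝ᵥ (A *ᵥ x) := by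
  have h : Aᵀ = A := by simpa [Matrix.IsHermitian] using hA.1
  rw [Matrix.dotProduct_mulVec, ← Matrix.mulVec_transpose, h, dotProduct_comm]

theorem Matrix.PosDef.inv_mulVec_self {A : Matrix ι ι ℝ} (hA : A.PosDef) (x : ι → ℝ) :
    A *ᵥ (A⁻¹ *ᵥ x) = x := by
  rw [Matrix.mulVec_mulVec, Matrix.mul_nonsing_inv _ ((Matrix.isUnit_iff_isUnit_det _).1 hA.isUnit),
    Matrix.one_mulVec]

theorem Matrix.PosDef.mulVec_inv_self {A : Matrix ι ι ℝ} (hA : A.PosDef) (x : ι → ℝ) :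
    A⁻¹ *ᵥ (A *ᵥ x) = x := by
  rw [Matrix.mulVec_mulVec, Matrix.nonsing_inv_mul _ ((Matrix.isUnit_iff_isUnit_det _).1 hA.isUnit),
    Matrix.one_mulVec]

theorem Matrix.PosDef.quad_nonneg {A : Matrix ι ι ℝ} (hA : A.PosDef) (x : ι → ℝ) :
    0 ≤ x ⬝ᵥ (A *ᵥ x) := by
  simpa using hA.posSemidef.dotProduct_mulVec_nonneg x

/-- Cauchy-Schwarz for the dual norms given by a positive definite matrix and its inverse. -/
theorem Matrix.PosDef.dotProduct_sq_le {A : Matrix ι ι ℝ} (hA : A.PosDef) (x z : ι → ℝ) :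
    (x ⬝ᵥ z) ^ 2 ≤ (x ⬝ᵥ (A⁻¹ *ᵥ x)) * (z ⬝ᵥ (A *ᵥ z)) := by
  have key : ∀ s : ℝ, 0 ≤ (x ⬝ᵥ (A⁻¹ *ᵥ x)) * (s * s) + (2 * (x ⬝ᵥ z)) * s
      + z ⬝ᵥ (A *ᵥ z) := by
    intro s
    have h := hA.quad_nonneg (z + s • (A⁻¹ *ᵥ x))
    have h2 : (z + s • (A⁻¹ *ᵥ x)) ⬝ᵥ (A *ᵥ (z + s • (A⁻¹ *ᵥ x)))
        = (x ⬝ᵥ (A⁻¹ *ᵥ x)) * (s * s) + (2 * (x ⬝ᵥ z)) * s + z ⬝ᵥ (A *ᵥ z) := by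
      have e1 : (A⁻¹ *ᵥ x) ⬝ᵥ (A *ᵥ z) = x ⬝ᵥ z := by
        rw [dotProduct_mulVec_comm_of_posDef hA, hA.inv_mulVec_self, dotProduct_comm]
      simp only [Matrix.mulVec_add, Matrix.mulVec_smul, hA.inv_mulVec_self, add_dotProduct,
        dotProduct_add, smul_dotProduct, dotProduct_smul, smul_eq_mul, e1]
      rw [dotProduct_comm z x, dotProduct_comm (A⁻¹ *ᵥ x) x]
      ring
    rwa [h2] at h
  have := discrim_le_zero key
  unfold discrim at this
  nlinarith

theorem abs_inner_le_weightedNorm {A : Matrix ι ι ℝ} (hA : A.PosDef)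
    (z x : EuclideanSpace ℝ ι) :
    |inner ℝ z x| ≤ weightedNorm A z * weightedNorm A⁻¹ x := by
  have e : inner ℝ z x = x.ofLp ⬝ᵥ z.ofLp := by
    simp [EuclideanSpace.inner_eq_star_dotProduct]
  unfold weightedNorm
  rw [← Real.sqrt_mul (hA.quad_nonneg _), e]
  apply Real.abs_le_sqrt
  rw [mul_comm]
  exact hA.dotProduct_sq_le _ _

theorem weightedNorm_nonneg (A : Matrix ι ι ℝ) (x : EuclideanSpace ℝ ι) : 0 ≤ weightedNorm A x :=
  Real.sqrt_nonneg _

theorem inner_eq_dotProduct (x y : EuclideanSpace ℝ ι) : inner ℝ x y = x.ofLp ⬝ᵥ y.ofLp := by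
  simp [EuclideanSpace.inner_eq_star_dotProduct, dotProduct_comm]

/-- The matrix determinant lemma for a symmetric rank one update. -/
theorem Matrix.PosDef.det_add_vecMulVec {A : Matrix ι ι ℝ} (hA : A.PosDef) (x : ι → ℝ) :
    (A + Matrix.vecMulVec x x).det = A.det * (1 + x ⬝ᵥ (A⁻¹ *ᵥ x)) := by
  have h := Matrix.det_add_replicateCol_mul_replicateRow (ι := Unit)
    ((Matrix.isUnit_iff_isUnit_det _).1 hA.isUnit) x x
  rw [Matrix.vecMulVec_eq Unit, h]
  congr 1
  simp [Matrix.det_unique, Matrix.mul_apply, Matrix.replicateRow, Matrix.replicateCol,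
    dotProduct, Matrix.mulVec, Finset.mul_sum, Finset.sum_mul]
  rw [Finset.sum_comm]
  simp [mul_assoc]

theorem vecMulVec_mulVec_self (x z : ι → ℝ) :
    Matrix.vecMulVec x x *ᵥ z = (x ⬝ᵥ z) • x := by
  rw [Matrix.vecMulVec_mulVec]
  ext i
  simp [mul_comm]

/-- After a rank one update `A + y yᵀ`, the dual norm decreases at most by the determinant ratio. -/
theorem Matrix.PosDef.quad_inv_le_rankOne {A : Matrix ι ι ℝ} (hA : A.PosDef) (y x : ι → ℝ)
    (hB : (A + Matrix.vecMulVec y y).PosDef) :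
    x ⬝ᵥ (A⁻¹ *ᵥ x) ≤ (1 + y ⬝ᵥ (A⁻¹ *ᵥ y)) * (x ⬝ᵥ ((A + Matrix.vecMulVec y y)⁻¹ *ᵥ x)) := by
  set B := A + Matrix.vecMulVec y y with hBdef
  set z := B⁻¹ *ᵥ x with hz
  -- In terms of `z = B⁻¹ x`, the right side minus the left is `(yᵀ A⁻¹ y)(zᵀ A z) - (yᵀ z)²`, which
  -- is nonnegative by Cauchy-Schwarz.
  have hx : x = A *ᵥ z + (y ⬝ᵥ z) • y := by
    rw [← hB.inv_mulVec_self x, ← hz, hBdef, Matrix.add_mulVec, vecMulVec_mulVec_self]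
  have e1 : x ⬝ᵥ z = z ⬝ᵥ (A *ᵥ z) + (y ⬝ᵥ z) ^ 2 := by
    rw [hx, add_dotProduct, smul_dotProduct, smul_eq_mul, dotProduct_comm (A *ᵥ z) z, sq]
  have e2 : x ⬝ᵥ (A⁻¹ *ᵥ x) = z ⬝ᵥ (A *ᵥ z) + 2 * (y ⬝ᵥ z) ^ 2
      + (y ⬝ᵥ z) ^ 2 * (y ⬝ᵥ (A⁻¹ *ᵥ y)) := by
    have e3 : (A *ᵥ z) ⬝ᵥ (A⁻¹ *ᵥ y) = y ⬝ᵥ z := by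
      rw [dotProduct_comm, dotProduct_mulVec_comm_of_posDef hA, hA.inv_mulVec_self, dotProduct_comm]
    conv_lhs => rw [hx]
    simp only [Matrix.mulVec_add, Matrix.mulVec_smul, hA.mulVec_inv_self, add_dotProduct,
        dotProduct_add, smul_dotProduct, dotProduct_smul, smul_eq_mul, e3]
    rw [dotProduct_comm (A *ᵥ z) z]
    ring
  have cs := hA.dotProduct_sq_le y z
  have := hA.quad_nonneg z
  have := hA.inv.quad_nonneg y
  rw [e1, e2]
  nlinarith

/-- The inequality between the determinant and the trace. -/
theorem Matrix.PosDef.det_le_trace_div_pow [Nonempty ι] {A : Matrix ι ι ℝ} (hA : A.PosDef) :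
    A.det ≤ (A.trace / Fintype.card ι) ^ Fintype.card ι := by
  have hpos := fun i => (hA.eigenvalues_pos i).le
  have hc : (0 : ℝ) < Fintype.card ι := by exact_mod_cast Fintype.card_pos
  have hag := Real.geom_mean_le_arith_mean Finset.univ (fun _ => (1 : ℝ))
    (fun i => hA.1.eigenvalues i) (by simp) (by simpa using hc) (fun i _ => hpos i)
  rw [hA.1.det_eq_prod_eigenvalues, hA.1.trace_eq_sum_eigenvalues]
  simp only [Real.rpow_one, one_mul, sum_const, card_univ, nsmul_eq_mul, mul_one] at hag
  have hp : 0 ≤ ∏ i, hA.1.eigenvalues i := Finset.prod_nonneg fun i _ => hpos i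
  calc _ = ((∏ i, hA.1.eigenvalues i) ^ ((Fintype.card ι : ℝ)⁻¹)) ^ Fintype.card ι := by
        rw [← Real.rpow_natCast, ← Real.rpow_mul hp, inv_mul_cancel₀ hc.ne', Real.rpow_one]; simp
    _ ≤ _ := by
        apply pow_le_pow_left₀ (Real.rpow_nonneg hp _)
        simpa using hag

end PosDef

/-! ### Gram matrices: growth of determinants and dual norms. -/

section Gram

variable {ι : Type*} [Fintype ι] [DecidableEq ι] {lam : ℝ} {x : ℕ → EuclideanSpace ℝ ι} {k : ℕ}

theorem gramMatrix_zero : gramMatrix lam x 0 = lam • (1 : Matrix ι ι ℝ) := by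
  simp [gramMatrix]

theorem gramMatrix_succ : gramMatrix lam x (k + 1)
    = gramMatrix lam x k + Matrix.vecMulVec (x k).ofLp (x k).ofLp := by
  simp [gramMatrix, Finset.sum_range_succ, add_assoc]

theorem gramMatrix_posDef (hl : 0 < lam) : (gramMatrix lam x k).PosDef := by
  unfold gramMatrix
  refine Matrix.PosDef.add_posSemidef (Matrix.PosDef.one.smul hl) ?_
  exact Matrix.posSemidef_sum _ fun i _ => by
    simpa using Matrix.posSemidef_vecMulVec_self_star (x i).ofLp

theorem gramMatrix_mulVec (z : ι → ℝ) :
    gramMatrix lam x k *ᵥ z = lam • z + ∑ τ ∈ range k, ((x τ).ofLp ⬝ᵥ z) • (x τ).ofLp := by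
  simp only [gramMatrix, Matrix.add_mulVec, Matrix.smul_mulVec, Matrix.one_mulVec,
    Matrix.sum_mulVec, vecMulVec_mulVec_self]

theorem gramMatrix_quad (z : ι → ℝ) :
    z ⬝ᵥ (gramMatrix lam x k *ᵥ z) = lam * (z ⬝ᵥ z)
      + ∑ τ ∈ range k, ((x τ).ofLp ⬝ᵥ z) ^ 2 := by
  rw [gramMatrix_mulVec, dotProduct_add, dotProduct_smul, dotProduct_sum]
  congr 1
  exact Finset.sum_congr rfl fun τ _ => by
    rw [dotProduct_smul, smul_eq_mul, dotProduct_comm z, sq]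

theorem gramMatrix_det_pos (hl : 0 < lam) : 0 < (gramMatrix lam x k).det :=
  (gramMatrix_posDef hl).det_pos

theorem gramMatrix_det_succ (hl : 0 < lam) : (gramMatrix lam x (k + 1)).det
    = (gramMatrix lam x k).det * (1 + weightedNorm (gramMatrix lam x k)⁻¹ (x k) ^ 2) := by
  rw [gramMatrix_succ, (gramMatrix_posDef hl).det_add_vecMulVec, weightedNorm,
    Real.sq_sqrt ((gramMatrix_posDef hl).inv.quad_nonneg _)]

theorem gramMatrix_det_mono (hl : 0 < lam) : Monotone fun k => (gramMatrix lam x k).det := by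
  refine monotone_nat_of_le_succ fun k => ?_
  rw [gramMatrix_det_succ hl]
  have := gramMatrix_det_pos (x := x) (k := k) hl
  nlinarith [sq_nonneg (weightedNorm (gramMatrix lam x k)⁻¹ (x k)), mul_nonneg this.le
    (sq_nonneg (weightedNorm (gramMatrix lam x k)⁻¹ (x k)))]

theorem gramMatrix_det_le [Nonempty ι] (hl : 0 < lam) (hx : ∀ τ < k, ‖x τ‖ ≤ 1) :
    (gramMatrix lam x k).det ≤ (lam + k / Fintype.card ι) ^ Fintype.card ι := by
  have hc : (0 : ℝ) < Fintype.card ι := by exact_mod_cast Fintype.card_pos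
  have hpd := gramMatrix_posDef (x := x) (k := k) hl
  refine hpd.det_le_trace_div_pow.trans (pow_le_pow_left₀
    (div_nonneg hpd.posSemidef.trace_nonneg hc.le) ?_ _)
  rw [div_le_iff₀ hc, add_mul, div_mul_cancel₀ _ hc.ne']
  unfold gramMatrix
  rw [Matrix.trace_add, Matrix.trace_smul, Matrix.trace_one, Matrix.trace_sum, smul_eq_mul]
  gcongr
  calc ∑ τ ∈ range k, (Matrix.vecMulVec (x τ).ofLp (x τ).ofLp).trace
      ≤ ∑ τ ∈ range k, (1 : ℝ) := by
        refine Finset.sum_le_sum fun τ hτ => ?_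
        rw [Matrix.trace_vecMulVec, ← inner_eq_dotProduct, real_inner_self_eq_norm_sq]
        have := hx τ (mem_range.1 hτ)
        have := norm_nonneg (x τ)
        nlinarith
    _ = k := by simp

/-- The trace grows by at most `1` per round, and the arithmetic-geometric mean inequality passes
this on to the determinant. This cap controls both the number of plans and the sum of the squared
bonuses. -/
theorem gramMatrix_log_det_le [Nonempty ι] (hl : 0 < lam) (hx : ∀ τ < k, ‖x τ‖ ≤ 1) :
    Real.log ((gramMatrix lam x k).det / (gramMatrix lam x 0).det)
      ≤ Fintype.card ι * Real.log (1 + k / (Fintype.card ι * lam)) := by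
  have hc : (0 : ℝ) < Fintype.card ι := by exact_mod_cast Fintype.card_pos
  rw [← Real.log_pow]
  have h0 := gramMatrix_det_pos (x := x) (k := 0) hl
  apply Real.log_le_log (div_pos (gramMatrix_det_pos hl) h0)
  rw [div_le_iff₀ h0, gramMatrix_zero, Matrix.det_smul, Matrix.det_one, mul_one, ← mul_pow]
  refine (gramMatrix_det_le hl hx).trans (le_of_eq ?_)
  congr 1
  field_simp

/-- Between two Gram matrices, the dual norm decreases at most by the determinant ratio. -/
theorem weightedNorm_sq_le_det_ratio (hl : 0 < lam) (z : EuclideanSpace ℝ ι) {a b : ℕ}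
    (hab : a ≤ b) : weightedNorm (gramMatrix lam x a)⁻¹ z ^ 2
      ≤ (gramMatrix lam x b).det / (gramMatrix lam x a).det
        * weightedNorm (gramMatrix lam x b)⁻¹ z ^ 2 := by
  have ha := gramMatrix_det_pos (x := x) (k := a) hl
  induction b, hab using Nat.le_induction with
  | base => rw [div_self ha.ne', one_mul]
  | succ b hab ih =>
    refine ih.trans ?_
    have hb := gramMatrix_det_pos (x := x) (k := b) hl
    have hpd := gramMatrix_posDef (x := x) (k := b) hl
    have hpd' := gramMatrix_posDef (x := x) (k := b + 1) hl
    -- The factor lost in one rank-one update is exactly the quotient of consecutive determinants,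
    -- so the factors multiply up to the full ratio.
    have h := hpd.quad_inv_le_rankOne (x b).ofLp z.ofLp (by rwa [← gramMatrix_succ])
    rw [← gramMatrix_succ] at h
    rw [gramMatrix_det_succ hl]
    simp only [weightedNorm]
    rw [Real.sq_sqrt (hpd.inv.quad_nonneg _), Real.sq_sqrt (hpd'.inv.quad_nonneg _),
      Real.sq_sqrt (hpd.inv.quad_nonneg _)]
    rw [mul_div_right_comm, mul_assoc]
    gcongr

theorem norm_sq_eq_dotProduct (z : EuclideanSpace ℝ ι) : ‖z‖ ^ 2 = z.ofLp ⬝ᵥ z.ofLp := by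
  rw [← inner_eq_dotProduct, real_inner_self_eq_norm_sq]

/-- The inverse of a Gram matrix with regularization `1` is a contraction. -/
theorem norm_gramMatrix_inv_mulVec_le (z : EuclideanSpace ℝ ι) :
    ‖(WithLp.toLp 2 ((gramMatrix 1 x k)⁻¹ *ᵥ z.ofLp) : EuclideanSpace ℝ ι)‖ ≤ ‖z‖ := by
  set y : EuclideanSpace ℝ ι := WithLp.toLp 2 ((gramMatrix 1 x k)⁻¹ *ᵥ z.ofLp) with hy
  have hpd := gramMatrix_posDef (x := x) (k := k) one_pos
  have hz : gramMatrix 1 x k *ᵥ y.ofLp = z.ofLp := hpd.inv_mulVec_self _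
  have h1 : ‖y‖ ^ 2 ≤ inner ℝ y z := by
    rw [inner_eq_dotProduct, ← hz, gramMatrix_quad, norm_sq_eq_dotProduct, one_mul]
    exact le_add_of_nonneg_right (Finset.sum_nonneg fun _ _ => sq_nonneg _)
  have h2 := real_inner_le_norm y z
  by_contra hlt
  push Not at hlt
  have := norm_nonneg z
  nlinarith

theorem weightedNorm_gramMatrix_inv_le (z : EuclideanSpace ℝ ι) :
    weightedNorm (gramMatrix 1 x k)⁻¹ z ≤ ‖z‖ := by
  have h := norm_gramMatrix_inv_mulVec_le (x := x) (k := k) z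
  rw [weightedNorm, ← Real.sqrt_sq (norm_nonneg z)]
  apply Real.sqrt_le_sqrt
  have e := inner_eq_dotProduct z (WithLp.toLp 2 ((gramMatrix 1 x k)⁻¹ *ᵥ z.ofLp))
  simp only at e
  rw [← e]
  refine (real_inner_le_norm _ _).trans ?_
  have := norm_nonneg z
  nlinarith

/-- Places the inverse Gram matrices in the box that is discretized for the union bound. -/
theorem abs_gramMatrix_inv_apply_le (i j : ι) : |(gramMatrix 1 x k)⁻¹ i j| ≤ 1 := by
  have h := norm_gramMatrix_inv_mulVec_le (x := x) (k := k) (EuclideanSpace.single j (1 : ℝ))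
  rw [PiLp.norm_single, norm_one] at h
  refine le_trans ?_ h
  have := PiLp.norm_apply_le
    (WithLp.toLp 2 ((gramMatrix 1 x k)⁻¹ *ᵥ (EuclideanSpace.single j (1 : ℝ)).ofLp)) i
  simpa using this

end Gram

/-! ### Rarely updated plans -/

/-- By concavity `log` lies above its chord on `[1, 2e]`, whose slope gives the constant `(2e - 1) /
(1 + log 2) ≈ 2.62`. The right end is `2e` because a block of episodes with one plan ends at a ratio
of at most `e`, doubled by one last round. -/
theorem sub_one_le_mul_log {R : ℝ} (h1 : 1 ≤ R) (h2 : R ≤ 2 * Real.exp 1) :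
    R - 1 ≤ 27 / 10 * Real.log R := by
  have he := Real.exp_one_lt_d9
  have he' := Real.exp_one_gt_d9
  have hl2 := Real.log_two_gt_d9
  have hD : (0 : ℝ) < 2 * Real.exp 1 - 1 := by linarith
  have hlog : Real.log (2 * Real.exp 1) = Real.log 2 + 1 := by
    rw [Real.log_mul (by norm_num) (by positivity), Real.log_exp]
  set t := (R - 1) / (2 * Real.exp 1 - 1) with ht
  have ht0 : 0 ≤ t := div_nonneg (by linarith) hD.le
  have ht1 : t ≤ 1 := by rw [ht, div_le_one hD]; linarith
  have hR : (1 - t) * 1 + t * (2 * Real.exp 1) = R := by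
    rw [ht]; field_simp; ring
  have hc := strictConcaveOn_log_Ioi.concaveOn.2 (Set.mem_Ioi.2 one_pos)
    (Set.mem_Ioi.2 (show 0 < 2 * Real.exp 1 by positivity)) (sub_nonneg.2 ht1) ht0 (by ring)
  simp only [smul_eq_mul, hR, Real.log_one, mul_zero, zero_add, hlog] at hc
  have hR' : R - 1 = t * (2 * Real.exp 1 - 1) := by rw [ht]; field_simp
  rw [hR']
  nlinarith

/-- The potential argument for a plan that is updated when a potential `D`, which at most doubles
from one round to the next, has grown by a factor `e`. -/
theorem sum_le_log_of_lazy {D y : ℕ → ℝ} {p : ℕ → ℕ} (hpos : ∀ k, 0 < D k) (hmono : Monotone D)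
    (hdouble : ∀ k, D (k + 1) ≤ 2 * D k) (h0 : p 0 = 0) (hle : ∀ k, p k ≤ k)
    (hp : ∀ k, p (k + 1) = p k ∨ p (k + 1) = k)
    (hratio : ∀ k, D k / D (p (k + 1)) ≤ Real.exp 1)
    (hy : ∀ k, y k ≤ (D (k + 1) - D k) / D (p (k + 1))) (K : ℕ) :
    ∑ k ∈ range K, y k ≤ 27 / 10 * Real.log (D K / D 0) := by
  -- The criterion bounds the ratio by `e` one round earlier, and one round at most doubles `D`.
  have hR : ∀ k, 1 ≤ D k / D (p k) ∧ D k / D (p k) ≤ 2 * Real.exp 1 := by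
    intro k
    refine ⟨by rw [le_div_iff₀ (hpos _), one_mul]; exact hmono (hle k), ?_⟩
    cases k with
    | zero =>
      rw [h0, div_self (hpos 0).ne']
      have := Real.add_one_le_exp 1
      linarith
    | succ k =>
      calc _ ≤ 2 * D k / D (p (k + 1)) := by
            have := hpos (p (k + 1)); have := hdouble k; gcongr
        _ = 2 * (D k / D (p (k + 1))) := by ring
        _ ≤ _ := by have := hratio k; linarith
  have hstep : ∀ k, D k / D (p k) - 1 ≤ 27 / 10 * (Real.log (D k / D 0)
      - Real.log (D (p k) / D 0)) := by
    intro k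
    rw [← Real.log_div (div_pos (hpos _) (hpos _)).ne' (div_pos (hpos _) (hpos _)).ne',
      div_div_div_cancel_right₀ (hpos 0).ne']
    exact sub_one_le_mul_log (hR k).1 (hR k).2
  -- Within a block the increments have the same denominator and telescope to `D k / D (p k) - 1`.
  -- This excess is exchanged for a logarithm only when the block closes.
  have hinv : ∀ k, ∑ τ ∈ range k, y τ
      ≤ 27 / 10 * Real.log (D (p k) / D 0) + (D k / D (p k) - 1) := by
    intro k
    induction k with
    | zero => simp [h0, div_self (hpos 0).ne']
    | succ k ih =>
      rw [Finset.sum_range_succ]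
      have h1 := hy k
      rw [sub_div] at h1
      rcases hp k with h | h
      · rw [h] at h1 ⊢; linarith
      -- A new block starts at `k`: `hstep` converts the excess of the old one.
      · have := hstep k
        rw [h, div_self (hpos k).ne'] at h1
        rw [h]; linarith
  have := hinv K
  have := hstep K
  linarith

/-! ### Times of replanning, sums of bonuses, and the number of planning calls. -/

namespace UCBlvd

variable {S A W : Type*} {d m n : ℕ} (U : UCBlvd S A W d m n) (X : History S A W)

theorem planBefore_le : ∀ k, U.planBefore X k ≤ k
  | 0 => le_rfl
  | k + 1 => by
    rw [planBefore]
    split_ifs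
    · omega
    · exact (planBefore_le k).trans (by omega)

theorem planBefore_succ (k : ℕ) :
    U.planBefore X (k + 1) = U.planBefore X k ∨ U.planBefore X (k + 1) = k := by
  rw [planBefore]; split_ifs <;> simp

theorem planIndex_le (k : ℕ) : U.planIndex X k ≤ k := by
  rcases U.planBefore_succ X k with h | h
  · exact h.le.trans (U.planBefore_le X k)
  · exact h.le

/-- A plan in force was computed in an episode that was its own plan index. Only for such episodes
does a run guarantee an outcome of the planning program. -/
theorem planIndex_planIndex (k : ℕ) : U.planIndex X (U.planIndex X k) = U.planIndex X k := by
  induction k with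
  | zero =>
    have h := U.planIndex_le X 0
    rw [Nat.le_zero.1 h, Nat.le_zero.1 h]
  | succ k ih =>
    rcases U.planBefore_succ X (k + 1) with h | h
    · have h' : U.planIndex X (k + 1) = U.planIndex X k := h
      rw [h', ih]
    · have h' : U.planIndex X (k + 1) = k + 1 := h
      rw [h', h']

variable {U} in
-- Once the decision of episode `k` is taken the criterion fails: either it was not met, or the plan
-- is that of episode `k` itself and the ratios are `1 < e`.
theorem det_ratio_le (hl : 0 < U.lam) (k : ℕ) {h : ℕ} (hh : h < U.H) :
    (U.Lam X k h).det / (U.Lam X (U.planIndex X k) h).det ≤ Real.exp 1 ∧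
    (U.LamT X k h).det / (U.LamT X (U.planIndex X k) h).det ≤ Real.exp 1 := by
  have hr : ¬ U.Replan X k (U.planIndex X k) := by
    unfold planIndex
    rw [planBefore]
    split_ifs with hif
    · rintro ⟨h', -, h1 | h1⟩
      all_goals
        have h2 := h1.trans_eq (div_self (gramMatrix_det_pos hl).ne')
        have := Real.add_one_le_exp 1
        linarith
    · exact hif
  unfold Replan at hr
  push Not at hr
  exact hr h hh

/-- Sum of the squared norms of features in the Gram matrices of the current plan. -/
theorem sum_weightedNorm_sq_le {ι : Type*} [Fintype ι] [DecidableEq ι] [Nonempty ι]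
    {x : ℕ → EuclideanSpace ℝ ι} (hx : ∀ k, ‖x k‖ ≤ 1)
    (hr : ∀ k, (gramMatrix 1 x k).det / (gramMatrix 1 x (U.planIndex X k)).det ≤ Real.exp 1)
    (K : ℕ) :
    ∑ k ∈ range K, weightedNorm (gramMatrix 1 x (U.planIndex X k))⁻¹ (x k) ^ 2
      ≤ 27 / 10 * (Fintype.card ι * Real.log (1 + K)) := by
  have hle1 : ∀ k, weightedNorm (gramMatrix 1 x k)⁻¹ (x k) ^ 2 ≤ 1 := fun k =>
    pow_le_one₀ (weightedNorm_nonneg _ _) ((weightedNorm_gramMatrix_inv_le _).trans (hx k))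
  have h := sum_le_log_of_lazy (D := fun k => (gramMatrix 1 x k).det)
    (y := fun k => weightedNorm (gramMatrix 1 x (U.planIndex X k))⁻¹ (x k) ^ 2)
    (p := U.planBefore X) (fun k => gramMatrix_det_pos one_pos) (gramMatrix_det_mono one_pos)
    (fun k => by
      rw [gramMatrix_det_succ one_pos, mul_comm]
      have := gramMatrix_det_pos (x := x) (k := k) one_pos
      have := hle1 k
      gcongr
      linarith)
    rfl (U.planBefore_le X) (U.planBefore_succ X) hr
    -- The dual norm in the old matrix is at most `D k / D (p (k + 1))` times the one in the current
    -- matrix, and the latter is `D (k + 1) / D k - 1` by the determinant lemma.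
    (fun k => by
      refine (weightedNorm_sq_le_det_ratio one_pos (x k) (U.planIndex_le X k)).trans
        (le_of_eq ?_)
      rw [gramMatrix_det_succ one_pos]
      change _ = _ / (gramMatrix 1 x (U.planIndex X k)).det
      ring) K
  refine h.trans ?_
  have hc : (1 : ℝ) ≤ Fintype.card ι := by exact_mod_cast Fintype.card_pos (α := ι)
  gcongr
  refine (gramMatrix_log_det_le one_pos fun τ _ => hx τ).trans ?_
  gcongr
  rw [mul_one]
  exact div_le_self (Nat.cast_nonneg _) hc

/-- The total logarithmic growth of the determinants of the Gram matrices. -/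
noncomputable def logPotential (k : ℕ) : ℝ :=
  ∑ h ∈ range U.H, (Real.log ((U.Lam X k h).det / (U.Lam X 0 h).det)
    + Real.log ((U.LamT X k h).det / (U.LamT X 0 h).det))

theorem log_det_ratio_mono {ι : Type*} [Fintype ι] [DecidableEq ι] {lam : ℝ} (hl : 0 < lam)
    (x : ℕ → EuclideanSpace ℝ ι) :
    Monotone fun k => Real.log ((gramMatrix lam x k).det / (gramMatrix lam x 0).det) := by
  intro a b hab
  have h0 := gramMatrix_det_pos (x := x) (k := 0) hl
  have ha := gramMatrix_det_pos (x := x) (k := a) hl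
  have := gramMatrix_det_mono (x := x) hl hab
  simp only at this ⊢
  gcongr

theorem log_det_ratio_add_one {ι : Type*} [Fintype ι] [DecidableEq ι] {lam : ℝ} (hl : 0 < lam)
    (x : ℕ → EuclideanSpace ℝ ι) {a b : ℕ}
    (h : Real.exp 1 < (gramMatrix lam x b).det / (gramMatrix lam x a).det) :
    Real.log ((gramMatrix lam x a).det / (gramMatrix lam x 0).det) + 1 ≤
      Real.log ((gramMatrix lam x b).det / (gramMatrix lam x 0).det) := by
  have h0 := gramMatrix_det_pos (x := x) (k := 0) hl
  have ha := gramMatrix_det_pos (x := x) (k := a) hl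
  have hb := gramMatrix_det_pos (x := x) (k := b) hl
  have h1 : 1 ≤ Real.log ((gramMatrix lam x b).det / (gramMatrix lam x a).det) := by
    rw [Real.le_log_iff_exp_le (div_pos hb ha)]
    exact h.le
  rw [Real.log_div ha.ne' h0.ne', Real.log_div hb.ne' h0.ne']
  rw [Real.log_div hb.ne' ha.ne'] at h1
  linarith

variable {U} in
theorem logPotential_mono (hl : 0 < U.lam) : Monotone (U.logPotential X) := fun _ _ hab =>
  Finset.sum_le_sum fun _ _ =>
    add_le_add (log_det_ratio_mono hl _ hab) (log_det_ratio_mono hl _ hab)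

variable {U} in
-- The determinant that triggers the call contributes at least `1`, and no other summand decreases.
theorem logPotential_replan (hl : 0 < U.lam) {a b : ℕ} (hab : a ≤ b) (h : U.Replan X b a) :
    U.logPotential X a + 1 ≤ U.logPotential X b := by
  obtain ⟨h, hh, hr⟩ := h
  unfold logPotential
  rw [← Finset.add_sum_erase _ _ (mem_range.2 hh), ← Finset.add_sum_erase _ _ (mem_range.2 hh)]
  have h1 := log_det_ratio_mono hl (U.phiAt X h) hab
  have h2 := log_det_ratio_mono hl (U.psiAt X h) hab
  have h3 : ∑ h ∈ (range U.H).erase h, (Real.log ((U.Lam X a h).det / (U.Lam X 0 h).det)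
      + Real.log ((U.LamT X a h).det / (U.LamT X 0 h).det)) ≤
      ∑ h ∈ (range U.H).erase h, (Real.log ((U.Lam X b h).det / (U.Lam X 0 h).det)
      + Real.log ((U.LamT X b h).det / (U.LamT X 0 h).det)) :=
    Finset.sum_le_sum fun _ _ =>
      add_le_add (log_det_ratio_mono hl _ hab) (log_det_ratio_mono hl _ hab)
  simp only at h1 h2
  rcases hr with hr | hr
  · have := log_det_ratio_add_one hl (U.phiAt X h) hr
    unfold Lam LamT at *
    linarith
  · have := log_det_ratio_add_one hl (U.psiAt X h) hr
    unfold Lam LamT at *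
    linarith

variable {U} in
-- The potential is evaluated at the episode of the current plan, so that it moves exactly when the
-- plan does and each call is charged to its own unit of growth.
theorem numPlanningCalls_le_logPotential (hl : 0 < U.lam) (K : ℕ) :
    (U.numPlanningCalls X K : ℝ) ≤ U.logPotential X (U.planBefore X K) := by
  classical
  induction K with
  | zero =>
    have : U.logPotential X 0 = 0 := by
      unfold logPotential
      refine Finset.sum_eq_zero fun h _ => ?_
      rw [Lam, LamT, div_self (gramMatrix_det_pos hl).ne', div_self (gramMatrix_det_pos hl).ne']
      simp
    simp [numPlanningCalls, planBefore, this]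
  | succ K ih =>
    unfold numPlanningCalls at ih ⊢
    rw [Finset.range_add_one, Finset.filter_insert, planBefore]
    split_ifs with hr
    · rw [Finset.card_insert_of_notMem (by simp), Nat.cast_add, Nat.cast_one]
      exact (add_le_add_left ih 1).trans (logPotential_replan X hl (U.planBefore_le X K) hr)
    · exact ih

theorem numPlanningCalls_le (hd : 0 < d) (hm : 0 < m) (hl : 0 < U.lam)
    (hφ : ∀ s a, ‖U.F.φ s a‖ ≤ 1) (hψ : ∀ s a w, ‖U.F.ψ s a w‖ ≤ 1) (K : ℕ) :
    (U.numPlanningCalls X K : ℝ) ≤ d * U.H * Real.log (1 + K / (d * U.lam))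
      + m * d * U.H * Real.log (1 + K / (m * d * U.lam)) := by
  have := Fin.pos_iff_nonempty.1 hd
  have := Fin.pos_iff_nonempty.1 hm
  refine (numPlanningCalls_le_logPotential X hl K).trans
    ((logPotential_mono X hl (U.planBefore_le X K)).trans ?_)
  calc U.logPotential X K ≤ ∑ h ∈ range U.H, (d * Real.log (1 + K / (d * U.lam))
        + m * d * Real.log (1 + K / (m * d * U.lam))) := by
        refine Finset.sum_le_sum fun h _ => add_le_add ?_ ?_
        · simpa [Lam] using gramMatrix_log_det_le (x := U.phiAt X h) (k := K) hl fun τ _ =>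
            hφ (X.st τ h) (X.ac τ h)
        · simpa [LamT, mul_comm (d : ℝ) m] using
            gramMatrix_log_det_le (x := U.psiAt X h) (k := K) hl fun τ _ =>
              hψ (X.st τ h) (X.ac τ h) (X.ctx τ)
    _ = _ := by rw [Finset.sum_const, card_range, nsmul_eq_mul]; ring

end UCBlvd

/-! ### Value functions -/

/-- Used for the random action and for the random plan index, both of which take countably many
values. -/
theorem measurable_apply_of_countable {Γ A E : Type*} {mΓ : MeasurableSpace Γ} [MeasurableSpace A]
    [Countable A] [DiscreteMeasurableSpace A] [MeasurableSpace E] {f : Γ → A} (hf : Measurable f)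
    {g : A → Γ → E} (hg : ∀ a, Measurable (g a)) : Measurable fun x => g (f x) x :=
  (measurable_from_prod_countable_left (f := fun p : Γ × A => g p.2 p.1) hg).comp
    (measurable_id.prodMk hf)

namespace ContextualMDP

variable {S A W : Type*} [MeasurableSpace S] [MeasurableSpace A] (M : ContextualMDP S A W)

theorem valueToGo_nonneg (π : ℕ → S → W → A) (w : W) :
    ∀ n h, h + n ≤ M.H → ∀ s, 0 ≤ M.valueToGo π w n h s
  | 0, _, _, _ => le_rfl
  | n + 1, h, hn, s => add_nonneg (M.r_mem h (by omega) _ _ _).1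
      (integral_nonneg fun s' => valueToGo_nonneg π w n (h + 1) (by omega) s')

theorem valueToGo_le (π : ℕ → S → W → A) (w : W) :
    ∀ n h, h + n ≤ M.H → ∀ s, M.valueToGo π w n h s ≤ n
  | 0, _, _, _ => by simp [valueToGo]
  | n + 1, h, hn, s => by
    have := M.markov h
    have h1 := (M.r_mem h (by omega) s (π h s w) w).2
    have h2 : ∫ s', M.valueToGo π w n (h + 1) s' ∂(M.P h (s, π h s w)) ≤
        ∫ _, (n : ℝ) ∂(M.P h (s, π h s w)) :=
      integral_mono_of_nonneg (ae_of_all _ (M.valueToGo_nonneg π w n (h + 1) (by omega)))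
        (integrable_const _) (ae_of_all _ (valueToGo_le π w n (h + 1) (by omega)))
    simp only [integral_const, probReal_univ, smul_eq_mul, one_mul] at h2
    rw [valueToGo]
    push_cast
    linarith

theorem value_nonneg (π : ℕ → S → W → A) {h : ℕ} (hh : h ≤ M.H) (s : S) (w : W) :
    0 ≤ M.value π h s w :=
  M.valueToGo_nonneg π w _ h (by omega) s

theorem value_le (π : ℕ → S → W → A) {h : ℕ} (hh : h ≤ M.H) (s : S) (w : W) :
    M.value π h s w ≤ M.H :=
  (M.valueToGo_le π w _ h (by omega) s).trans (by exact_mod_cast Nat.sub_le _ _)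

theorem value_horizon (π : ℕ → S → W → A) (s : S) (w : W) : M.value π M.H s w = 0 := by
  simp [value, valueToGo]

theorem value_eq (π : ℕ → S → W → A) {h : ℕ} (hh : h < M.H) (s : S) (w : W) :
    M.value π h s w = M.r h s (π h s w) w
      + ∫ s', M.value π (h + 1) s' w ∂(M.P h (s, π h s w)) := by
  unfold value
  rw [show M.H - h = (M.H - (h + 1)) + 1 by omega, valueToGo]

/-- The parameter space `Γ` will be the sample space with the past of an episode: policy and context
are random there, and the martingale of the value gaps needs joint measurability in past and state.
-/
theorem measurable_valueToGo [Countable A] [DiscreteMeasurableSpace A] {Γ : Type*}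
    {mΓ : MeasurableSpace Γ} {π : Γ → ℕ → S → W → A} {w : Γ → W}
    (hr : ∀ h < M.H, ∀ a, Measurable fun p : Γ × S => M.r h p.2 a (w p.1))
    (hπ : ∀ h < M.H, Measurable fun p : Γ × S => π p.1 h p.2 (w p.1)) :
    ∀ n h, h + n ≤ M.H → Measurable fun p : Γ × S => M.valueToGo (π p.1) (w p.1) n h p.2
  | 0, _, _ => measurable_const
  | n + 1, h, hn => by
    have := M.markov h
    have hh : h < M.H := by omega
    simp only [valueToGo]
    refine (measurable_apply_of_countable (hπ h hh) (hr h hh)).add ?_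
    have ih := measurable_valueToGo hr hπ n (h + 1) (by omega)
    let κ : Kernel (Γ × S) S := (M.P h).comap (fun p : Γ × S => (p.2, π p.1 h p.2 (w p.1)))
      (measurable_snd.prodMk (hπ h hh))
    have : IsMarkovKernel κ := by infer_instance
    have h2 : StronglyMeasurable fun q : (Γ × S) × S => M.valueToGo (π q.1.1) (w q.1.1) n (h + 1) q.2 :=
      (ih.comp ((measurable_fst.comp measurable_fst).prodMk measurable_snd)).stronglyMeasurable
    exact (h2.integral_kernel_prod_right' (κ := κ)).measurable

theorem measurable_value [Countable A] [DiscreteMeasurableSpace A] {Γ : Type*}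
    {mΓ : MeasurableSpace Γ} {π : Γ → ℕ → S → W → A} {w : Γ → W}
    (hr : ∀ h < M.H, ∀ a, Measurable fun p : Γ × S => M.r h p.2 a (w p.1))
    (hπ : ∀ h < M.H, Measurable fun p : Γ × S => π p.1 h p.2 (w p.1)) {h : ℕ} (hh : h ≤ M.H) :
    Measurable fun p : Γ × S => M.value (π p.1) h p.2 (w p.1) :=
  M.measurable_valueToGo hr hπ _ h (by omega)

theorem optValue_le [Nonempty A] {h : ℕ} {s : S} {w : W} {v : ℝ}
    (H : ∀ π : ℕ → S → W → A, (∀ h' w', Measurable fun s' => π h' s' w') → M.value π h s w ≤ v) :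
    M.optValue h s w ≤ v := by
  refine csSup_le ?_ ?_
  · exact ⟨_, fun _ _ _ => Classical.arbitrary A, fun _ _ => measurable_const, rfl⟩
  · rintro _ ⟨π, hπ, rfl⟩
    exact H π hπ

theorem optValue_le_horizon [Nonempty A] {h : ℕ} (hh : h ≤ M.H) (s : S) (w : W) :
    M.optValue h s w ≤ M.H :=
  M.optValue_le fun π _ => M.value_le π hh s w

end ContextualMDP

/-- The trivial bound, which settles the case `√K ≤ L`. -/
theorem regret_le_mul {S A W : Type*} [MeasurableSpace S] [MeasurableSpace A] [Nonempty A]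
    (M : ContextualMDP S A W) (K : ℕ) (X : History S A W) (π : ℕ → ℕ → S → W → A) :
    regret M K X π ≤ K * M.H := by
  calc regret M K X π ≤ ∑ k ∈ range K, (M.H : ℝ) := by
        refine Finset.sum_le_sum fun k _ => ?_
        have := M.optValue_le_horizon (Nat.zero_le _) (X.st k 0) (X.ctx k)
        have := M.value_nonneg (π k) (Nat.zero_le _) (X.st k 0) (X.ctx k)
        linarith
    _ = _ := by simp

/-- Settles the case `L < 1`, where the rewards vanish. -/
theorem regret_nonpos_of_reward_eq_zero {S A W : Type*} [MeasurableSpace S] [MeasurableSpace A]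
    [Nonempty A] (M : ContextualMDP S A W) (K : ℕ) (X : History S A W) (π : ℕ → ℕ → S → W → A)
    (hr : ∀ h < M.H, ∀ s a w, M.r h s a w = 0) : regret M K X π ≤ 0 := by
  have hz : ∀ (π : ℕ → S → W → A) w, ∀ n h, h + n ≤ M.H → ∀ s, M.valueToGo π w n h s = 0 := by
    intro π w n
    induction n with
    | zero => exact fun _ _ _ => rfl
    | succ n ih =>
      intro h hn s
      simp [ContextualMDP.valueToGo, hr h (by omega), ih (h + 1) (by omega)]
  refine Finset.sum_nonpos fun k _ => sub_nonpos.2 ?_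
  rw [show M.value (π k) 0 (X.st k 0) (X.ctx k) = 0 from hz _ _ _ _ (by omega) _]
  exact M.optValue_le fun π _ => (hz _ _ _ _ (by omega) _).le

/-! ### Kronecker products -/

section Kron

variable {d m : ℕ}

/-- The contraction `ξ ↦ ∑ l, ξ (·, l) y l`, adjoint to the Kronecker product with `y`. -/
def contractVec (x : EuclideanSpace ℝ (Fin d × Fin m)) (y : EuclideanSpace ℝ (Fin m)) :
    EuclideanSpace ℝ (Fin d) :=
  WithLp.toLp 2 fun i => ∑ l, x (i, l) * y l

/-- Freezing the context turns a functional that is linear in `ψ` into one that is linear in `φ`.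
This links the `ξ`-part of the planning program to its `θ`-parts. -/
theorem inner_kronVec (x : EuclideanSpace ℝ (Fin d × Fin m)) (v : EuclideanSpace ℝ (Fin d))
    (y : EuclideanSpace ℝ (Fin m)) : inner ℝ x (kronVec v y) = inner ℝ (contractVec x y) v := by
  simp only [inner_eq_dotProduct, dotProduct, kronVec, contractVec, Fintype.sum_prod_type,
    Finset.sum_mul]
  exact Finset.sum_congr rfl fun i _ => Finset.sum_congr rfl fun l _ => by ring

theorem norm_kronVec (v : EuclideanSpace ℝ (Fin d)) (y : EuclideanSpace ℝ (Fin m)) :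
    ‖kronVec v y‖ = ‖v‖ * ‖y‖ := by
  rw [← sq_eq_sq₀ (norm_nonneg _) (by positivity), mul_pow, EuclideanSpace.real_norm_sq_eq,
    EuclideanSpace.real_norm_sq_eq, EuclideanSpace.real_norm_sq_eq, Finset.sum_mul_sum,
    Fintype.sum_prod_type]
  simp [kronVec, mul_pow]

theorem norm_contractVec_le (x : EuclideanSpace ℝ (Fin d × Fin m))
    (y : EuclideanSpace ℝ (Fin m)) : ‖contractVec x y‖ ≤ ‖x‖ * ‖y‖ := by
  rw [← sq_le_sq₀ (norm_nonneg _) (by positivity), mul_pow, EuclideanSpace.real_norm_sq_eq,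
    EuclideanSpace.real_norm_sq_eq, EuclideanSpace.real_norm_sq_eq, Fintype.sum_prod_type,
    Finset.sum_mul]
  refine Finset.sum_le_sum fun i _ => ?_
  exact Finset.sum_mul_sq_le_sq_mul_sq univ (fun l => x (i, l)) fun l => y l

theorem kronVec_sum {ι : Type*} (s : Finset ι) (v : EuclideanSpace ℝ (Fin d)) (c : ι → ℝ)
    (y : ι → EuclideanSpace ℝ (Fin m)) :
    kronVec v (∑ j ∈ s, c j • y j) = ∑ j ∈ s, c j • kronVec v (y j) := by
  ext p
  simp only [kronVec, WithLp.ofLp_sum, Finset.sum_apply, WithLp.ofLp_smul, Pi.smul_apply,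
    smul_eq_mul, Finset.mul_sum]
  exact Finset.sum_congr rfl fun i _ => by ring

end Kron

/-! ### The function class of the algorithm -/

section BonusValue

theorem weightedNorm_zero {ι : Type*} [Fintype ι] (x : EuclideanSpace ℝ ι) :
    weightedNorm (0 : Matrix ι ι ℝ) x = 0 := by
  simp [weightedNorm]

/-- Negative `u` is allowed because the matrices of the grid need not be positive semidefinite. -/
theorem sqrt_add_le_sqrt_add_sqrt (u : ℝ) {t : ℝ} (ht : 0 ≤ t) : √(u + t) ≤ √u + √t := by
  rcases le_or_gt 0 u with hu | hu
  · rw [Real.sqrt_le_left (by positivity)]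
    nlinarith [Real.sq_sqrt hu, Real.sq_sqrt ht, mul_nonneg (Real.sqrt_nonneg u) (Real.sqrt_nonneg t)]
  · have h1 := Real.sqrt_nonneg u
    have h2 : √(u + t) ≤ √t := Real.sqrt_le_sqrt (by linarith)
    linarith

/-- An entrywise error `ε` moves the quadratic form by at most `ε (∑ |x i|)²`, hence by `ε` times
the dimension. The square root makes the dependence on `ε` only of order `√ε`, which the mesh of the
grid has to make up for. -/
theorem weightedNorm_le_add {ι : Type*} [Fintype ι] {B B' : Matrix ι ι ℝ} {ε : ℝ} (hε : 0 ≤ ε)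
    (h : ∀ i j, |B i j - B' i j| ≤ ε) {x : EuclideanSpace ℝ ι} (hx : ‖x‖ ≤ 1) :
    weightedNorm B x ≤ weightedNorm B' x + √(Fintype.card ι * ε) := by
  have hx2 : ∑ i, x i ^ 2 ≤ 1 := by
    rw [← EuclideanSpace.real_norm_sq_eq]
    exact pow_le_one₀ (norm_nonneg _) hx
  have h1 : (∑ i, |x i|) ^ 2 ≤ Fintype.card ι := by
    have := sq_sum_le_card_mul_sum_sq (s := univ) (f := fun i => |x i|)
    simp only [card_univ, sq_abs] at this
    refine this.trans (mul_le_of_le_one_right (Nat.cast_nonneg _) hx2)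
  have h2 : x.ofLp ⬝ᵥ (B *ᵥ x.ofLp) - x.ofLp ⬝ᵥ (B' *ᵥ x.ofLp) ≤ Fintype.card ι * ε := by
    rw [← dotProduct_sub, ← Matrix.sub_mulVec]
    simp only [dotProduct, Matrix.mulVec, Matrix.sub_apply]
    calc ∑ i, x.ofLp i * ∑ j, (B i j - B' i j) * x.ofLp j
        ≤ ∑ i, |x i| * ∑ j, ε * |x j| := by
          refine Finset.sum_le_sum fun i _ => ?_
          refine (le_abs_self _).trans ?_
          rw [abs_mul]
          gcongr
          refine (Finset.abs_sum_le_sum_abs _ _).trans (Finset.sum_le_sum fun j _ => ?_)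
          rw [abs_mul]
          gcongr
          exact h i j
      _ = (∑ i, |x i|) ^ 2 * ε := by
          rw [← Finset.mul_sum, ← Finset.sum_mul]; ring
      _ ≤ _ := by gcongr
  refine le_trans (Real.sqrt_le_sqrt (show _ ≤ x.ofLp ⬝ᵥ (B' *ᵥ x.ofLp) + Fintype.card ι * ε by
    linarith)) (sqrt_add_le_sqrt_add_sqrt _ (by positivity))

theorem measurable_weightedNorm {Γ ι : Type*} {mΓ : MeasurableSpace Γ} [Fintype ι]
    {B : Γ → Matrix ι ι ℝ} {x : Γ → EuclideanSpace ℝ ι} (hB : ∀ i j, Measurable fun γ => B γ i j)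
    (hx : Measurable x) : Measurable fun γ => weightedNorm (B γ) (x γ) := by
  have hxi : ∀ i, Measurable fun γ => (x γ).ofLp i := fun i =>
    (measurable_pi_apply i).comp ((WithLp.measurable_ofLp 2 _).comp hx)
  unfold weightedNorm
  simp only [dotProduct, Matrix.mulVec]
  exact (Finset.measurable_sum _ fun i _ => (hxi i).mul
    (Finset.measurable_sum _ fun j _ => (hB i j).mul (hxi j))).sqrt

variable {S A W : Type*} {d m n : ℕ} [Fintype A] [Nonempty A]

/-- The functions of the class of the completeness assumption, with matrix parameters `B`, `Bt`
in the place of `Λ⁻¹`, `Λ̃⁻¹`. -/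
noncomputable def bonusValue (F : Features S A W d m n) (H : ℕ) (b bt : ℝ)
    (ν : EuclideanSpace ℝ (Fin d × Fin m)) (B : Matrix (Fin d) (Fin d) ℝ)
    (Bt : Matrix (Fin d × Fin m) (Fin d × Fin m) ℝ) (s : S) (w : W) : ℝ :=
  min (univ.sup' univ_nonempty fun a =>
    max (inner ℝ ν (F.ψ s a w) + b * weightedNorm B (F.φ s a)
      + bt * weightedNorm Bt (F.ψ s a w)) 0) (H : ℝ)

variable {F : Features S A W d m n} {H : ℕ} {b bt : ℝ}

theorem bonusValue_nonneg (ν : EuclideanSpace ℝ (Fin d × Fin m)) (B : Matrix (Fin d) (Fin d) ℝ)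
    (Bt : Matrix (Fin d × Fin m) (Fin d × Fin m) ℝ) (s : S) (w : W) :
    0 ≤ bonusValue F H b bt ν B Bt s w :=
  le_min ((le_max_right _ _).trans (Finset.le_sup' (fun a =>
    max (inner ℝ ν (F.ψ s a w) + b * weightedNorm B (F.φ s a)
      + bt * weightedNorm Bt (F.ψ s a w)) 0) (mem_univ (Classical.arbitrary A))))
    (Nat.cast_nonneg _)

theorem bonusValue_le (ν : EuclideanSpace ℝ (Fin d × Fin m)) (B : Matrix (Fin d) (Fin d) ℝ)
    (Bt : Matrix (Fin d × Fin m) (Fin d × Fin m) ℝ) (s : S) (w : W) :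
    bonusValue F H b bt ν B Bt s w ≤ H := min_le_right _ _

/-- Lets the value function after the last step be treated as a member of the class. -/
theorem bonusValue_zero (s : S) (w : W) : bonusValue F H b bt 0 0 0 s w = 0 := by
  simp [bonusValue, weightedNorm_zero]

/-- A uniform shift of the linear part plus bonuses by `γ ≥ 0` passes through the truncations and
the maximum over actions without growing. -/
theorem bonusValue_le_add (hb : 0 ≤ b) (hbt : 0 ≤ bt) (hφ : ∀ s a, ‖F.φ s a‖ ≤ 1)
    (hψ : ∀ s a w, ‖F.ψ s a w‖ ≤ 1) {ν ν' : EuclideanSpace ℝ (Fin d × Fin m)}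
    {B B' : Matrix (Fin d) (Fin d) ℝ} {Bt Bt' : Matrix (Fin d × Fin m) (Fin d × Fin m) ℝ} {ε : ℝ}
    (hε : 0 ≤ ε) (hB : ∀ i j, |B i j - B' i j| ≤ ε) (hBt : ∀ i j, |Bt i j - Bt' i j| ≤ ε)
    (s : S) (w : W) :
    bonusValue F H b bt ν B Bt s w ≤ bonusValue F H b bt ν' B' Bt' s w
      + (‖ν - ν'‖ + b * √(d * ε) + bt * √(d * m * ε)) := by
  set γ := ‖ν - ν'‖ + b * √(d * ε) + bt * √(d * m * ε) with hγ
  have hγ0 : 0 ≤ γ := by positivity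
  have hq : ∀ a, inner ℝ ν (F.ψ s a w) + b * weightedNorm B (F.φ s a)
      + bt * weightedNorm Bt (F.ψ s a w) ≤ inner ℝ ν' (F.ψ s a w) + b * weightedNorm B' (F.φ s a)
      + bt * weightedNorm Bt' (F.ψ s a w) + γ := by
    intro a
    have h1 : inner ℝ ν (F.ψ s a w) - inner ℝ ν' (F.ψ s a w) ≤ ‖ν - ν'‖ := by
      rw [← inner_sub_left]
      exact (real_inner_le_norm _ _).trans (mul_le_of_le_one_right (norm_nonneg _) (hψ s a w))
    have h2 := mul_le_mul_of_nonneg_left (weightedNorm_le_add hε hB (hφ s a)) hb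
    have h3 := mul_le_mul_of_nonneg_left (weightedNorm_le_add hε hBt (hψ s a w)) hbt
    simp only [Fintype.card_fin, Fintype.card_prod, Nat.cast_mul] at h2 h3
    linarith
  unfold bonusValue
  rw [← min_add_add_right]
  refine le_min ((min_le_left _ _).trans ?_) ((min_le_right _ _).trans (by linarith))
  refine Finset.sup'_le _ _ fun a _ => ?_
  have hle := Finset.le_sup' (fun a => max (inner ℝ ν' (F.ψ s a w) + b * weightedNorm B' (F.φ s a)
      + bt * weightedNorm Bt' (F.ψ s a w)) 0) (mem_univ a)
  refine le_trans ?_ (add_le_add_left hle γ)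
  rw [← max_add_add_right]
  exact max_le_max (hq a) (by linarith)

theorem measurable_bonusValue [MeasurableSpace S] [MeasurableSpace W] {Γ : Type*}
    {mΓ : MeasurableSpace Γ} (hφ : ∀ a, Measurable fun s => F.φ s a)
    (hψ : ∀ a, Measurable fun p : S × W => F.ψ p.1 a p.2)
    {ν : Γ → EuclideanSpace ℝ (Fin d × Fin m)} {B : Γ → Matrix (Fin d) (Fin d) ℝ}
    {Bt : Γ → Matrix (Fin d × Fin m) (Fin d × Fin m) ℝ} {s : Γ → S} {w : Γ → W}
    (hν : Measurable ν) (hB : ∀ i j, Measurable fun γ => B γ i j)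
    (hBt : ∀ i j, Measurable fun γ => Bt γ i j) (hs : Measurable s) (hw : Measurable w) :
    Measurable fun γ => bonusValue F H b bt (ν γ) (B γ) (Bt γ) (s γ) (w γ) := by
  have h1 : ∀ a, Measurable fun γ => F.φ (s γ) a := fun a => (hφ a).comp hs
  have h2 : ∀ a, Measurable fun γ => F.ψ (s γ) a (w γ) := fun a => (hψ a).comp (hs.prodMk hw)
  have h3 := Finset.measurable_sup' (univ_nonempty (α := A)) (f := fun a γ =>
    max (inner ℝ (ν γ) (F.ψ (s γ) a (w γ)) + b * weightedNorm (B γ) (F.φ (s γ) a)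
      + bt * weightedNorm (Bt γ) (F.ψ (s γ) a (w γ))) 0) fun a _ =>
    (((hν.inner (h2 a)).add ((measurable_weightedNorm hB (h1 a)).const_mul b)).add
      ((measurable_weightedNorm hBt (h2 a)).const_mul bt)).max measurable_const
  refine Measurable.min ?_ measurable_const
  convert h3 using 1
  ext γ
  rw [Finset.sup'_apply]

end BonusValue

namespace UCBlvd

variable {S A W : Type*} {d m n : ℕ} [Fintype A] [Nonempty A] (U : UCBlvd S A W d m n)
  (X : History S A W)

theorem V_eq_bonusValue (k : ℕ) (ξ : ℕ → EuclideanSpace ℝ (Fin d × Fin m)) {h : ℕ} (hh : h < U.H)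
    (s : S) (w : W) : U.V X k ξ h s w = bonusValue U.F U.H (2 * U.F.L * U.β) U.βt
      (U.etaT X k h + ξ h) (U.Lam X k h)⁻¹ (U.LamT X k h)⁻¹ s w := by
  simp [V, bonusValue, Q, hh]

theorem V_of_le (k : ℕ) (ξ : ℕ → EuclideanSpace ℝ (Fin d × Fin m)) {h : ℕ} (hh : U.H ≤ h)
    (s : S) (w : W) : U.V X k ξ h s w = 0 := by
  simp [V, Q, hh.not_gt]

theorem V_nonneg (k : ℕ) (ξ : ℕ → EuclideanSpace ℝ (Fin d × Fin m)) (h : ℕ)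
    (s : S) (w : W) : 0 ≤ U.V X k ξ h s w := by
  rcases lt_or_ge h U.H with hh | hh
  · rw [U.V_eq_bonusValue X k ξ hh]; exact bonusValue_nonneg _ _ _ _ _
  · rw [U.V_of_le X k ξ hh]

theorem V_le (k : ℕ) (ξ : ℕ → EuclideanSpace ℝ (Fin d × Fin m)) (h : ℕ)
    (s : S) (w : W) : U.V X k ξ h s w ≤ U.H := min_le_right _ _

end UCBlvd

/-! ### Conditional distributions and exponential supermartingales -/

section Transition

/-- The hypothesis on rectangles identifies the joint law of `(v, Y)` as the composition of the law
of `v` with `κ`; the claim is then Fubini. -/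
theorem integral_eq_of_measure_inter_eq {Ω Γ S : Type*} [MeasurableSpace Ω] [MeasurableSpace Γ]
    [MeasurableSpace S] {μ : Measure Ω} [IsProbabilityMeasure μ] {v : Ω → Γ} (hv : Measurable v)
    {Y : Ω → S} (hY : Measurable Y) {κ : Kernel Γ S} [IsMarkovKernel κ]
    (h : ∀ B C, MeasurableSet B → MeasurableSet C →
      μ (v ⁻¹' B ∩ Y ⁻¹' C) = ∫⁻ ω in v ⁻¹' B, κ (v ω) C ∂μ)
    {f : Γ × S → ℝ} (hf : Measurable f) {c : ℝ} (hc : ∀ p, |f p| ≤ c) :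
    ∫ ω, f (v ω, Y ω) ∂μ = ∫ ω, ∫ y, f (v ω, y) ∂(κ (v ω)) ∂μ := by
  have : IsProbabilityMeasure (μ.map v) := Measure.isProbabilityMeasure_map hv.aemeasurable
  have : IsProbabilityMeasure (μ.map fun ω => (v ω, Y ω)) :=
    Measure.isProbabilityMeasure_map (hv.prodMk hY).aemeasurable
  have key : μ.map (fun ω => (v ω, Y ω)) = (μ.map v) ⊗ₘ κ := by
    refine Measure.ext_prod fun {B C} hB hC => ?_
    rw [Measure.map_apply (hv.prodMk hY) (hB.prod hC), Measure.compProd_apply_prod hB hC,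
      setLIntegral_map hB (κ.measurable_coe hC) hv, ← h B C hB hC]
    rfl
  have hint : Integrable f ((μ.map v) ⊗ₘ κ) :=
    Integrable.of_bound hf.aestronglyMeasurable c (ae_of_all _ fun p => by
      rw [Real.norm_eq_abs]; exact hc p)
  rw [← integral_map (f := f) (hv.prodMk hY).aemeasurable hf.aestronglyMeasurable, key,
    Measure.integral_compProd hint, integral_map hv.aemeasurable]
  exact (hf.stronglyMeasurable.integral_kernel_prod_right' (κ := κ)).aestronglyMeasurable

/-- If `P (u ω)` is the conditional distribution of `Y` given `m'`, expectations of functions of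
`ω` and `Y ω` that are `m'`-measurable in `ω` can be computed by integrating out `Y` first. -/
theorem integral_eq_of_condExp_indicator {Ω E S : Type*} {m' mΩ : MeasurableSpace Ω}
    (hm : m' ≤ mΩ) [MeasurableSpace E] [MeasurableSpace S] {μ : Measure Ω} [IsProbabilityMeasure μ]
    {u : Ω → E} (hu : Measurable[m'] u) {Y : Ω → S} (hY : Measurable[mΩ] Y) {P : Kernel E S}
    [IsMarkovKernel P]
    (h : ∀ B : Set S, MeasurableSet B →
      μ[Set.indicator {ω | Y ω ∈ B} (fun _ => (1 : ℝ)) | m'] =ᵐ[μ] fun ω => (P (u ω)).real B)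
    {f : Ω × S → ℝ} (hf : Measurable[m'.prod inferInstance] f) {c : ℝ} (hc : ∀ p, |f p| ≤ c) :
    ∫ ω, f (ω, Y ω) ∂μ = ∫ ω, ∫ y, f (ω, y) ∂(P (u ω)) ∂μ := by
  let κ : @Kernel Ω S m' _ := @Kernel.comap _ _ _ _ _ m' P u hu
  have hκ : @IsMarkovKernel _ _ m' _ κ := @Kernel.IsMarkovKernel.comap _ _ _ _ _ m' u P _ hu
  -- Here `v` is the identity, seen as a map from `Ω` with its full σ-algebra to `Ω` with the
  -- σ-algebra of the past. Integrands may thus depend on the entire past.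
  refine @integral_eq_of_measure_inter_eq Ω Ω S mΩ m' _ μ _ id (fun s hs => hm s hs) Y hY κ hκ
    ?_ f hf c hc
  intro B C hB hC
  have hBΩ : MeasurableSet[mΩ] B := hm _ hB
  have hYC : MeasurableSet[mΩ] {ω | Y ω ∈ C} := hY hC
  have hmeas : Measurable[mΩ] fun ω => P (u ω) C := (P.measurable_coe hC).comp (hu.mono hm le_rfl)
  have h1 : ∫ ω in B, (Set.indicator {ω | Y ω ∈ C} (fun _ => (1 : ℝ))) ω ∂μ
      = ∫ ω in B, (P (u ω)).real C ∂μ := by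
    rw [← setIntegral_condExp hm ((integrable_const (1 : ℝ)).indicator hYC) hB]
    exact setIntegral_congr_ae hBΩ ((h C hC).mono fun ω hω _ => hω)
  have h2 : ∫ ω in B, (Set.indicator {ω | Y ω ∈ C} (fun _ => (1 : ℝ))) ω ∂μ
      = μ.real (B ∩ {ω | Y ω ∈ C}) := by
    rw [integral_indicator (μ := μ.restrict B) hYC]
    simp [measureReal_restrict_apply hYC, Set.inter_comm]
  have h3 : ∫ ω in B, (P (u ω)).real C ∂μ = (∫⁻ ω in B, P (u ω) C ∂μ).toReal := by
    rw [← integral_toReal hmeas.aemeasurable (ae_of_all _ fun ω => measure_lt_top _ _)]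
    rfl
  have h4 : ∫⁻ ω in B, P (u ω) C ∂μ ≠ ⊤ := by
    refine ne_top_of_le_ne_top (b := ∫⁻ ω in B, 1 ∂μ) ?_ (lintegral_mono fun ω => prob_le_one)
    simp
  have h5 : μ (B ∩ {ω | Y ω ∈ C}) = ∫⁻ ω in B, P (u ω) C ∂μ := by
    rw [← ENNReal.toReal_eq_toReal_iff' (measure_ne_top _ _) h4, ← h3, ← h1, h2]
    rfl
  exact h5

end Transition

/-! ### Exponential moments of compensated martingale sums. -/

section ExpSupermartingale

/-- Takes the place of Hoeffding's lemma: the linear term has conditional mean zero, and the square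
is dominated by a predictable quantity. -/
theorem exp_le_add_exp_sq (y : ℝ) : Real.exp y ≤ y + Real.exp (y ^ 2) := by
  have h2 := Real.add_one_le_exp (y ^ 2)
  rcases le_or_gt |y| 1 with h | h
  · have := (abs_le.1 (Real.abs_exp_sub_one_sub_id_le h)).2
    linarith
  · rcases lt_abs.1 h with h | h
    · have : Real.exp y ≤ Real.exp (y ^ 2) := Real.exp_le_exp.2 (by nlinarith)
      linarith
    · have : Real.exp y ≤ 1 := Real.exp_le_one_iff.2 (by linarith)
      nlinarith

variable {Ω : Type*} {mΩ : MeasurableSpace Ω} {μ : Measure Ω} [IsProbabilityMeasure μ]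
  {𝒢 : Filtration ℕ mΩ} {n : ℕ} {Y q : ℕ → Ω → ℝ} {c : ℝ}

theorem measurable_sum_sub_sq (hq : ∀ t < n, Measurable[𝒢 t] (q t))
    (hY : ∀ t < n, Measurable[𝒢 (t + 1)] (Y t)) {k : ℕ} (hk : k ≤ n) :
    Measurable[𝒢 k] fun ω => ∑ t ∈ range k, (Y t ω - q t ω ^ 2) := by
  refine Finset.measurable_sum _ fun t ht => ?_
  have htk := mem_range.1 ht
  exact ((hY t (by omega)).mono (𝒢.mono (by omega)) le_rfl).sub
    (((hq t (by omega)).mono (𝒢.mono (by omega)) le_rfl).pow_const 2)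

/-- A sum of martingale differences `Y t`, bounded by predictable `q t`, has compensated
exponential moment at most `1`. -/
theorem integral_exp_sum_sub_sq_le_one (hq : ∀ t < n, Measurable[𝒢 t] (q t))
    (hY : ∀ t < n, Measurable[𝒢 (t + 1)] (Y t)) (hYq : ∀ t < n, ∀ ω, |Y t ω| ≤ q t ω)
    (hqc : ∀ t < n, ∀ ω, q t ω ≤ c)
    (hmart : ∀ t < n, ∀ Z : Ω → ℝ, Measurable[𝒢 t] Z → (∃ C, ∀ ω, |Z ω| ≤ C) →
      ∫ ω, Z ω * Y t ω ∂μ = 0) {k : ℕ} (hk : k ≤ n) :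
    ∫ ω, Real.exp (∑ t ∈ range k, (Y t ω - q t ω ^ 2)) ∂μ ≤ 1 := by
  induction k with
  | zero => simp
  | succ k ih =>
    have hkn : k < n := by omega
    set Z : Ω → ℝ := fun ω => Real.exp (∑ t ∈ range k, (Y t ω - q t ω ^ 2)) with hZ
    have hbd : ∀ j ≤ n, ∀ ω, ∑ t ∈ range j, (Y t ω - q t ω ^ 2) ≤ j * c := by
      intro j hj ω
      calc _ ≤ ∑ t ∈ range j, c := Finset.sum_le_sum fun t ht => by
            have ht' : t < n := by have := mem_range.1 ht; omega
            have := (abs_le.1 (hYq t ht' ω)).2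
            have := hqc t ht' ω
            nlinarith [sq_nonneg (q t ω)]
        _ = _ := by simp
    have hZm : Measurable[𝒢 k] Z := (measurable_sum_sub_sq hq hY hkn.le).exp
    have hZΩ : Measurable Z := hZm.mono (𝒢.le k) le_rfl
    have hqΩ : Measurable (q k) := (hq k hkn).mono (𝒢.le k) le_rfl
    have hYΩ : Measurable (Y k) := (hY k hkn).mono (𝒢.le _) le_rfl
    have hZ0 : ∀ ω, 0 ≤ Z ω := fun ω => (Real.exp_pos _).le
    have hZb : ∀ ω, Z ω ≤ Real.exp (k * c) := fun ω => Real.exp_le_exp.2 (hbd k hkn.le ω)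
    have hZi : Integrable Z μ := Integrable.of_bound hZΩ.aestronglyMeasurable (Real.exp (k * c))
      (ae_of_all _ fun ω => by rw [Real.norm_eq_abs, abs_of_nonneg (hZ0 ω)]; exact hZb ω)
    have he1 : ∀ ω, Real.exp (-q k ω ^ 2) ≤ 1 := fun ω =>
      Real.exp_le_one_iff.2 (by nlinarith [sq_nonneg (q k ω)])
    have hZe0 : ∀ ω, 0 ≤ Z ω * Real.exp (-q k ω ^ 2) := fun ω =>
      mul_nonneg (hZ0 ω) (Real.exp_pos _).le
    have hZeb : ∀ ω, Z ω * Real.exp (-q k ω ^ 2) ≤ Real.exp (k * c) := fun ω =>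
      (mul_le_of_le_one_right (hZ0 ω) (he1 ω)).trans (hZb ω)
    have hZe : Measurable[𝒢 k] fun ω => Z ω * Real.exp (-q k ω ^ 2) :=
      hZm.mul ((hq k hkn).pow_const 2).neg.exp
    have hzero := hmart k hkn _ hZe
      ⟨Real.exp (k * c), fun ω => by rw [abs_of_nonneg (hZe0 ω)]; exact hZeb ω⟩
    have hZYi : Integrable (fun ω => Z ω * Real.exp (-q k ω ^ 2) * Y k ω) μ := by
      refine Integrable.of_bound ((hZe.mono (𝒢.le k) le_rfl).mul hYΩ).aestronglyMeasurable
        (Real.exp (k * c) * c) (ae_of_all _ fun ω => ?_)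
      rw [Real.norm_eq_abs, abs_mul, abs_of_nonneg (hZe0 ω)]
      exact mul_le_mul (hZeb ω) ((hYq k hkn ω).trans (hqc k hkn ω)) (abs_nonneg _)
        (Real.exp_pos _).le
    -- Multiplied by the predictable weight `Z exp (-q²)`, the linear term integrates to zero and
    -- `exp (q²)` cancels, so the moment does not increase.
    calc ∫ ω, Real.exp (∑ t ∈ range (k + 1), (Y t ω - q t ω ^ 2)) ∂μ
        ≤ ∫ ω, (Z ω * Real.exp (-q k ω ^ 2) * Y k ω + Z ω) ∂μ := by
          refine integral_mono_of_nonneg (ae_of_all _ fun ω => (Real.exp_pos _).le)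
            (hZYi.add hZi) (ae_of_all _ fun ω => ?_)
          simp only
          rw [Finset.sum_range_succ, Real.exp_add, sub_eq_add_neg, add_comm (Y k ω), Real.exp_add]
          have h1 : Real.exp (Y k ω) ≤ Y k ω + Real.exp (q k ω ^ 2) := by
            refine (exp_le_add_exp_sq _).trans (add_le_add_right (Real.exp_le_exp.2 ?_) _)
            exact sq_le_sq' (abs_le.1 (hYq k hkn ω)).1 (abs_le.1 (hYq k hkn ω)).2
          have h2 : Real.exp (-q k ω ^ 2) * Real.exp (q k ω ^ 2) = 1 := by
            rw [← Real.exp_add]; simp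
          have h3 := mul_le_mul_of_nonneg_left h1 (hZe0 ω)
          calc _ = Z ω * Real.exp (-q k ω ^ 2) * Real.exp (Y k ω) := by rw [hZ]; ring
            _ ≤ _ := h3
            _ = Z ω * Real.exp (-q k ω ^ 2) * Y k ω
                + Z ω * (Real.exp (-q k ω ^ 2) * Real.exp (q k ω ^ 2)) := by ring
            _ = _ := by rw [h2, mul_one]
      _ = ∫ ω, Z ω ∂μ := by rw [integral_add hZYi hZi, hzero, zero_add]
      _ ≤ 1 := ih (by omega)

/-- Markov's inequality for the exponential. The compensator stays random, and this is what later
allows it to be absorbed in the quadratic form of the Gram matrix. -/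
theorem measureReal_lt_sum_sub_sq_le (hq : ∀ t < n, Measurable[𝒢 t] (q t))
    (hY : ∀ t < n, Measurable[𝒢 (t + 1)] (Y t)) (hYq : ∀ t < n, ∀ ω, |Y t ω| ≤ q t ω)
    (hqc : ∀ t < n, ∀ ω, q t ω ≤ c)
    (hmart : ∀ t < n, ∀ Z : Ω → ℝ, Measurable[𝒢 t] Z → (∃ C, ∀ ω, |Z ω| ≤ C) →
      ∫ ω, Z ω * Y t ω ∂μ = 0) (x : ℝ) :
    μ.real {ω | x < ∑ t ∈ range n, (Y t ω - q t ω ^ 2)} ≤ Real.exp (-x) := by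
  have h1 := integral_exp_sum_sub_sq_le_one hq hY hYq hqc hmart le_rfl
  set Φ : Ω → ℝ := fun ω => ∑ t ∈ range n, (Y t ω - q t ω ^ 2) with hΦ
  have hΦm : Measurable Φ := (measurable_sum_sub_sq hq hY le_rfl).mono (𝒢.le n) le_rfl
  have hi : Integrable (fun ω => Real.exp (Φ ω)) μ := by
    refine Integrable.of_bound hΦm.exp.aestronglyMeasurable (Real.exp (n * c))
      (ae_of_all _ fun ω => ?_)
    rw [Real.norm_eq_abs, abs_of_nonneg (Real.exp_pos _).le]
    refine Real.exp_le_exp.2 ?_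
    calc _ ≤ ∑ t ∈ range n, c := Finset.sum_le_sum fun t ht => by
          have ht' := mem_range.1 ht
          have := (abs_le.1 (hYq t ht' ω)).2
          have := hqc t ht' ω
          nlinarith [sq_nonneg (q t ω)]
      _ = _ := by simp
  have h2 := mul_meas_ge_le_integral_of_nonneg (ae_of_all _ fun ω => (Real.exp_pos (Φ ω)).le) hi
    (Real.exp x)
  have h3 : μ.real {ω | x < Φ ω} ≤ μ.real {ω | Real.exp x ≤ Real.exp (Φ ω)} :=
    measureReal_mono fun ω hω => Real.exp_le_exp.2 (le_of_lt hω)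
  rw [Real.exp_neg, ← one_div, le_div_iff₀ (Real.exp_pos _), mul_comm]
  exact (mul_le_mul_of_nonneg_left h3 (Real.exp_pos _).le).trans (h2.trans h1)

end ExpSupermartingale

section Transition

/-- The integral of a function against a conditional distribution is measurable in the past. -/
theorem measurable_integral_kernel {Ω E S : Type*} {m' : MeasurableSpace Ω} [MeasurableSpace E]
    [MeasurableSpace S] {u : Ω → E} (hu : Measurable u) {P : Kernel E S} [IsMarkovKernel P]
    {f : Ω × S → ℝ} (hf : Measurable f) : Measurable fun ω => ∫ y, f (ω, y) ∂(P (u ω)) :=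
  (hf.stronglyMeasurable.integral_kernel_prod_right' (κ := P.comap u hu)).measurable

theorem abs_integral_le_of_abs_le {S : Type*} [MeasurableSpace S] {P : Measure S}
    [IsProbabilityMeasure P] {f : S → ℝ} {c : ℝ} (hc : ∀ y, |f y| ≤ c) : |∫ y, f y ∂P| ≤ c := by
  have := norm_integral_le_of_norm_le_const (μ := P) (f := f) (C := c) (ae_of_all _ hc)
  simpa using this

/-- The difference of `f (ω, Y ω)` and its conditional expectation is orthogonal to the past. -/
theorem integral_mul_sub_integral_eq_zero {Ω E S : Type*} {m' mΩ : MeasurableSpace Ω}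
    (hm : m' ≤ mΩ) [MeasurableSpace E] [MeasurableSpace S] {μ : Measure Ω} [IsProbabilityMeasure μ]
    {u : Ω → E} (hu : Measurable[m'] u) {Y : Ω → S} (hY : Measurable[mΩ] Y) {P : Kernel E S}
    [IsMarkovKernel P]
    (h : ∀ B : Set S, MeasurableSet B →
      μ[Set.indicator {ω | Y ω ∈ B} (fun _ => (1 : ℝ)) | m'] =ᵐ[μ] fun ω => (P (u ω)).real B)
    {f : Ω × S → ℝ} (hf : Measurable[m'.prod inferInstance] f) {c : ℝ} (hc : ∀ p, |f p| ≤ c)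
    {Z : Ω → ℝ} (hZ : Measurable[m'] Z) {C : ℝ} (hZC : ∀ ω, |Z ω| ≤ C) :
    ∫ ω, Z ω * (f (ω, Y ω) - ∫ y, f (ω, y) ∂(P (u ω))) ∂μ = 0 := by
  have hfst : @Measurable (Ω × S) Ω (m'.prod inferInstance) m' Prod.fst :=
    @measurable_fst Ω S m' inferInstance
  have hg : Measurable[m'.prod inferInstance] fun p : Ω × S =>
      Z p.1 * (f p - ∫ y, f (p.1, y) ∂(P (u p.1))) :=
    (hZ.comp hfst).mul (hf.sub ((@measurable_integral_kernel Ω E S m' _ _ u hu P _ f hf).comp hfst))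
  have hI : ∀ ω, |∫ y, f (ω, y) ∂(P (u ω))| ≤ c := fun ω =>
    abs_integral_le_of_abs_le fun y => hc (ω, y)
  have hgc : ∀ p : Ω × S, |Z p.1 * (f p - ∫ y, f (p.1, y) ∂(P (u p.1)))| ≤ C * (2 * c) := by
    intro p
    rw [abs_mul]
    have h1 := abs_sub (f p) (∫ y, f (p.1, y) ∂(P (u p.1)))
    exact mul_le_mul (hZC _) (by linarith [hc p, hI p.1]) (abs_nonneg _)
      ((abs_nonneg _).trans (hZC p.1))
  rw [integral_eq_of_condExp_indicator hm hu hY h hg hgc]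
  refine integral_eq_zero_of_ae (ae_of_all _ fun ω => ?_)
  have hfi : Integrable (fun y => f (ω, y)) (P (u ω)) := by
    have : Measurable fun y => f (ω, y) := hf.comp (@measurable_prodMk_left Ω S m' _ ω)
    exact Integrable.of_bound this.aestronglyMeasurable c (ae_of_all _ fun y => hc (ω, y))
  simp only [Pi.zero_apply]
  rw [integral_const_mul, integral_sub hfi (integrable_const _)]
  simp

end Transition

/-! ### Grids -/

/-- The grid consists of the multiples of `ε` with index between `-⌈R / ε⌉` and `⌈R / ε⌉`, and
points are rounded down coordinatewise. -/
theorem exists_grid (ι : Type*) [Fintype ι] {R ε : ℝ} (hR : 0 ≤ R) (hε : 0 < ε) :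
    ∃ N : Finset (ι → ℝ), (#N : ℝ) ≤ (2 * R / ε + 3) ^ Fintype.card ι ∧
      ∀ p : ι → ℝ, (∀ i, |p i| ≤ R) → ∃ p' ∈ N, ∀ i, |p i - p' i| ≤ ε := by
  classical
  set a : ℕ := ⌈R / ε⌉₊ with ha
  have ha1 : R / ε ≤ a := Nat.le_ceil _
  have ha2 : (a : ℝ) < R / ε + 1 := Nat.ceil_lt_add_one (by positivity)
  refine ⟨(Fintype.piFinset fun _ : ι => Finset.Icc (-(a : ℤ)) a).image
    fun z i => ε * (z i : ℝ), ?_, ?_⟩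
  · have h1 : #((Fintype.piFinset fun _ : ι => Finset.Icc (-(a : ℤ)) a).image
        fun z i => ε * (z i : ℝ)) ≤ (2 * a + 1) ^ Fintype.card ι := by
      refine Finset.card_image_le.trans (le_of_eq ?_)
      rw [Fintype.card_piFinset]
      simp only [Int.card_Icc, prod_const, card_univ]
      congr 1
      omega
    calc _ ≤ (((2 * a + 1) ^ Fintype.card ι : ℕ) : ℝ) := by exact_mod_cast h1
      _ = (2 * (a : ℝ) + 1) ^ Fintype.card ι := by push_cast; rfl
      _ ≤ _ := by
        gcongr ?_ ^ _
        rw [mul_div_assoc]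
        linarith
  · intro p hp
    refine ⟨fun i => ε * (⌊p i / ε⌋ : ℝ), ?_, fun i => ?_⟩
    · refine Finset.mem_image.2 ⟨fun i => ⌊p i / ε⌋, ?_, rfl⟩
      rw [Fintype.mem_piFinset]
      intro i
      have h1 := abs_le.1 (hp i)
      have h2 : -(a : ℝ) ≤ p i / ε := by
        have : -(R / ε) ≤ p i / ε := by rw [← neg_div]; gcongr; exact h1.1
        linarith
      have h3 : p i / ε ≤ a := le_trans (by gcongr; exact h1.2) ha1
      rw [Finset.mem_Icc]
      refine ⟨Int.le_floor.2 (by push_cast; exact h2), ?_⟩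
      have : (⌊p i / ε⌋ : ℝ) ≤ ((a : ℤ) : ℝ) := (Int.floor_le _).trans (by push_cast; exact h3)
      exact_mod_cast this
    · have h1 := Int.floor_le (p i / ε)
      have h2 := (Int.lt_floor_add_one (p i / ε)).le
      have h3 : p i = ε * (p i / ε) := by field_simp
      have h4 : p i - ε * (⌊p i / ε⌋ : ℝ) = ε * (p i / ε - ⌊p i / ε⌋) := by
        rw [mul_sub, ← h3]
      rw [h4, abs_mul, abs_of_pos hε, abs_of_nonneg (by linarith)]
      exact mul_le_of_le_one_right hε.le (by linarith)

theorem norm_le_card_mul_of_forall_le {ι : Type*} [Fintype ι] {v : EuclideanSpace ℝ ι} {ε : ℝ}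
    (h : ∀ i, |v i| ≤ ε) : ‖v‖ ≤ Fintype.card ι * ε := by
  calc ‖v‖ ≤ ∑ i, |v i| := by
        rw [EuclideanSpace.norm_eq]
        refine Real.sqrt_le_iff.2 ⟨Finset.sum_nonneg fun _ _ => abs_nonneg _, ?_⟩
        simpa using Finset.sum_sq_le_sq_sum_of_nonneg (s := univ) (f := fun i => |v i|)
          fun i _ => abs_nonneg _
    _ ≤ ∑ i : ι, ε := Finset.sum_le_sum fun i _ => h i
    _ = _ := by simp

/-! ### Regularized least squares -/

section Ridge

variable {ι : Type*} [Fintype ι] [DecidableEq ι] {x : ℕ → EuclideanSpace ℝ ι} {y : ℕ → ℝ} {k : ℕ}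

theorem norm_ridge_le {c : ℝ} (hc : 0 ≤ c) (hx : ∀ τ < k, ‖x τ‖ ≤ 1) (hy : ∀ τ < k, |y τ| ≤ c) :
    ‖ridge 1 x y k‖ ≤ k * c := by
  refine (norm_gramMatrix_inv_mulVec_le _).trans ((norm_sum_le _ _).trans ?_)
  calc ∑ τ ∈ range k, ‖y τ • x τ‖ ≤ ∑ τ ∈ range k, c := by
        refine Finset.sum_le_sum fun τ hτ => ?_
        have hτ := mem_range.1 hτ
        rw [norm_smul, Real.norm_eq_abs]
        calc _ ≤ c * 1 := mul_le_mul (hy τ hτ) (hx τ hτ) (norm_nonneg _) hc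
          _ = c := mul_one c
    _ = k * c := by simp

theorem weightedNorm_sq_eq (z : EuclideanSpace ℝ ι) : weightedNorm (gramMatrix 1 x k) z ^ 2
    = ‖z‖ ^ 2 + ∑ τ ∈ range k, (inner ℝ z (x τ)) ^ 2 := by
  rw [weightedNorm, Real.sq_sqrt ((gramMatrix_posDef one_pos).quad_nonneg _), gramMatrix_quad,
    one_mul, norm_sq_eq_dotProduct]
  simp only [inner_eq_dotProduct, dotProduct_comm]

theorem norm_le_weightedNorm (z : EuclideanSpace ℝ ι) :
    ‖z‖ ≤ weightedNorm (gramMatrix 1 x k) z := by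
  rw [← sq_le_sq₀ (norm_nonneg _) (weightedNorm_nonneg _ _), weightedNorm_sq_eq]
  exact le_add_of_nonneg_right (Finset.sum_nonneg fun _ _ => sq_nonneg _)

/-- The error of the regularized least squares estimate. -/
theorem weightedNorm_ridge_sub_sq (θ : EuclideanSpace ℝ ι) :
    weightedNorm (gramMatrix 1 x k) (ridge 1 x y k - θ) ^ 2
      = ∑ τ ∈ range k, (y τ - inner ℝ θ (x τ)) * inner ℝ (ridge 1 x y k - θ) (x τ)
        - inner ℝ (ridge 1 x y k - θ) θ := by
  set u := ridge 1 x y k - θ with hu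
  have hpd := gramMatrix_posDef (x := x) (k := k) one_pos
  have h1 : gramMatrix 1 x k *ᵥ u.ofLp
      -- The Gram matrix maps the error to the accumulated noise minus the regularization bias `θ`;
      -- pairing with the error gives the identity.
      = (∑ τ ∈ range k, (y τ - inner ℝ θ (x τ)) • x τ).ofLp - θ.ofLp := by
    have e : u.ofLp = (gramMatrix 1 x k)⁻¹ *ᵥ (∑ τ ∈ range k, y τ • x τ).ofLp - θ.ofLp := rfl
    rw [e, Matrix.mulVec_sub, hpd.inv_mulVec_self, gramMatrix_mulVec, one_smul]
    simp only [sub_smul, Finset.sum_sub_distrib, inner_eq_dotProduct, WithLp.ofLp_sub,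
      WithLp.ofLp_sum, WithLp.ofLp_smul, dotProduct_comm θ.ofLp]
    abel
  rw [weightedNorm, Real.sq_sqrt (hpd.quad_nonneg _), h1, dotProduct_sub, ← inner_eq_dotProduct,
    ← inner_eq_dotProduct, inner_sum]
  simp only [inner_smul_right]

/-- A bound for the compensated noise in the direction of the error of the estimate yields a bound
for the error itself. -/
theorem weightedNorm_ridge_sub_sq_le (θ : EuclideanSpace ℝ ι) {c b : ℝ} (hc : 0 < c)
    (h : ∑ τ ∈ range k, (inner ℝ ((2 * c ^ 2)⁻¹ • (ridge 1 x y k - θ)) (x τ)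
        * (y τ - inner ℝ θ (x τ))
        - (c * |inner ℝ ((2 * c ^ 2)⁻¹ • (ridge 1 x y k - θ)) (x τ)|) ^ 2) ≤ b) :
    weightedNorm (gramMatrix 1 x k) (ridge 1 x y k - θ) ^ 2 ≤ 4 * c ^ 2 * b + ‖θ‖ ^ 2 := by
  have h1 := weightedNorm_ridge_sub_sq (x := x) (y := y) (k := k) θ
  set u := ridge 1 x y k - θ with hu
  have h2 := weightedNorm_sq_eq (x := x) (k := k) u
  -- With the scaling `(2 c²)⁻¹` the compensator is half of `∑ ⟨u, x τ⟩²`. Half of the quadratic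
  -- form of `u` therefore survives on the left; the bias term takes `‖u‖² / 2` by the inequality `2
  -- ‖u‖ ‖θ‖ ≤ ‖u‖² + ‖θ‖²`.
  have h3 : ∑ τ ∈ range k, (inner ℝ ((2 * c ^ 2)⁻¹ • u) (x τ) * (y τ - inner ℝ θ (x τ))
      - (c * |inner ℝ ((2 * c ^ 2)⁻¹ • u) (x τ)|) ^ 2) = (2 * c ^ 2)⁻¹ *
        (∑ τ ∈ range k, (y τ - inner ℝ θ (x τ)) * inner ℝ u (x τ)
          - 2⁻¹ * ∑ τ ∈ range k, (inner ℝ u (x τ)) ^ 2) := by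
    rw [mul_sub, Finset.mul_sum, Finset.mul_sum, Finset.mul_sum, ← Finset.sum_sub_distrib]
    refine Finset.sum_congr rfl fun τ _ => ?_
    rw [real_inner_smul_left, mul_pow, sq_abs]
    field_simp
  rw [h3, inv_mul_le_iff₀ (by positivity)] at h
  have h4 : -inner ℝ u θ ≤ ‖u‖ * ‖θ‖ := by
    have := abs_real_inner_le_norm u θ
    exact (neg_le_abs _).trans this
  have := sq_nonneg (‖u‖ - ‖θ‖)
  nlinarith

/-- Without noise only the regularization bias remains. Rewards are observed exactly, which is why
`β̃ = √(m d)` suffices. -/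
theorem weightedNorm_ridge_sub_le_of_exact {θ : EuclideanSpace ℝ ι}
    (hy : ∀ τ < k, y τ = inner ℝ θ (x τ)) :
    weightedNorm (gramMatrix 1 x k) (ridge 1 x y k - θ) ≤ ‖θ‖ := by
  have h := weightedNorm_ridge_sub_sq_le (x := x) (y := y) (k := k) θ (b := 0) one_pos
    (Finset.sum_nonpos fun τ hτ => by
      rw [hy τ (mem_range.1 hτ)]
      nlinarith [sq_nonneg (1 * |inner ℝ ((2 * 1 ^ 2 : ℝ)⁻¹ • (ridge 1 x y k - θ)) (x τ)|)])
  rw [mul_zero, zero_add] at h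
  exact (sq_le_sq₀ (weightedNorm_nonneg _ _) (norm_nonneg _)).1 h

end Ridge

/-! ### Consequences of the structural assumptions -/

theorem weightedNorm_sub_comm {ι : Type*} [Fintype ι] (B : Matrix ι ι ℝ)
    (x y : EuclideanSpace ℝ ι) : weightedNorm B (x - y) = weightedNorm B (y - x) := by
  rw [← neg_sub y x, weightedNorm, weightedNorm, WithLp.ofLp_neg, Matrix.mulVec_neg,
    neg_dotProduct_neg]

section Structure

variable {S A W : Type*} [MeasurableSpace S] [MeasurableSpace A] {d m n : ℕ}
  {M : ContextualMDP S A W} {F : Features S A W d m n} {ρ : W → EuclideanSpace ℝ (Fin m)}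

theorem IsMapping.psi_eq_sum (hρ : IsMapping F ρ) (w : W) :
    ∃ c : Fin n → ℝ, ∑ j, |c j| ≤ F.L ∧
      ∀ s a, F.ψ s a w = ∑ j, c j • F.ψ s a (F.wrep j) := by
  obtain ⟨c, hc, hL⟩ := hρ.span w
  refine ⟨c, hL, fun s a => ?_⟩
  simp only [hρ.kron, hc, kronVec_sum]

theorem IsMapping.L_nonneg [hW : Nonempty W] (hρ : IsMapping F ρ) : 0 ≤ F.L := by
  obtain ⟨c, -, hL⟩ := hρ.span (Classical.arbitrary W)
  exact (Finset.sum_nonneg fun _ _ => abs_nonneg _).trans hL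

/-- If `L < 1`, the representative contexts are contractions of each other, so `ρ` vanishes. -/
theorem IsMapping.rho_eq_zero_of_L_lt_one (hρ : IsMapping F ρ) (hL : F.L < 1) (w : W) :
    ρ w = 0 := by
  have hrep : ∀ j, ρ (F.wrep j) = 0 := by
    intro j0
    have : Nonempty (Fin n) := ⟨j0⟩
    -- A representative of maximal norm satisfies `‖ρ‖ ≤ L ‖ρ‖`, so it is zero.
    obtain ⟨j, hj⟩ := Finite.exists_max fun j => ‖ρ (F.wrep j)‖
    obtain ⟨c, hc, hcL⟩ := hρ.span (F.wrep j)
    have h1 : ‖ρ (F.wrep j)‖ ≤ F.L * ‖ρ (F.wrep j)‖ := by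
      calc ‖ρ (F.wrep j)‖ ≤ ∑ i, ‖c i • ρ (F.wrep i)‖ := by
            conv_lhs => rw [hc]
            exact norm_sum_le _ _
        _ ≤ ∑ i, |c i| * ‖ρ (F.wrep j)‖ := by
            refine Finset.sum_le_sum fun i _ => ?_
            rw [norm_smul, Real.norm_eq_abs]
            gcongr
            exact hj i
        _ = (∑ i, |c i|) * ‖ρ (F.wrep j)‖ := by rw [Finset.sum_mul]
        _ ≤ _ := by gcongr
    have h2 : ‖ρ (F.wrep j)‖ ≤ 0 := by
      by_contra h
      push Not at h
      nlinarith
    exact norm_le_zero_iff.1 ((hj j0).trans h2)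
  obtain ⟨c, hc, -⟩ := hρ.span w
  simp [hc, hrep]

/-- Linear independence of the features on `𝒟` determines functions that are linear in `φ`. -/
theorem inner_phi_eq_of_eq_on_D
    (hD : LinearIndependent ℝ fun i => F.φ (F.D i).1 (F.D i).2) {u v : EuclideanSpace ℝ (Fin d)}
    (h : ∀ i, inner ℝ u (F.φ (F.D i).1 (F.D i).2) = inner ℝ v (F.φ (F.D i).1 (F.D i).2)) :
    u = v := by
  rcases Nat.eq_zero_or_pos d with rfl | hd
  · exact Subsingleton.elim _ _
  have := Fin.pos_iff_nonempty.1 hd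
  let b := basisOfLinearIndependentOfCardEqFinrank hD (by simp)
  refine InnerProductSpace.ext_inner_left_basis b fun i => ?_
  simpa [b, real_inner_comm] using h i

variable [MeasurableSpace W] [Fintype A] [Nonempty A]

theorem StandingAssumptions.norm_phi_le (hA : StandingAssumptions M F) (s : S) (a : A) :
    ‖F.φ s a‖ ≤ 1 := by
  obtain ⟨_, _, _, hb⟩ := hA.linear
  exact hb.phi s a

theorem StandingAssumptions.norm_psi_le (hA : StandingAssumptions M F) (s : S) (a : A) (w : W) :
    ‖F.ψ s a w‖ ≤ 1 := by
  obtain ⟨_, _, _, hb⟩ := hA.linear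
  exact hb.psi s a w

theorem StandingAssumptions.exists_reward_eq (hA : StandingAssumptions M F) :
    ∃ η : ℕ → EuclideanSpace ℝ (Fin d × Fin m), ∀ h < M.H, ‖η h‖ ≤ √((m : ℝ) * d) ∧
      ∀ s a w, M.r h s a w = inner ℝ (η h) (F.ψ s a w) := by
  obtain ⟨_, η, hl, hb⟩ := hA.linear
  exact ⟨η, fun h hh => ⟨hb.eta h hh, hl.reward h hh⟩⟩

theorem StandingAssumptions.measurable_reward (hA : StandingAssumptions M F) {Γ : Type*}
    {mΓ : MeasurableSpace Γ} {s : Γ → S} (hs : Measurable s) {w : Γ → W} (hw : Measurable w) {h : ℕ}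
    (hh : h < M.H) (a : A) : Measurable fun p => M.r h (s p) a (w p) := by
  obtain ⟨η, hη⟩ := hA.exists_reward_eq
  simp only [(hη h hh).2]
  exact measurable_const.inner ((hA.psi_meas a).comp (hs.prodMk hw))

/-- Total mass `1` is the inner product of `φ` with a vector of norm at most `√d`. Features bounded
away from zero turn the bound on `ψ = φ ⊗ ρ` into one on `ρ`. -/
theorem StandingAssumptions.one_le_norm_phi (hA : StandingAssumptions M F) (hH : 0 < M.H) (s : S)
    (a : A) : 1 ≤ √(d : ℝ) * ‖F.φ s a‖ := by
  obtain ⟨μ, _, hl, hb⟩ := hA.linear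
  have := M.markov 0
  have h1 := hl.transition 0 hH s a Set.univ MeasurableSet.univ
  rw [probReal_univ] at h1
  have h2 : inner ℝ (WithLp.toLp 2 fun i => (μ 0 i).real Set.univ : EuclideanSpace ℝ (Fin d))
      (F.φ s a) = 1 := by rw [h1, inner_eq_dotProduct]; rfl
  rw [← h2]
  exact (real_inner_le_norm _ _).trans
    (mul_le_mul_of_nonneg_right (hb.measure 0 hH) (norm_nonneg _))

theorem StandingAssumptions.norm_rho_le (hA : StandingAssumptions M F) (hρ : IsMapping F ρ)
    (hH : 0 < M.H) (hd : 0 < d) (w : W) : ‖ρ w‖ ≤ √(d : ℝ) := by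
  -- The set `𝒟` supplies a state-action pair at which to evaluate the features.
  set s := (F.D ⟨0, hd⟩).1
  set a := (F.D ⟨0, hd⟩).2
  have h1 := hA.one_le_norm_phi hH s a
  have h2 := hA.norm_psi_le s a w
  rw [hρ.kron, norm_kronVec] at h2
  calc ‖ρ w‖ ≤ √(d : ℝ) * ‖F.φ s a‖ * ‖ρ w‖ := le_mul_of_one_le_left (norm_nonneg _) h1
    _ = √(d : ℝ) * (‖F.φ s a‖ * ‖ρ w‖) := by ring
    _ ≤ √(d : ℝ) * 1 := by gcongr
    _ = _ := mul_one _

/-- The algorithm's own value functions belong to the class of the completeness assumption; the zero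
function after the last step does so with zero coefficients. -/
theorem StandingAssumptions.exists_backup (hA : StandingAssumptions M F) {lam : ℝ} (hl : 0 < lam)
    (β βt : ℝ) (X : History S A W) (k : ℕ) (ξ : ℕ → EuclideanSpace ℝ (Fin d × Fin m)) {h : ℕ}
    (hh : h < M.H) :
    ∃ x : EuclideanSpace ℝ (Fin d × Fin m), ‖x‖ ≤ M.H * √((m : ℝ) * d) ∧ ∀ s a w,
      ∫ s', UCBlvd.V ⟨F, M.H, lam, β, βt⟩ X k ξ (h + 1) s' w ∂(M.P h (s, a))
        = inner ℝ x (F.ψ s a w) := by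
  refine hA.complete (fun s w => UCBlvd.V ⟨F, M.H, lam, β, βt⟩ X k ξ (h + 1) s w) ?_ h hh
  rcases lt_or_ge (h + 1) M.H with h1 | h1
  · exact ⟨_, _, _, _, _, gramMatrix_posDef hl, gramMatrix_posDef hl, fun s w =>
      UCBlvd.V_eq_bonusValue ⟨F, M.H, lam, β, βt⟩ X k ξ h1 s w⟩
  · refine ⟨0, 1, 1, 0, 0, Matrix.PosDef.one, Matrix.PosDef.one, fun s w => ?_⟩
    simp [UCBlvd.V_of_le ⟨F, M.H, lam, β, βt⟩ X k ξ h1]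

end Structure

/-! ### Accuracy of a plan, optimism, and the one-step recursion of the gap. -/

namespace UCBlvd

variable {S A W : Type*} [MeasurableSpace S] [MeasurableSpace A] [MeasurableSpace W]
  [Fintype A] [Nonempty A] {d m n : ℕ} {M : ContextualMDP S A W} {F : Features S A W d m n}
  {ρ : W → EuclideanSpace ℝ (Fin m)} {lam β βt β₀ : ℝ} {X : History S A W} {k : ℕ}
  {ξ : ℕ → EuclideanSpace ℝ (Fin d × Fin m)}

/-- If the parameters of the true backup are in the confidence sets, then the planned parameters
predict the backup up to a multiple of the bonus. -/
theorem abs_inner_plan_sub_le (hA : StandingAssumptions M F) (hρ : IsMapping F ρ)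
    (hl : 0 < lam) (hplan : IsPlan ⟨F, M.H, lam, β, βt⟩ X k ξ) {h : ℕ} (hh : h < M.H)
    {x : EuclideanSpace ℝ (Fin d × Fin m)} (hx : ‖x‖ ≤ M.H * √((m : ℝ) * d))
    (hβ₀ : β₀ ≤ β) (hβ₀0 : 0 ≤ β₀)
    (hconf : ∀ j, weightedNorm (Lam ⟨F, M.H, lam, β, βt⟩ X k h)
      (thetaT ⟨F, M.H, lam, β, βt⟩ X k ξ h (F.wrep j) - contractVec x (ρ (F.wrep j))) ≤ β₀)
    (s : S) (a : A) (w : W) :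
    |inner ℝ (ξ h) (F.ψ s a w) - inner ℝ x (F.ψ s a w)|
      ≤ F.L * (β + β₀) * weightedNorm (Lam ⟨F, M.H, lam, β, βt⟩ X k h)⁻¹ (F.φ s a) := by
  obtain ⟨θ, ⟨hθ, -⟩, hmin⟩ := hplan h hh
  -- The true parameters are feasible with objective zero, so every residual of the minimizer
  -- vanishes as well.
  have hobj := hmin x (fun j => contractVec x (ρ (F.wrep j)))
    ⟨fun j => by rw [weightedNorm_sub_comm]; exact (hconf j).trans hβ₀, hx⟩
  have hzero : objective ⟨F, M.H, lam, β, βt⟩ x (fun j => contractVec x (ρ (F.wrep j))) = 0 := by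
    refine Finset.sum_eq_zero fun j _ => Finset.sum_eq_zero fun i _ => ?_
    rw [hρ.kron, inner_kronVec, sub_self, sq, mul_zero]
  rw [hzero] at hobj
  have hterm : ∀ j i, inner ℝ (θ j) (F.φ (F.D i).1 (F.D i).2)
      = inner ℝ (ξ h) (F.ψ (F.D i).1 (F.D i).2 (F.wrep j)) := by
    have h0 := (Finset.sum_eq_zero_iff_of_nonneg fun j _ =>
      Finset.sum_nonneg fun i _ => sq_nonneg _).1 (le_antisymm hobj
        (Finset.sum_nonneg fun j _ => Finset.sum_nonneg fun i _ => sq_nonneg _))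
    intro j i
    have h1 := (Finset.sum_eq_zero_iff_of_nonneg fun i _ => sq_nonneg _).1 (h0 j (mem_univ j)) i
      (mem_univ i)
    exact sub_eq_zero.1 (pow_eq_zero_iff two_ne_zero |>.1 h1)
  have hθeq : ∀ j, θ j = contractVec (ξ h) (ρ (F.wrep j)) := fun j =>
    inner_phi_eq_of_eq_on_D hA.indep fun i => by rw [hterm, hρ.kron, inner_kronVec]
  have hpd := gramMatrix_posDef (x := phiAt ⟨F, M.H, lam, β, βt⟩ X h) (k := k) hl
  have hj : ∀ j, |inner ℝ (ξ h) (F.ψ s a (F.wrep j)) - inner ℝ x (F.ψ s a (F.wrep j))|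
      ≤ (β + β₀) * weightedNorm (Lam ⟨F, M.H, lam, β, βt⟩ X k h)⁻¹ (F.φ s a) := by
    intro j
    rw [hρ.kron, inner_kronVec, inner_kronVec, ← hθeq, ← inner_sub_left]
    set t := thetaT ⟨F, M.H, lam, β, βt⟩ X k ξ h (F.wrep j) with ht
    have e : θ j - contractVec x (ρ (F.wrep j))
        = (θ j - t) + (t - contractVec x (ρ (F.wrep j))) := by abel
    -- The planned parameter is within `β` of the estimate by feasibility, the true one within the
    -- smaller `β₀` by concentration.
    rw [e, inner_add_left, add_mul]
    refine (abs_add_le _ _).trans (add_le_add ?_ ?_)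
    · exact (abs_inner_le_weightedNorm hpd _ _).trans
        (mul_le_mul_of_nonneg_right (hθ j) (weightedNorm_nonneg _ _))
    · exact (abs_inner_le_weightedNorm hpd _ _).trans
        (mul_le_mul_of_nonneg_right (hconf j) (weightedNorm_nonneg _ _))
  -- An arbitrary context combines the representative ones with coefficients of absolute sum at most
  -- `L`; the same bonus in `φ` bounds each error.
  obtain ⟨c, hc, hψ⟩ := hρ.psi_eq_sum w
  rw [hψ, inner_sum, inner_sum, ← Finset.sum_sub_distrib]
  calc _ ≤ ∑ j, |c j| * ((β + β₀) * weightedNorm (Lam ⟨F, M.H, lam, β, βt⟩ X k h)⁻¹ (F.φ s a)) := by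
        refine (Finset.abs_sum_le_sum_abs _ _).trans (Finset.sum_le_sum fun j _ => ?_)
        rw [inner_smul_right, inner_smul_right, ← mul_sub, abs_mul]
        exact mul_le_mul_of_nonneg_left (hj j) (abs_nonneg _)
    _ ≤ F.L * ((β + β₀) * weightedNorm (Lam ⟨F, M.H, lam, β, βt⟩ X k h)⁻¹ (F.φ s a)) := by
        rw [← Finset.sum_mul]
        exact mul_le_mul_of_nonneg_right hc
          (mul_nonneg (by linarith) (weightedNorm_nonneg _ _))
    _ = _ := by ring

theorem norm_etaT_le_and_abs_inner_sub_le (hA : StandingAssumptions M F) {K : ℕ} (hk : k ≤ K)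
    {h : ℕ} (hh : h < M.H)
    (hrew : ∀ τ < K, X.rew τ h = M.r h (X.st τ h) (X.ac τ h) (X.ctx τ)) :
    ‖etaT ⟨F, M.H, 1, β, βt⟩ X k h‖ ≤ 2 * √((m : ℝ) * d) ∧ ∀ s a w,
      |inner ℝ (etaT ⟨F, M.H, 1, β, βt⟩ X k h) (F.ψ s a w) - M.r h s a w|
        ≤ √((m : ℝ) * d) * weightedNorm (LamT ⟨F, M.H, 1, β, βt⟩ X k h)⁻¹ (F.ψ s a w) := by
  obtain ⟨η, hη⟩ := hA.exists_reward_eq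
  obtain ⟨hη1, hη2⟩ := hη h hh
  have h1 : weightedNorm (LamT ⟨F, M.H, 1, β, βt⟩ X k h)
      (etaT ⟨F, M.H, 1, β, βt⟩ X k h - η h) ≤ ‖η h‖ :=
    weightedNorm_ridge_sub_le_of_exact fun τ hτ => by rw [hrew τ (by omega), hη2]; rfl
  constructor
  · have h2 := (norm_le_weightedNorm (x := psiAt ⟨F, M.H, 1, β, βt⟩ X h) (k := k)
      (etaT ⟨F, M.H, 1, β, βt⟩ X k h - η h)).trans h1
    have h3 := norm_le_norm_add_norm_sub' (etaT ⟨F, M.H, 1, β, βt⟩ X k h) (η h)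
    linarith
  · intro s a w
    rw [hη2, ← inner_sub_left]
    exact (abs_inner_le_weightedNorm (gramMatrix_posDef one_pos) _ _).trans
      (mul_le_mul_of_nonneg_right (h1.trans hη1) (weightedNorm_nonneg _ _))

/-- The parameters of the action-value function predict the reward and the backup of the next value
function up to `L (β + β₀)` and `β̃` times the respective dual norms. -/
def IsAccurate (U : UCBlvd S A W d m n) (M : ContextualMDP S A W) (X : History S A W) (k : ℕ)
    (ξ : ℕ → EuclideanSpace ℝ (Fin d × Fin m)) (β₀ : ℝ) : Prop :=
  ∀ h < U.H, ∀ s a w, |inner ℝ (U.etaT X k h + ξ h) (U.F.ψ s a w)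
      - (M.r h s a w + ∫ s', U.V X k ξ (h + 1) s' w ∂(M.P h (s, a)))|
    ≤ U.F.L * (U.β + β₀) * weightedNorm (U.Lam X k h)⁻¹ (U.F.φ s a)
      + U.βt * weightedNorm (U.LamT X k h)⁻¹ (U.F.ψ s a w)

theorem measurable_V_state (hA : StandingAssumptions M F) (h : ℕ) (w : W) :
    Measurable fun s => V ⟨F, M.H, lam, β, βt⟩ X k ξ h s w := by
  rcases lt_or_ge h M.H with hh | hh
  · simp only [V_eq_bonusValue ⟨F, M.H, lam, β, βt⟩ X k ξ hh]
    exact measurable_bonusValue hA.phi_meas hA.psi_meas measurable_const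
      (fun _ _ => measurable_const) (fun _ _ => measurable_const) measurable_id measurable_const
  · simp only [V_of_le ⟨F, M.H, lam, β, βt⟩ X k ξ hh]
    exact measurable_const

theorem integrable_V (hA : StandingAssumptions M F) (h : ℕ) (w : W) (P : Measure S)
    [IsProbabilityMeasure P] : Integrable (fun s => V ⟨F, M.H, lam, β, βt⟩ X k ξ h s w) P :=
  Integrable.of_bound (measurable_V_state hA h w).aestronglyMeasurable M.H (ae_of_all _ fun s => by
    rw [Real.norm_eq_abs, abs_of_nonneg (V_nonneg _ _ _ _ _ _ _)]
    exact V_le ⟨F, M.H, lam, β, βt⟩ X k ξ h s w)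

theorem integrable_value [DiscreteMeasurableSpace A] (hA : StandingAssumptions M F)
    {π : ℕ → S → W → A} {w : W} (hπ : ∀ h < M.H, Measurable fun s => π h s w) {h : ℕ} (hh : h ≤ M.H)
    (P : Measure S) [IsProbabilityMeasure P] : Integrable (fun s => M.value π h s w) P := by
  have hm := M.measurable_value (Γ := Unit) (mΓ := inferInstance) (π := fun _ => π) (w := fun _ => w)
    (fun h hh a => hA.measurable_reward measurable_snd measurable_const hh a)
    (fun h hh => (hπ h hh).comp measurable_snd) hh
  have hm' : Measurable fun s => M.value π h s w := hm.comp (measurable_prodMk_left (x := ()))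
  refine Integrable.of_bound hm'.aestronglyMeasurable M.H (ae_of_all _ fun s => ?_)
  rw [Real.norm_eq_abs, abs_of_nonneg (M.value_nonneg π hh s w)]
  exact M.value_le π hh s w

/-- One step of optimism: the bonus `2 L β` covers the error `L (β + β₀)`. -/
theorem reward_add_integral_le_Q (hL : 0 ≤ F.L) (hβ₀ : β₀ ≤ β)
    (hacc : IsAccurate ⟨F, M.H, lam, β, βt⟩ M X k ξ β₀) {h : ℕ} (hh : h < M.H) (s : S) (a : A)
    (w : W) :
    M.r h s a w + ∫ s', V ⟨F, M.H, lam, β, βt⟩ X k ξ (h + 1) s' w ∂(M.P h (s, a))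
      ≤ Q ⟨F, M.H, lam, β, βt⟩ X k ξ h s a w := by
  have h1 := (abs_le.1 (hacc h hh s a w)).1
  have h2 : F.L * (β + β₀) * weightedNorm (Lam ⟨F, M.H, lam, β, βt⟩ X k h)⁻¹ (F.φ s a)
      ≤ 2 * F.L * β * weightedNorm (Lam ⟨F, M.H, lam, β, βt⟩ X k h)⁻¹ (F.φ s a) := by
    refine mul_le_mul_of_nonneg_right ?_ (weightedNorm_nonneg _ _)
    nlinarith
  rw [Q, if_pos hh]
  refine le_trans ?_ (le_max_left _ _)
  linarith

/-- The bonus `2 L β` and the error `L (β + β₀)` add up to `L (3 β + β₀)`. Keeping `β₀` well below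
`β` makes the constants of the explicit bound attainable. -/
theorem Q_le (hacc : IsAccurate ⟨F, M.H, lam, β, βt⟩ M X k ξ β₀) (hL : 0 ≤ F.L) (hβ : 0 ≤ β)
    (hβ₀ : 0 ≤ β₀) (hβt : 0 ≤ βt) {h : ℕ} (hh : h < M.H) (s : S) (a : A) (w : W) :
    Q ⟨F, M.H, lam, β, βt⟩ X k ξ h s a w ≤
      M.r h s a w + ∫ s', V ⟨F, M.H, lam, β, βt⟩ X k ξ (h + 1) s' w ∂(M.P h (s, a))
        + F.L * (3 * β + β₀) * weightedNorm (Lam ⟨F, M.H, lam, β, βt⟩ X k h)⁻¹ (F.φ s a)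
        + 2 * βt * weightedNorm (LamT ⟨F, M.H, lam, β, βt⟩ X k h)⁻¹ (F.ψ s a w) := by
  have h1 := (abs_le.1 (hacc h hh s a w)).2
  have h3 := weightedNorm_nonneg (Lam ⟨F, M.H, lam, β, βt⟩ X k h)⁻¹ (F.φ s a)
  have h4 := weightedNorm_nonneg (LamT ⟨F, M.H, lam, β, βt⟩ X k h)⁻¹ (F.ψ s a w)
  have h5 := (M.r_mem h hh s a w).1
  have h6 : 0 ≤ ∫ s', V ⟨F, M.H, lam, β, βt⟩ X k ξ (h + 1) s' w ∂(M.P h (s, a)) :=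
    integral_nonneg fun s' => V_nonneg ⟨F, M.H, lam, β, βt⟩ X k ξ (h + 1) s' w
  rw [Q, if_pos hh]
  refine max_le ?_ (by positivity)
  simp only at h1 ⊢
  linarith

/-- Optimism: the value function of an accurate plan dominates the values of all policies. -/
theorem value_le_V [DiscreteMeasurableSpace A] (hA : StandingAssumptions M F) (hL : 0 ≤ F.L)
    (hβ₀ : β₀ ≤ β) (hacc : IsAccurate ⟨F, M.H, lam, β, βt⟩ M X k ξ β₀) {π : ℕ → S → W → A}
    {w : W} (hπ : ∀ h < M.H, Measurable fun s => π h s w) {h : ℕ} (hh : h ≤ M.H) (s : S) :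
    M.value π h s w ≤ V ⟨F, M.H, lam, β, βt⟩ X k ξ h s w := by
  induction hh using Nat.decreasingInduction generalizing s with
  | self => rw [M.value_horizon]; exact V_nonneg _ _ _ _ _ _ _
  | of_succ h hh ih =>
    refine le_min ?_ (M.value_le π (Nat.le_of_lt hh) s w)
    refine le_trans ?_ (Finset.le_sup' (fun a => Q ⟨F, M.H, lam, β, βt⟩ X k ξ h s a w)
      (mem_univ (π h s w)))
    refine le_trans ?_ (reward_add_integral_le_Q hL hβ₀ hacc hh s (π h s w) w)
    have := M.markov h
    rw [M.value_eq π hh]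
    exact add_le_add_right (integral_mono (integrable_value hA hπ hh (M.P h (s, π h s w)))
      (integrable_V hA _ _ _) fun s' => ih s') _

/-- The gap between the optimistic and the true value of a greedy policy, in terms of the gap at
the next step. -/
theorem V_sub_value_le [DiscreteMeasurableSpace A] (hA : StandingAssumptions M F)
    (hacc : IsAccurate ⟨F, M.H, lam, β, βt⟩ M X k ξ β₀) (hL : 0 ≤ F.L) (hβ : 0 ≤ β)
    (hβ₀ : 0 ≤ β₀) (hβt : 0 ≤ βt) {π : ℕ → S → W → A} {w : W}
    (hπ : ∀ h < M.H, Measurable fun s => π h s w) {h : ℕ} (hh : h < M.H) (s : S)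
    (hgreedy : ∀ a, Q ⟨F, M.H, lam, β, βt⟩ X k ξ h s a w
      ≤ Q ⟨F, M.H, lam, β, βt⟩ X k ξ h s (π h s w) w) :
    V ⟨F, M.H, lam, β, βt⟩ X k ξ h s w - M.value π h s w ≤
      F.L * (3 * β + β₀) * weightedNorm (Lam ⟨F, M.H, lam, β, βt⟩ X k h)⁻¹ (F.φ s (π h s w))
        + 2 * βt * weightedNorm (LamT ⟨F, M.H, lam, β, βt⟩ X k h)⁻¹ (F.ψ s (π h s w) w)
        + ∫ s', (V ⟨F, M.H, lam, β, βt⟩ X k ξ (h + 1) s' w - M.value π (h + 1) s' w)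
          ∂(M.P h (s, π h s w)) := by
  have := M.markov h
  have h1 : V ⟨F, M.H, lam, β, βt⟩ X k ξ h s w ≤ Q ⟨F, M.H, lam, β, βt⟩ X k ξ h s (π h s w) w :=
    (min_le_left _ _).trans (Finset.sup'_le _ _ fun a _ => hgreedy a)
  have h2 := Q_le hacc hL hβ hβ₀ hβt hh s (π h s w) w
  rw [integral_sub (integrable_V hA _ _ _) (integrable_value hA hπ hh _), M.value_eq π hh]
  linarith

end UCBlvd

/-! ### Measurability -/

theorem measurable_comp_prodMk {Ω E G : Type*} {m₁ m₂ : MeasurableSpace Ω} (h : m₁ ≤ m₂)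
    {mE : MeasurableSpace E} [MeasurableSpace G] {f : Ω × E → G}
    (hf : Measurable[m₁.prod mE] f) {g : Ω → E} (hg : Measurable[m₂] g) :
    Measurable[m₂] fun ω => f (ω, g ω) :=
  hf.comp (@Measurable.prodMk Ω m₂ Ω E m₁ mE id g (fun _ hs => h _ hs) hg)

section Matrices

variable {Γ ι : Type*} {mΓ : MeasurableSpace Γ} [Fintype ι] [DecidableEq ι]

theorem measurable_det {B : Γ → Matrix ι ι ℝ} (hB : ∀ i j, Measurable fun γ => B γ i j) :
    Measurable fun γ => (B γ).det := by
  simp only [Matrix.det_apply]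
  exact Finset.measurable_sum _ fun σ _ =>
    (Finset.measurable_prod _ fun i _ => hB _ _).const_smul _

theorem measurable_inv_apply {B : Γ → Matrix ι ι ℝ} (hB : ∀ i j, Measurable fun γ => B γ i j)
    (i j : ι) : Measurable fun γ => (B γ)⁻¹ i j := by
  simp only [Matrix.inv_def, Matrix.smul_apply, Matrix.adjugate_apply, smul_eq_mul,
    Ring.inverse_eq_inv']
  refine (measurable_det hB).inv.mul (measurable_det fun i' j' => ?_)
  simp only [Matrix.updateRow_apply]
  split_ifs
  · exact measurable_const
  · exact hB _ _

theorem measurable_euclidean_apply {x : Γ → EuclideanSpace ℝ ι} (hx : Measurable x) (i : ι) :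
    Measurable fun γ => (x γ).ofLp i :=
  (measurable_pi_apply i).comp ((WithLp.measurable_ofLp 2 _).comp hx)

theorem measurable_gramMatrix_apply {lam : ℝ} {x : Γ → ℕ → EuclideanSpace ℝ ι} {k : ℕ}
    (hx : ∀ τ < k, Measurable fun γ => x γ τ) (i j : ι) :
    Measurable fun γ => gramMatrix lam (x γ) k i j := by
  simp only [gramMatrix, Matrix.add_apply, Matrix.sum_apply, Matrix.vecMulVec_apply]
  refine measurable_const.add (Finset.measurable_sum _ fun τ hτ => ?_)
  have h := hx τ (mem_range.1 hτ)
  exact (measurable_euclidean_apply h i).mul (measurable_euclidean_apply h j)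

theorem measurable_ridge {lam : ℝ} {x : Γ → ℕ → EuclideanSpace ℝ ι} {y : Γ → ℕ → ℝ} {k : ℕ}
    (hx : ∀ τ < k, Measurable fun γ => x γ τ) (hy : ∀ τ < k, Measurable fun γ => y γ τ) :
    Measurable fun γ => ridge lam (x γ) (y γ) k := by
  refine (WithLp.measurable_toLp 2 _).comp (measurable_pi_iff.2 fun i => ?_)
  simp only [Matrix.mulVec, dotProduct, WithLp.ofLp_sum, WithLp.ofLp_smul, Finset.sum_apply,
    Pi.smul_apply, smul_eq_mul]
  exact Finset.measurable_sum _ fun j _ =>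
    (measurable_inv_apply (measurable_gramMatrix_apply hx) i j).mul
      (Finset.measurable_sum _ fun τ hτ => (hy τ (mem_range.1 hτ)).mul
        (measurable_euclidean_apply (hx τ (mem_range.1 hτ)) j))

end Matrices

/-! ### Measurability of the learner's quantities with respect to the past. -/

namespace UCBlvd

variable {Ω S A W : Type*} [MeasurableSpace S] [MeasurableSpace A] [MeasurableSpace W]
  [Fintype A] [Nonempty A] [DiscreteMeasurableSpace A] {mΩ : MeasurableSpace Ω} {d m n : ℕ}
  {U : UCBlvd S A W d m n}
  {M : ContextualMDP S A W} {K : ℕ} {μ : Measure Ω} [IsProbabilityMeasure μ]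
  {𝓕 : Filtration ℕ mΩ} {X : Ω → History S A W}
  {ξ : ℕ → Ω → ℕ → EuclideanSpace ℝ (Fin d × Fin m)} {π : ℕ → Ω → ℕ → S → W → A}

theorem clock_le_clock {τ k h h' : ℕ} (hk : τ < k) (hh : h ≤ U.H) :
    U.clock τ h ≤ U.clock k h' := by
  have : (τ + 1) * (U.H + 1) ≤ k * (U.H + 1) := Nat.mul_le_mul_right _ hk
  unfold clock
  nlinarith

theorem clock_zero_le (k h : ℕ) : U.clock k 0 ≤ U.clock k h := by
  unfold clock; omega

variable (hR : U.IsRun M K μ 𝓕 X ξ π)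

include hR

theorem IsRun.measurable_ac {k h : ℕ} (hk : k < K) (hh : h < U.H) :
    Measurable[𝓕 (U.clock k h)] fun ω => (X ω).ac k h := by
  simp only [hR.action _ k hk h hh]
  exact measurable_comp_prodMk (f := fun p : Ω × (S × W) => π k p.1 h p.2.1 p.2.2)
    (𝓕.mono (clock_zero_le k h)) (hR.policy_meas k hk h hh)
    ((hR.st_meas k hk h hh.le).prodMk
      ((hR.ctx_meas k hk).mono (𝓕.mono (clock_zero_le k h)) le_rfl))

theorem IsRun.measurable_phiAt (hφ : ∀ a, Measurable fun s => U.F.φ s a) {k h : ℕ} (hk : k < K)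
    (hh : h < U.H) : Measurable[𝓕 (U.clock k h)] fun ω => U.phiAt (X ω) h k :=
  measurable_apply_of_countable (hR.measurable_ac hk hh)
    fun a => (hφ a).comp (hR.st_meas k hk h hh.le)

theorem IsRun.measurable_psiAt (hψ : ∀ a, Measurable fun p : S × W => U.F.ψ p.1 a p.2) {k h : ℕ}
    (hk : k < K) (hh : h < U.H) : Measurable[𝓕 (U.clock k h)] fun ω => U.psiAt (X ω) h k :=
  measurable_apply_of_countable (hR.measurable_ac hk hh)
    (g := fun a ω => U.F.ψ ((X ω).st k h) a ((X ω).ctx k))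
    fun a => (hψ a).comp ((hR.st_meas k hk h hh.le).prodMk
      ((hR.ctx_meas k hk).mono (𝓕.mono (clock_zero_le k h)) le_rfl))

theorem IsRun.measurable_Lam (hφ : ∀ a, Measurable fun s => U.F.φ s a) {j k h : ℕ} (hj : j ≤ k)
    (hk : k < K) (hh : h < U.H) (i i' : Fin d) :
    Measurable[𝓕 (U.clock k 0)] fun ω => U.Lam (X ω) j h i i' :=
  measurable_gramMatrix_apply (fun τ hτ => (hR.measurable_phiAt hφ (by omega) hh).mono
    (𝓕.mono (clock_le_clock (by omega) hh.le)) le_rfl) i i'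

theorem IsRun.measurable_LamT (hψ : ∀ a, Measurable fun p : S × W => U.F.ψ p.1 a p.2) {j k h : ℕ}
    (hj : j ≤ k) (hk : k < K) (hh : h < U.H) (i i' : Fin d × Fin m) :
    Measurable[𝓕 (U.clock k 0)] fun ω => U.LamT (X ω) j h i i' :=
  measurable_gramMatrix_apply (fun τ hτ => (hR.measurable_psiAt hψ (by omega) hh).mono
    (𝓕.mono (clock_le_clock (by omega) hh.le)) le_rfl) i i'

theorem IsRun.measurable_etaT (hψ : ∀ a, Measurable fun p : S × W => U.F.ψ p.1 a p.2)
    (hr : ∀ h < U.H, ∀ a, Measurable fun p : S × W => M.r h p.1 a p.2) {j k h : ℕ}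
    (hj : j ≤ k) (hk : k < K) (hh : h < U.H) :
    Measurable[𝓕 (U.clock k 0)] fun ω => U.etaT (X ω) j h := by
  refine measurable_ridge (fun τ hτ => (hR.measurable_psiAt hψ (by omega) hh).mono
    (𝓕.mono (clock_le_clock (by omega) hh.le)) le_rfl) fun τ hτ => ?_
  have hτK : τ < K := by omega
  simp only [hR.reward _ τ hτK h hh]
  have hle : U.clock τ h ≤ U.clock k 0 := clock_le_clock (by omega) hh.le
  refine Measurable.mono ?_ (𝓕.mono hle) le_rfl
  exact measurable_apply_of_countable (hR.measurable_ac hτK hh)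
    (g := fun a ω => M.r h ((X ω).st τ h) a ((X ω).ctx τ))
    fun a => (hr h hh a).comp ((hR.st_meas τ hτK h hh.le).prodMk
      ((hR.ctx_meas τ hτK).mono (𝓕.mono (clock_zero_le τ h)) le_rfl))

theorem IsRun.measurableSet_replan (hφ : ∀ a, Measurable fun s => U.F.φ s a)
    (hψ : ∀ a, Measurable fun p : S × W => U.F.ψ p.1 a p.2) {j k : ℕ} (hj : j ≤ k) (hk : k < K) :
    MeasurableSet[𝓕 (U.clock k 0)] {ω | U.Replan (X ω) k j} := by
  have : {ω | U.Replan (X ω) k j} = ⋃ h ∈ Set.Iio U.H,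
      ({ω | Real.exp 1 < (U.Lam (X ω) k h).det / (U.Lam (X ω) j h).det} ∪
        {ω | Real.exp 1 < (U.LamT (X ω) k h).det / (U.LamT (X ω) j h).det}) := by
    ext ω
    simp [Replan]
  rw [this]
  refine MeasurableSet.biUnion (Set.to_countable _) fun h hh => MeasurableSet.union ?_ ?_
  · exact measurableSet_lt measurable_const
      ((measurable_det (hR.measurable_Lam hφ le_rfl hk hh)).div
        (measurable_det (hR.measurable_Lam hφ hj hk hh)))
  · exact measurableSet_lt measurable_const
      ((measurable_det (hR.measurable_LamT hψ le_rfl hk hh)).div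
        (measurable_det (hR.measurable_LamT hψ hj hk hh)))

/-- Whether episode `k` replans depends on earlier episodes only, so the plan in force is known when
the episode begins. The replanning event is decomposed over the finitely many values of the previous
index. -/
theorem IsRun.measurable_planIndex (hφ : ∀ a, Measurable fun s => U.F.φ s a)
    (hψ : ∀ a, Measurable fun p : S × W => U.F.ψ p.1 a p.2) {k : ℕ} (hk : k < K) :
    Measurable[𝓕 (U.clock k 0)] fun ω => U.planIndex (X ω) k := by
  have key : ∀ k < K, Measurable[𝓕 (U.clock k 0)] (fun ω => U.planBefore (X ω) k) →
      Measurable[𝓕 (U.clock k 0)] fun ω => U.planBefore (X ω) (k + 1) := by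
    intro k hk h
    have hset : MeasurableSet[𝓕 (U.clock k 0)] {ω | U.Replan (X ω) k (U.planBefore (X ω) k)} := by
      have : {ω | U.Replan (X ω) k (U.planBefore (X ω) k)} = ⋃ j ∈ Set.Iic k,
          ({ω | U.planBefore (X ω) k = j} ∩ {ω | U.Replan (X ω) k j}) := by
        ext ω
        simp only [Set.mem_ofPred_eq, Set.mem_iUnion, Set.mem_inter_iff, Set.mem_Iic]
        constructor
        · exact fun h => ⟨_, U.planBefore_le (X ω) k, rfl, h⟩
        · rintro ⟨j, -, rfl, h⟩; exact h
      rw [this]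
      exact MeasurableSet.biUnion (Set.to_countable _) fun j hj =>
        (h (measurableSet_singleton j)).inter (hR.measurableSet_replan hφ hψ hj hk)
    simp only [planBefore]
    exact Measurable.ite hset measurable_const h
  refine key k hk ?_
  induction k with
  | zero => exact measurable_const
  | succ k ih =>
    exact (key k (by omega) (ih (by omega))).mono (𝓕.mono (clock_le_clock (by omega) (by omega)))
      le_rfl

theorem IsRun.measurable_V (hφ : ∀ a, Measurable fun s => U.F.φ s a)
    (hψ : ∀ a, Measurable fun p : S × W => U.F.ψ p.1 a p.2)
    (hr : ∀ h < U.H, ∀ a, Measurable fun p : S × W => M.r h p.1 a p.2) {j k : ℕ}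
    (hj : j ≤ k) (hk : k < K) (h : ℕ) :
    Measurable[(𝓕 (U.clock k 0)).prod inferInstance] fun p : Ω × S =>
      U.V (X p.1) j (ξ j p.1) h p.2 ((X p.1).ctx k) := by
  have hfst : Measurable[(𝓕 (U.clock k 0)).prod inferInstance, 𝓕 (U.clock k 0)]
      (Prod.fst : Ω × S → Ω) := @measurable_fst Ω S (𝓕 (U.clock k 0)) _
  have hsnd : Measurable[(𝓕 (U.clock k 0)).prod inferInstance]
      (Prod.snd : Ω × S → S) := @measurable_snd Ω S (𝓕 (U.clock k 0)) _
  rcases lt_or_ge h U.H with hh | hh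
  · simp only [U.V_eq_bonusValue _ _ _ hh]
    refine measurable_bonusValue hφ hψ ?_ (fun i i' => ?_) (fun i i' => ?_) hsnd
      ((hR.ctx_meas k hk).comp hfst)
    · have hle : U.clock j 0 ≤ U.clock k 0 := by unfold clock; gcongr
      have h1 : Measurable[𝓕 (U.clock k 0)] fun ω => ξ j ω h :=
        (hR.plan_meas j (by omega) h hh).mono (𝓕.mono hle) le_rfl
      exact ((hR.measurable_etaT hψ hr hj hk hh).add h1).comp hfst
    · exact (measurable_inv_apply (hR.measurable_Lam hφ hj hk hh) i i').comp hfst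
    · exact (measurable_inv_apply (hR.measurable_LamT hψ hj hk hh) i i').comp hfst
  · simp only [U.V_of_le _ _ _ hh]
    exact measurable_const

/-- The value function of the current plan is jointly measurable in the past and in the state. -/
theorem IsRun.measurable_V_planIndex (hφ : ∀ a, Measurable fun s => U.F.φ s a)
    (hψ : ∀ a, Measurable fun p : S × W => U.F.ψ p.1 a p.2)
    (hr : ∀ h < U.H, ∀ a, Measurable fun p : S × W => M.r h p.1 a p.2) {k : ℕ}
    (hk : k < K) (h : ℕ) :
    Measurable[(𝓕 (U.clock k 0)).prod inferInstance] fun p : Ω × S =>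
      U.V (X p.1) (U.planIndex (X p.1) k) (ξ (U.planIndex (X p.1) k) p.1) h p.2 ((X p.1).ctx k) := by
  have hfst : Measurable[(𝓕 (U.clock k 0)).prod inferInstance, 𝓕 (U.clock k 0)]
      (Prod.fst : Ω × S → Ω) := @measurable_fst Ω S (𝓕 (U.clock k 0)) _
  have h1 := measurable_apply_of_countable
    -- The index is taken in `Fin (k + 1)`, so that no plan of a later episode, which the past does
    -- not determine, enters.
    (f := fun p : Ω × S => (⟨U.planIndex (X p.1) k,
      Nat.lt_succ_of_le (U.planIndex_le (X p.1) k)⟩ : Fin (k + 1)))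
    (g := fun j p => U.V (X p.1) j (ξ j p.1) h p.2 ((X p.1).ctx k))
    (mΓ := (𝓕 (U.clock k 0)).prod inferInstance) ?_
    fun j => hR.measurable_V hφ hψ hr (Nat.lt_succ_iff.1 j.2) hk h
  · exact h1
  · refine @measurable_to_countable' _ _ _ _ ((𝓕 (U.clock k 0)).prod inferInstance) _ fun j => ?_
    have h2 := ((hR.measurable_planIndex hφ hψ hk).comp hfst) (measurableSet_singleton j.1)
    convert h2 using 1
    ext p
    simp [Fin.ext_iff]

/-- The values of the policies are jointly measurable in the past and in the state. -/
theorem IsRun.measurable_value (hH : U.H = M.H)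
    (hr : ∀ h < U.H, ∀ a, Measurable fun p : S × W => M.r h p.1 a p.2) {k : ℕ}
    (hk : k < K) {h : ℕ} (hh : h ≤ U.H) :
    Measurable[(𝓕 (U.clock k 0)).prod inferInstance] fun p : Ω × S =>
      M.value (π k p.1) h p.2 ((X p.1).ctx k) := by
  have hfst : Measurable[(𝓕 (U.clock k 0)).prod inferInstance, 𝓕 (U.clock k 0)]
      (Prod.fst : Ω × S → Ω) := @measurable_fst Ω S (𝓕 (U.clock k 0)) _
  have hsnd : Measurable[(𝓕 (U.clock k 0)).prod inferInstance]
      (Prod.snd : Ω × S → S) := @measurable_snd Ω S (𝓕 (U.clock k 0)) _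
  have hsw : Measurable[(𝓕 (U.clock k 0)).prod inferInstance] fun p : Ω × S =>
      (p.2, (X p.1).ctx k) := hsnd.prodMk ((hR.ctx_meas k hk).comp hfst)
  refine M.measurable_value (mΓ := 𝓕 (U.clock k 0)) (π := π k) (w := fun ω => (X ω).ctx k)
    (fun h hh a => (hr h (hH ▸ hh) a).comp hsw) (fun h hh => ?_) (hH ▸ hh)
  exact (hR.policy_meas k hk h (hH ▸ hh)).comp
    (@Measurable.prodMk _ ((𝓕 (U.clock k 0)).prod inferInstance) _ _ (𝓕 (U.clock k 0)) _ _ _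
      hfst hsw)

end UCBlvd

/-! ### Concentration along a run -/

theorem sum_range_mul_eq (f : ℕ → ℝ) (K N : ℕ) :
    ∑ t ∈ range (K * N), f t = ∑ k ∈ range K, ∑ h ∈ range N, f (k * N + h) := by
  induction K with
  | zero => simp
  | succ K ih => rw [Nat.succ_mul, Finset.sum_range_add, ih, Finset.sum_range_succ]

namespace UCBlvd

section Definitions

variable {S A W : Type*} [MeasurableSpace S] [MeasurableSpace A] {d m n : ℕ}

/-- The difference between `g` at the next state and its expectation. -/
noncomputable def noise (M : ContextualMDP S A W) (X : History S A W) (h : ℕ) (g : S → ℝ)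
    (τ : ℕ) : ℝ :=
  g (X.st τ (h + 1)) - ∫ s', g s' ∂(M.P h (X.st τ h, X.ac τ h))

/-- The accumulated noise in the direction `x`, compensated by its predictable variation. -/
noncomputable def compensatedNoise (U : UCBlvd S A W d m n) (M : ContextualMDP S A W)
    (X : History S A W) (h k : ℕ) (x : EuclideanSpace ℝ (Fin d)) (g : S → ℝ) : ℝ :=
  ∑ τ ∈ range k, (inner ℝ x (U.phiAt X h τ) * noise M X h g τ
    - (U.H * |inner ℝ x (U.phiAt X h τ)|) ^ 2)

/-- The gap between the optimistic value of the current plan and the value of the policy. -/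
noncomputable def gap [Fintype A] [Nonempty A] (U : UCBlvd S A W d m n) (M : ContextualMDP S A W)
    (X : History S A W) (ξ : ℕ → ℕ → EuclideanSpace ℝ (Fin d × Fin m)) (π : ℕ → ℕ → S → W → A)
    (k h : ℕ) (s : S) : ℝ :=
  U.V X (U.planIndex X k) (ξ (U.planIndex X k)) h s (X.ctx k) - M.value (π k) h s (X.ctx k)

theorem abs_noise_le {M : ContextualMDP S A W} {g : S → ℝ} {c : ℝ} (hg0 : ∀ s, 0 ≤ g s)
    (hgc : ∀ s, g s ≤ c) (X : History S A W) (h τ : ℕ) : |noise M X h g τ| ≤ c := by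
  have := M.markov h
  have h1 : 0 ≤ ∫ s', g s' ∂(M.P h (X.st τ h, X.ac τ h)) := integral_nonneg hg0
  have h2 : ∫ s', g s' ∂(M.P h (X.st τ h, X.ac τ h)) ≤ c :=
    (le_abs_self _).trans (abs_integral_le_of_abs_le fun s => by
      rw [abs_of_nonneg (hg0 s)]; exact hgc s)
  have h3 := hg0 (X.st τ (h + 1))
  have h4 := hgc (X.st τ (h + 1))
  exact abs_le.2 ⟨by unfold noise; linarith, by unfold noise; linarith⟩

end Definitions

variable {Ω S A W : Type*} [MeasurableSpace S] [MeasurableSpace A] [MeasurableSpace W]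
  [Fintype A] [Nonempty A] [DiscreteMeasurableSpace A] {mΩ : MeasurableSpace Ω} {d m n : ℕ}
  {U : UCBlvd S A W d m n}
  {M : ContextualMDP S A W} {K : ℕ} {μ : Measure Ω} [IsProbabilityMeasure μ]
  {𝓕 : Filtration ℕ mΩ} {X : Ω → History S A W}
  {ξ : ℕ → Ω → ℕ → EuclideanSpace ℝ (Fin d × Fin m)} {π : ℕ → Ω → ℕ → S → W → A}

theorem abs_gap_le (hH : U.H = M.H) (X : History S A W)
    (ξ : ℕ → ℕ → EuclideanSpace ℝ (Fin d × Fin m)) (π : ℕ → ℕ → S → W → A) (k : ℕ) {h : ℕ}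
    (hh : h ≤ U.H) (s : S) : |U.gap M X ξ π k h s| ≤ U.H := by
  have h1 := U.V_nonneg X (U.planIndex X k) (ξ (U.planIndex X k)) h s (X.ctx k)
  have h2 := U.V_le X (U.planIndex X k) (ξ (U.planIndex X k)) h s (X.ctx k)
  have h3 := M.value_nonneg (π k) (hH ▸ hh) s (X.ctx k)
  have h4 := M.value_le (π k) (hH ▸ hh) s (X.ctx k)
  rw [← hH] at h4
  exact abs_le.2 ⟨by unfold gap; linarith, by unfold gap; linarith⟩

variable (hR : U.IsRun M K μ 𝓕 X ξ π)

include hR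

theorem IsRun.integral_mul_sub_eq_zero {k h : ℕ} (hk : k < K) (hh : h < U.H) {f : Ω × S → ℝ}
    (hf : Measurable[(𝓕 (U.clock k h)).prod inferInstance] f) {c : ℝ} (hc : ∀ p, |f p| ≤ c)
    {Z : Ω → ℝ} (hZ : Measurable[𝓕 (U.clock k h)] Z) {C : ℝ} (hZC : ∀ ω, |Z ω| ≤ C) :
    ∫ ω, Z ω * (f (ω, (X ω).st k (h + 1))
      - ∫ y, f (ω, y) ∂(M.P h ((X ω).st k h, (X ω).ac k h))) ∂μ = 0 := by
  have := M.markov h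
  exact _root_.integral_mul_sub_integral_eq_zero (𝓕.le _)
    (u := fun ω => ((X ω).st k h, (X ω).ac k h))
    ((hR.st_meas k hk h hh.le).prodMk (hR.measurable_ac hk hh))
    ((hR.st_meas k hk (h + 1) hh).mono (𝓕.le _) le_rfl) (hR.transition k hk h hh) hf hc hZ hZC

theorem IsRun.measurable_noise {h τ : ℕ} (hτ : τ < K) (hh : h < U.H) {g : S → ℝ}
    (hg : Measurable g) : Measurable[𝓕 (U.clock τ (h + 1))] fun ω => noise M (X ω) h g τ := by
  have := M.markov h
  refine (hg.comp (hR.st_meas τ hτ (h + 1) hh)).sub ?_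
  have hle : U.clock τ h ≤ U.clock τ (h + 1) := by unfold clock; omega
  exact (measurable_integral_kernel
    ((hR.st_meas τ hτ h hh.le).prodMk (hR.measurable_ac hτ hh)) (f := fun p : Ω × S => g p.2)
    (hg.comp (@measurable_snd Ω S (𝓕 (U.clock τ h)) _))).mono (𝓕.mono hle) le_rfl

/-- A deviation inequality for the compensated noise of a fixed function in a fixed direction. -/
theorem IsRun.measureReal_lt_compensatedNoise_le (hφ : ∀ a, Measurable fun s => U.F.φ s a)
    (hφ1 : ∀ s a, ‖U.F.φ s a‖ ≤ 1) {h k : ℕ} (hk : k ≤ K) (hh : h < U.H)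
    (x : EuclideanSpace ℝ (Fin d)) {g : S → ℝ} (hg : Measurable g) (hg0 : ∀ s, 0 ≤ g s)
    (hgH : ∀ s, g s ≤ U.H) (b : ℝ) :
    μ.real {ω | b < U.compensatedNoise M (X ω) h k x g} ≤ Real.exp (-b) := by
  -- With the step `h` fixed, the filtration is sampled once per episode, at the time of the action;
  -- the next state is revealed before the following sampling time.
  let 𝒢 : Filtration ℕ mΩ := ⟨fun t => 𝓕 (U.clock t h), fun s t hst => 𝓕.mono (by
    unfold clock; gcongr), fun t => 𝓕.le _⟩
  have hx : ∀ t < k, Measurable[𝓕 (U.clock t h)] fun ω => inner ℝ x (U.phiAt (X ω) h t) :=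
    fun t ht => measurable_const.inner (hR.measurable_phiAt hφ (by omega) hh)
  have hxb : ∀ t ω, |inner ℝ x (U.phiAt (X ω) h t)| ≤ ‖x‖ := fun t ω =>
    (abs_real_inner_le_norm _ _).trans (mul_le_of_le_one_right (norm_nonneg _) (hφ1 _ _))
  refine measureReal_lt_sum_sub_sq_le (𝒢 := 𝒢) (n := k) (c := U.H * ‖x‖)
    (Y := fun t ω => inner ℝ x (U.phiAt (X ω) h t) * noise M (X ω) h g t)
    (q := fun t ω => U.H * |inner ℝ x (U.phiAt (X ω) h t)|) ?_ ?_ ?_ ?_ ?_ b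
  · exact fun t ht => (continuous_abs.measurable.comp (hx t ht)).const_mul _
  · intro t ht
    have h1 : U.clock t h ≤ U.clock (t + 1) h := by unfold clock; gcongr; omega
    have h2 : U.clock t (h + 1) ≤ U.clock (t + 1) h := clock_le_clock (by omega) hh
    exact ((hx t ht).mono (𝓕.mono h1) le_rfl).mul
      ((hR.measurable_noise (by omega) hh hg).mono (𝓕.mono h2) le_rfl)
  · intro t ht ω
    rw [abs_mul, mul_comm]
    exact mul_le_mul_of_nonneg_right (abs_noise_le hg0 hgH _ _ _) (abs_nonneg _)
  · intro t ht ω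
    exact mul_le_mul_of_nonneg_left (hxb t ω) (Nat.cast_nonneg _)
  · rintro t ht Z hZ ⟨C, hC⟩
    have := hR.integral_mul_sub_eq_zero (show t < K by omega) hh (f := fun p => g p.2)
      (hg.comp (@measurable_snd Ω S (𝓕 (U.clock t h)) _))
      (c := U.H) (fun p => by rw [abs_of_nonneg (hg0 _)]; exact hgH _)
      (Z := fun ω => Z ω * inner ℝ x (U.phiAt (X ω) h t)) (hZ.mul (hx t ht)) (C := C * ‖x‖)
      (fun ω => by
        rw [abs_mul]
        exact mul_le_mul (hC ω) (hxb t ω) (abs_nonneg _) ((abs_nonneg _).trans (hC ω)))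
    rw [← this]
    refine integral_congr_ae (ae_of_all _ fun ω => ?_)
    simp only [noise]
    ring

theorem IsRun.measurable_gap (hH : U.H = M.H) (hφ : ∀ a, Measurable fun s => U.F.φ s a)
    (hψ : ∀ a, Measurable fun p : S × W => U.F.ψ p.1 a p.2)
    (hr : ∀ h < U.H, ∀ a, Measurable fun p : S × W => M.r h p.1 a p.2) {k h t : ℕ}
    (hk : k < K) (hh : h ≤ U.H) (ht : U.clock k 0 ≤ t) :
    Measurable[(𝓕 t).prod inferInstance] fun p : Ω × S =>
      U.gap M (X p.1) (fun j => ξ j p.1) (fun j => π j p.1) k h p.2 := by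
  have hle : (𝓕 (U.clock k 0)).prod (inferInstance : MeasurableSpace S)
      ≤ (𝓕 t).prod inferInstance :=
    sup_le_sup_right (MeasurableSpace.comap_mono (𝓕.mono ht)) _
  exact ((hR.measurable_V_planIndex hφ hψ hr hk h).sub
    (hR.measurable_value hH hr hk hh)).mono hle le_rfl

/-- A deviation inequality for the martingale of the value gaps. -/
theorem IsRun.measureReal_lt_gap_noise_le (hH : U.H = M.H)
    (hφ : ∀ a, Measurable fun s => U.F.φ s a)
    (hψ : ∀ a, Measurable fun p : S × W => U.F.ψ p.1 a p.2)
    (hr : ∀ h < U.H, ∀ a, Measurable fun p : S × W => M.r h p.1 a p.2) {l : ℝ} (hl : 0 ≤ l)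
    (b : ℝ) :
    μ.real {ω | b + K * (U.H + 1) * (2 * U.H * l) ^ 2 < -l * ∑ k ∈ range K, ∑ h ∈ range U.H,
      noise M (X ω) h (U.gap M (X ω) (fun j => ξ j ω) (fun j => π j ω) k (h + 1)) k}
      ≤ Real.exp (-b) := by
  set D : ℕ → ℕ → Ω → S → ℝ := fun k h ω =>
    U.gap M (X ω) (fun j => ξ j ω) (fun j => π j ω) k h with hD
  -- All steps of all episodes are put on one time line. An episode has `H + 1` ticks, and the last
  -- one, at which no action is taken, contributes zero. Gaps lie in `[-H, H]`, whence the bound `2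
  -- H l`.
  set Y : ℕ → Ω → ℝ := fun t ω => if t % (U.H + 1) < U.H then
    -l * noise M (X ω) (t % (U.H + 1)) (D (t / (U.H + 1)) (t % (U.H + 1) + 1) ω) (t / (U.H + 1))
    else 0 with hY
  have hDm : ∀ {k h t : ℕ}, k < K → h ≤ U.H → U.clock k 0 ≤ t →
      Measurable[(𝓕 t).prod inferInstance] fun p : Ω × S => D k h p.1 p.2 :=
    fun hk hh ht => hR.measurable_gap hH hφ hψ hr hk hh ht
  have hDb : ∀ k h ω s, h ≤ U.H → |D k h ω s| ≤ U.H := fun k h ω s hh =>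
    abs_gap_le hH _ _ _ k hh s
  have hclock : ∀ t, U.clock (t / (U.H + 1)) (t % (U.H + 1)) = t := fun t => by
    unfold clock; rw [mul_comm]; exact Nat.div_add_mod t _
  have hdiv : ∀ t < K * (U.H + 1), t / (U.H + 1) < K := fun t ht =>
    Nat.div_lt_of_lt_mul (by rwa [mul_comm])
  have hmain := measureReal_lt_sum_sub_sq_le (μ := μ) (𝒢 := 𝓕) (n := K * (U.H + 1))
    (c := 2 * U.H * l) (Y := Y) (q := fun _ _ => 2 * U.H * l) (fun t _ => measurable_const)
    ?_ ?_ (fun _ _ _ => le_rfl) ?_ b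
  · refine (measureReal_mono (fun ω hω => ?_)).trans hmain
    have hω' : b + K * (U.H + 1) * (2 * U.H * l) ^ 2 < -l * ∑ k ∈ range K, ∑ h ∈ range U.H,
      noise M (X ω) h (D k (h + 1) ω) k := hω
    change b < ∑ t ∈ range (K * (U.H + 1)), (Y t ω - (2 * U.H * l) ^ 2)
    have hsum : ∑ t ∈ range (K * (U.H + 1)), Y t ω = -l * ∑ k ∈ range K, ∑ h ∈ range U.H,
        noise M (X ω) h (D k (h + 1) ω) k := by
      rw [sum_range_mul_eq, Finset.mul_sum]
      refine Finset.sum_congr rfl fun k _ => ?_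
      rw [Finset.sum_range_succ, Finset.mul_sum]
      have hmod : ∀ h ≤ U.H, (k * (U.H + 1) + h) % (U.H + 1) = h := fun h hh => by
        rw [Nat.mul_add_mod_self_right, Nat.mod_eq_of_lt (by omega)]
      have hdv : ∀ h ≤ U.H, (k * (U.H + 1) + h) / (U.H + 1) = k := fun h hh => by
        rw [mul_comm, Nat.mul_add_div (by omega), Nat.div_eq_of_lt (by omega), add_zero]
      have hlast : Y (k * (U.H + 1) + U.H) ω = 0 := by
        simp only [hY, hmod U.H le_rfl, lt_irrefl, if_false]
      rw [hlast, add_zero]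
      refine Finset.sum_congr rfl fun h hh => ?_
      have hh := mem_range.1 hh
      simp only [hY, hmod h hh.le, hdv h hh.le, hh, if_true]
    rw [Finset.sum_sub_distrib, hsum]
    simp only [sum_const, card_range, nsmul_eq_mul]
    push_cast
    linarith
  · intro t ht
    by_cases hlt : t % (U.H + 1) < U.H
    · simp only [hY, hlt, if_true]
      have := M.markov (t % (U.H + 1))
      set k := t / (U.H + 1)
      set h := t % (U.H + 1)
      have hk : k < K := hdiv t ht
      have hc1 : U.clock k (h + 1) = t + 1 := by
        rw [← hclock t]; unfold clock; ring
      have hc0 : U.clock k 0 ≤ t := (clock_zero_le k h).trans_eq (hclock t)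
      have hm := hDm (k := k) (h := h + 1) (t := t + 1) hk hlt (by omega)
      have h1 : Measurable[𝓕 (t + 1)] fun ω => D k (h + 1) ω ((X ω).st k (h + 1)) :=
        measurable_comp_prodMk le_rfl hm (hc1 ▸ hR.st_meas k hk (h + 1) hlt)
      have hle : 𝓕 (U.clock k h) ≤ 𝓕 (t + 1) := 𝓕.mono (by rw [hclock t]; omega)
      have h2 : Measurable[𝓕 (t + 1)] fun ω =>
          ∫ s', D k (h + 1) ω s' ∂(M.P h ((X ω).st k h, (X ω).ac k h)) :=
        measurable_integral_kernel (P := M.P h) (u := fun ω => ((X ω).st k h, (X ω).ac k h))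
          (((hR.st_meas k hk h hlt.le).mono hle le_rfl).prodMk
            ((hR.measurable_ac hk hlt).mono hle le_rfl)) hm
      exact (h1.sub h2).const_mul _
    · simp only [hY, hlt, if_false]
      exact measurable_const
  · intro t ht ω
    by_cases hlt : t % (U.H + 1) < U.H
    · simp only [hY, hlt, if_true]
      have := M.markov (t % (U.H + 1))
      rw [abs_mul, abs_neg, abs_of_nonneg hl, mul_comm]
      refine mul_le_mul_of_nonneg_right ?_ hl
      have h1 : |∫ s', D (t / (U.H + 1)) (t % (U.H + 1) + 1) ω s' ∂(M.P (t % (U.H + 1))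
          ((X ω).st (t / (U.H + 1)) (t % (U.H + 1)), (X ω).ac (t / (U.H + 1)) (t % (U.H + 1))))|
          ≤ U.H := abs_integral_le_of_abs_le fun s => hDb _ _ ω s hlt
      have h2 := hDb (t / (U.H + 1)) (t % (U.H + 1) + 1) ω
        ((X ω).st (t / (U.H + 1)) (t % (U.H + 1) + 1)) hlt
      exact (abs_sub _ _).trans (by linarith)
    · simp only [hY, hlt, if_false, abs_zero]
      positivity
  · rintro t ht Z hZ ⟨C, hC⟩
    by_cases hlt : t % (U.H + 1) < U.H
    · simp only [hY, hlt, if_true]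
      set k := t / (U.H + 1) with hkdef
      set h := t % (U.H + 1) with hhdef
      have hk : k < K := hdiv t ht
      have hct : U.clock k h = t := hclock t
      have := hR.integral_mul_sub_eq_zero hk hlt (f := fun p => D k (h + 1) p.1 p.2)
        (hDm hk hlt (clock_zero_le k h)) (c := U.H) (fun p => hDb _ _ _ _ hlt)
        (Z := fun ω => -l * Z ω) (by rw [hct]; exact hZ.const_mul _) (C := l * C)
        (fun ω => by
          rw [abs_mul, abs_neg, abs_of_nonneg hl]
          exact mul_le_mul_of_nonneg_left (hC ω) hl)
      rw [← this]
      refine integral_congr_ae (ae_of_all _ fun ω => ?_)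
      simp only [noise]
      ring
    · simp only [hY, hlt, if_false, mul_zero, integral_zero]

end UCBlvd

/-! ### The confidence event -/

namespace UCBlvd

theorem abs_noise_sub_le {S A W : Type*} [MeasurableSpace S] [MeasurableSpace A]
    {M : ContextualMDP S A W} {g g' : S → ℝ} {c γ : ℝ} (hg : Measurable g) (hg' : Measurable g')
    (hgc : ∀ s, |g s| ≤ c) (hgc' : ∀ s, |g' s| ≤ c) (h : ∀ s, |g s - g' s| ≤ γ)
    (X : History S A W) (l τ : ℕ) : |noise M X l g τ - noise M X l g' τ| ≤ 2 * γ := by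
  have := M.markov l
  set P := M.P l (X.st τ l, X.ac τ l)
  have hi : Integrable g P := Integrable.of_bound hg.aestronglyMeasurable c (ae_of_all _ hgc)
  have hi' : Integrable g' P := Integrable.of_bound hg'.aestronglyMeasurable c (ae_of_all _ hgc')
  have h1 : noise M X l g τ - noise M X l g' τ
      = (g (X.st τ (l + 1)) - g' (X.st τ (l + 1))) - ∫ s, (g s - g' s) ∂P := by
    rw [integral_sub hi hi']; unfold noise; ring
  rw [h1]
  have h2 : |∫ s, (g s - g' s) ∂P| ≤ γ := abs_integral_le_of_abs_le h
  have h3 := h (X.st τ (l + 1))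
  exact (abs_sub _ _).trans (by linarith)

/-- The price of replacing direction and function by their neighbours on the grid. -/
theorem compensatedNoise_le_add {S A W : Type*} [MeasurableSpace S] [MeasurableSpace A]
    {d m n : ℕ} {U : UCBlvd S A W d m n} {M : ContextualMDP S A W}
    (hφ1 : ∀ s a, ‖U.F.φ s a‖ ≤ 1) {g g' : S → ℝ} {R η γ : ℝ} (hg : Measurable g)
    (hg' : Measurable g') (hg0 : ∀ s, 0 ≤ g s) (hgH : ∀ s, g s ≤ U.H) (hg0' : ∀ s, 0 ≤ g' s)
    (hgH' : ∀ s, g' s ≤ U.H) (h : ∀ s, |g s - g' s| ≤ γ) {x x' : EuclideanSpace ℝ (Fin d)}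
    (hx : ‖x‖ ≤ R) (hxx : ‖x - x'‖ ≤ η) (X : History S A W) (l k : ℕ) :
    U.compensatedNoise M X l k x g ≤ U.compensatedNoise M X l k x' g'
      + k * (η * U.H + 2 * R * γ + U.H ^ 2 * (η * (2 * R + η))) := by
  have hR : 0 ≤ R := (norm_nonneg _).trans hx
  have hη : 0 ≤ η := (norm_nonneg _).trans hxx
  have hterm : ∀ τ, inner ℝ x (U.phiAt X l τ) * noise M X l g τ
      - (U.H * |inner ℝ x (U.phiAt X l τ)|) ^ 2 ≤ inner ℝ x' (U.phiAt X l τ) * noise M X l g' τ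
      - (U.H * |inner ℝ x' (U.phiAt X l τ)|) ^ 2
      + (η * U.H + 2 * R * γ + U.H ^ 2 * (η * (2 * R + η))) := by
    intro τ
    have hinner : ∀ v : EuclideanSpace ℝ (Fin d), |inner ℝ v (U.phiAt X l τ)| ≤ ‖v‖ := fun v =>
      (abs_real_inner_le_norm _ _).trans (mul_le_of_le_one_right (norm_nonneg _) (hφ1 _ _))
    have h1 := (hinner x).trans hx
    have h2 := (hinner (x - x')).trans hxx
    rw [inner_sub_left] at h2
    have h3 := abs_noise_sub_le (M := M) hg hg'
      (fun s => by rw [abs_of_nonneg (hg0 s)]; exact hgH s)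
      (fun s => by rw [abs_of_nonneg (hg0' s)]; exact hgH' s) h X l τ
    have h4 : |noise M X l g' τ| ≤ U.H := abs_noise_le hg0' hgH' X l τ
    set a := inner ℝ x (U.phiAt X l τ)
    set a' := inner ℝ x' (U.phiAt X l τ)
    set e := noise M X l g τ
    set e' := noise M X l g' τ
    have h5 : a * (e - e') ≤ R * (2 * γ) := (le_abs_self _).trans (by
      rw [abs_mul]; exact mul_le_mul h1 h3 (abs_nonneg _) hR)
    have h6 : (a - a') * e' ≤ η * U.H := (le_abs_self _).trans (by
      rw [abs_mul]; exact mul_le_mul h2 h4 (abs_nonneg _) hη)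
    have h7 : a' ^ 2 - a ^ 2 ≤ η * (2 * R + η) := by
      have h8 : |a + a'| ≤ 2 * R + η := by
        have : a + a' = 2 * a - (a - a') := by ring
        rw [this]
        refine (abs_sub _ _).trans ?_
        rw [abs_mul, abs_two]
        linarith
      have h9 : a' ^ 2 - a ^ 2 = -((a - a') * (a + a')) := by ring
      rw [h9]
      refine (neg_le_abs _).trans ?_
      rw [abs_mul]
      exact mul_le_mul h2 h8 (abs_nonneg _) hη
    have h10 := mul_le_mul_of_nonneg_left h7 (sq_nonneg (U.H : ℝ))
    rw [mul_pow, mul_pow, sq_abs, sq_abs]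
    nlinarith
  unfold compensatedNoise
  calc _ ≤ ∑ τ ∈ range k, _ := Finset.sum_le_sum fun τ _ => hterm τ
    _ = _ := by rw [Finset.sum_add_distrib, sum_const, card_range, nsmul_eq_mul]

/-- The discretization error of the confidence event. -/
noncomputable def gridError (d m H K : ℕ) (R ε b bt : ℝ) : ℝ :=
  K * (d * ε * H + 2 * R * (d * m * ε + b * √(d * ε) + bt * √(d * m * ε))
    + H ^ 2 * (d * ε * (2 * R + d * ε)))

variable {Ω S A W : Type*} [MeasurableSpace S] [MeasurableSpace A] [MeasurableSpace W]
  [Fintype A] [Nonempty A] [DiscreteMeasurableSpace A] {mΩ : MeasurableSpace Ω} {d m n : ℕ}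
  {M : ContextualMDP S A W} {K : ℕ} {μ : Measure Ω} [IsProbabilityMeasure μ]
  {𝓕 : Filtration ℕ mΩ} {X : Ω → History S A W}
  {ξ : ℕ → Ω → ℕ → EuclideanSpace ℝ (Fin d × Fin m)} {π : ℕ → Ω → ℕ → S → W → A}

/-- With high probability, the compensated noise is bounded uniformly over all bounded directions
and over the function class with bounded parameters. -/
theorem IsRun.exists_confidence_event {U : UCBlvd S A W d m n} (hR : U.IsRun M K μ 𝓕 X ξ π)
    (hφ : ∀ a, Measurable fun s => U.F.φ s a)
    (hψ : ∀ a, Measurable fun p : S × W => U.F.ψ p.1 a p.2)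
    (hφ1 : ∀ s a, ‖U.F.φ s a‖ ≤ 1) (hψ1 : ∀ s a w, ‖U.F.ψ s a w‖ ≤ 1) {R ε b bt : ℝ}
    (hR0 : 0 ≤ R) (hε : 0 < ε) (hb : 0 ≤ b) (hbt : 0 ≤ bt) (ι : ℝ) :
    ∃ E : Set Ω, μ.real Eᶜ ≤ K * U.H * n
        * (2 * R / ε + 3) ^ (d + d * m + d * d + d * m * (d * m)) * Real.exp (-ι) ∧
      ∀ ω ∈ E, ∀ k < K, ∀ h < U.H, ∀ j, ∀ (x : EuclideanSpace ℝ (Fin d))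
        (ν : EuclideanSpace ℝ (Fin d × Fin m)) (B : Matrix (Fin d) (Fin d) ℝ)
        (Bt : Matrix (Fin d × Fin m) (Fin d × Fin m) ℝ), ‖x‖ ≤ R → ‖ν‖ ≤ R →
        (∀ i i', |B i i'| ≤ R) → (∀ i i', |Bt i i'| ≤ R) →
        U.compensatedNoise M (X ω) h k x
          (fun s => bonusValue U.F U.H b bt ν B Bt s (U.F.wrep j))
          ≤ ι + gridError d m U.H K R ε b bt := by
  obtain ⟨N₁, hN₁, hx⟩ := exists_grid (Fin d) hR0 hε
  obtain ⟨N₂, hN₂, hν⟩ := exists_grid (Fin d × Fin m) hR0 hε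
  obtain ⟨N₃, hN₃, hB⟩ := exists_grid (Fin d × Fin d) hR0 hε
  obtain ⟨N₄, hN₄, hBt⟩ := exists_grid ((Fin d × Fin m) × (Fin d × Fin m)) hR0 hε
  let I : Finset ((ℕ × ℕ × Fin n) × (Fin d → ℝ) × (Fin d × Fin m → ℝ) × (Fin d × Fin d → ℝ) ×
      ((Fin d × Fin m) × (Fin d × Fin m) → ℝ)) :=
    -- One bad event per episode, step, representative context and grid point. The four grids have
    -- dimensions `d`, `d m`, `d²` and `(d m)²`, which add up in the exponent.
    (range K ×ˢ range U.H ×ˢ univ) ×ˢ N₁ ×ˢ N₂ ×ˢ N₃ ×ˢ N₄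
  let G : (ℕ × ℕ × Fin n) × (Fin d → ℝ) × (Fin d × Fin m → ℝ) × (Fin d × Fin d → ℝ) ×
      ((Fin d × Fin m) × (Fin d × Fin m) → ℝ) → S → ℝ := fun p s =>
    bonusValue U.F U.H b bt (WithLp.toLp 2 p.2.2.1) (fun i i' => p.2.2.2.1 (i, i'))
      (fun i i' => p.2.2.2.2 (i, i')) s (U.F.wrep p.1.2.2)
  let bad : (ℕ × ℕ × Fin n) × (Fin d → ℝ) × (Fin d × Fin m → ℝ) × (Fin d × Fin d → ℝ) ×
      ((Fin d × Fin m) × (Fin d × Fin m) → ℝ) → Set Ω := fun p =>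
    {ω | ι < U.compensatedNoise M (X ω) p.1.2.1 p.1.1 (WithLp.toLp 2 p.2.1) (G p)}
  have hmeas : ∀ ν B Bt w, Measurable fun s => bonusValue U.F U.H b bt ν B Bt s w :=
    fun ν B Bt w => measurable_bonusValue hφ hψ measurable_const (fun _ _ => measurable_const)
      (fun _ _ => measurable_const) measurable_id measurable_const
  refine ⟨(⋃ p ∈ I, bad p)ᶜ, ?_, ?_⟩
  · rw [compl_compl]
    refine (measureReal_biUnion_finset_le I bad).trans ?_
    calc ∑ p ∈ I, μ.real (bad p) ≤ ∑ p ∈ I, Real.exp (-ι) := by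
          refine Finset.sum_le_sum fun p hp => ?_
          simp only [I, Finset.mem_product, mem_range] at hp
          exact hR.measureReal_lt_compensatedNoise_le hφ hφ1 hp.1.1.le hp.1.2.1 _ (hmeas _ _ _ _)
            (fun s => bonusValue_nonneg _ _ _ _ _) (fun s => bonusValue_le _ _ _ _ _) ι
      _ = (#I : ℝ) * Real.exp (-ι) := by simp
      _ ≤ _ := by
          gcongr
          simp only [I, Finset.card_product, Nat.cast_mul, card_range, card_univ, Fintype.card_fin]
          simp only [Fintype.card_prod, Fintype.card_fin] at hN₁ hN₂ hN₃ hN₄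
          rw [pow_add, pow_add, pow_add]
          calc (K : ℝ) * (U.H * n) * (#N₁ * (#N₂ * (#N₃ * #N₄)))
              = (K : ℝ) * U.H * n * (#N₁ * #N₂ * #N₃ * #N₄) := by ring
            _ ≤ _ := by gcongr
  · intro ω hω k hk h hh j x ν B Bt hxR hνR hBR hBtR
    obtain ⟨x', hx'N, hx'⟩ := hx x.ofLp fun i => (PiLp.norm_apply_le x i).trans hxR
    obtain ⟨ν', hν'N, hν'⟩ := hν ν.ofLp fun i => (PiLp.norm_apply_le ν i).trans hνR
    obtain ⟨B', hB'N, hB'⟩ := hB (fun p => B p.1 p.2) fun p => hBR _ _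
    obtain ⟨Bt', hBt'N, hBt'⟩ := hBt (fun p => Bt p.1 p.2) fun p => hBtR _ _
    have hmem : ((k, h, j), x', ν', B', Bt') ∈ I := by
      simp only [I, Finset.mem_product, mem_range, mem_univ, and_true]
      exact ⟨⟨hk, hh⟩, hx'N, hν'N, hB'N, hBt'N⟩
    have hnot : ω ∉ bad ((k, h, j), x', ν', B', Bt') := fun hbad =>
      hω (Set.mem_biUnion hmem hbad)
    have hle : U.compensatedNoise M (X ω) h k (WithLp.toLp 2 x') (G ((k, h, j), x', ν', B', Bt'))
        ≤ ι := not_lt.1 hnot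
    have hη : ‖x - WithLp.toLp 2 x'‖ ≤ d * ε := by
      have := norm_le_card_mul_of_forall_le (v := x - WithLp.toLp 2 x') (ε := ε) hx'
      rwa [Fintype.card_fin] at this
    have hνη : ‖ν - WithLp.toLp 2 ν'‖ ≤ d * m * ε := by
      have := norm_le_card_mul_of_forall_le (v := ν - WithLp.toLp 2 ν') (ε := ε) hν'
      rwa [Fintype.card_prod, Fintype.card_fin, Fintype.card_fin, Nat.cast_mul] at this
    have hclose : ∀ s, |bonusValue U.F U.H b bt ν B Bt s (U.F.wrep j)
        - G ((k, h, j), x', ν', B', Bt') s|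
        ≤ d * m * ε + b * √(d * ε) + bt * √(d * m * ε) := by
      intro s
      have h1 := bonusValue_le_add (H := U.H) hb hbt hφ1 hψ1 (ν := ν) (ν' := WithLp.toLp 2 ν')
        (B := B) (B' := fun i i' => B' (i, i')) (Bt := Bt) (Bt' := fun i i' => Bt' (i, i'))
        hε.le (fun i i' => hB' (i, i')) (fun i i' => hBt' (i, i')) s (U.F.wrep j)
      have h2 := bonusValue_le_add (H := U.H) hb hbt hφ1 hψ1 (ν' := ν) (ν := WithLp.toLp 2 ν')
        (B' := B) (B := fun i i' => B' (i, i')) (Bt' := Bt) (Bt := fun i i' => Bt' (i, i'))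
        hε.le (fun i i' => by rw [abs_sub_comm]; exact hB' (i, i'))
        (fun i i' => by rw [abs_sub_comm]; exact hBt' (i, i')) s (U.F.wrep j)
      rw [norm_sub_rev] at h2
      exact abs_le.2 ⟨by simp only [G]; linarith, by simp only [G]; linarith⟩
    have hmain := compensatedNoise_le_add (M := M) hφ1 (hmeas ν B Bt (U.F.wrep j)) (hmeas _ _ _ _)
      (fun s => bonusValue_nonneg _ _ _ _ _) (fun s => bonusValue_le _ _ _ _ _)
      (fun s => bonusValue_nonneg _ _ _ _ _) (fun s => bonusValue_le _ _ _ _ _) hclose hxR hη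
      (X ω) h k
    refine hmain.trans (add_le_add hle ?_)
    unfold gridError
    gcongr

/-- On the confidence event, plans are accurate. -/
theorem isAccurate_of_compensatedNoise_le {F : Features S A W d m n} (hA : StandingAssumptions M F)
    (hd : 0 < d) (hm : 0 < m) (hH : 0 < M.H) {X : History S A W} {k : ℕ}
    {ξ : ℕ → EuclideanSpace ℝ (Fin d × Fin m)} {β βt β₀ R b : ℝ}
    (hk : k < K) (hβt : βt = √((m : ℝ) * d))
    (hrew : ∀ τ < K, ∀ h < M.H, X.rew τ h = M.r h (X.st τ h) (X.ac τ h) (X.ctx τ))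
    (hplan : IsPlan ⟨F, M.H, 1, β, βt⟩ X k ξ) (hKR : (K : ℝ) + m * d ≤ R)
    (hHR : 3 * M.H * (m * d) ≤ R) (hβ₀0 : 0 ≤ β₀) (hβ₀ : β₀ ≤ β)
    (hbβ : 4 * (M.H : ℝ) ^ 2 * b + (M.H * (m * d)) ^ 2 ≤ β₀ ^ 2)
    (hnoise : ∀ h < M.H, ∀ j, ∀ (x : EuclideanSpace ℝ (Fin d))
        (ν : EuclideanSpace ℝ (Fin d × Fin m)) (B : Matrix (Fin d) (Fin d) ℝ)
        (Bt : Matrix (Fin d × Fin m) (Fin d × Fin m) ℝ), ‖x‖ ≤ R → ‖ν‖ ≤ R →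
        (∀ i i', |B i i'| ≤ R) → (∀ i i', |Bt i i'| ≤ R) →
        compensatedNoise ⟨F, M.H, 1, β, βt⟩ M X h k x
          (fun s => bonusValue F M.H (2 * F.L * β) βt ν B Bt s (F.wrep j)) ≤ b) :
    IsAccurate ⟨F, M.H, 1, β, βt⟩ M X k ξ β₀ := by
  obtain ⟨ρ, hρ⟩ := hA.mapping
  have hd1 : (1 : ℝ) ≤ d := by exact_mod_cast hd
  have hm1 : (1 : ℝ) ≤ m := by exact_mod_cast hm
  have hH1 : (1 : ℝ) ≤ M.H := by exact_mod_cast hH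
  have hmd1 : (1 : ℝ) ≤ m * d := one_le_mul_of_one_le_of_one_le hm1 hd1
  have hR1 : 1 ≤ R := by
    have : (0 : ℝ) ≤ K := Nat.cast_nonneg _
    linarith
  have hsqrt : √((m : ℝ) * d) ≤ m * d := by
    rw [Real.sqrt_le_left (by positivity)]
    nlinarith
  intro h hh s a w
  obtain ⟨x, hx, hback⟩ := hA.exists_backup one_pos β βt X k ξ hh
  -- The norm bounds of `x` and `ρ` give `H √(m d) √d ≤ H m d`, since `m ≥ 1`.
  have hθ : ∀ j, ‖contractVec x (ρ (F.wrep j))‖ ≤ M.H * (m * d) := by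
    intro j
    have h1 := hA.norm_rho_le hρ hH hd (F.wrep j)
    calc _ ≤ ‖x‖ * ‖ρ (F.wrep j)‖ := norm_contractVec_le _ _
      _ ≤ M.H * √((m : ℝ) * d) * √(d : ℝ) := mul_le_mul hx h1 (norm_nonneg _) (by positivity)
      _ = M.H * √(m * d * d) := by rw [mul_assoc, ← Real.sqrt_mul (by positivity)]
      _ ≤ M.H * (m * d) := by
          gcongr
          rw [Real.sqrt_le_left (by positivity)]
          nlinarith [mul_nonneg (mul_nonneg (sub_nonneg.2 hm1) (by positivity : (0 : ℝ) ≤ m))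
            (by positivity : (0 : ℝ) ≤ (d : ℝ) * d)]
  have hparams : ∀ j, ∃ (ν : EuclideanSpace ℝ (Fin d × Fin m)) (B : Matrix (Fin d) (Fin d) ℝ)
      (Bt : Matrix (Fin d × Fin m) (Fin d × Fin m) ℝ), ‖ν‖ ≤ R ∧ (∀ i i', |B i i'| ≤ R) ∧
      (∀ i i', |Bt i i'| ≤ R) ∧ (fun s => V ⟨F, M.H, 1, β, βt⟩ X k ξ (h + 1) s (F.wrep j))
        = fun s => bonusValue F M.H (2 * F.L * β) βt ν B Bt s (F.wrep j) := by
    intro j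
    rcases lt_or_ge (h + 1) M.H with hh1 | hh1
    · refine ⟨etaT ⟨F, M.H, 1, β, βt⟩ X k (h + 1) + ξ (h + 1),
        (Lam ⟨F, M.H, 1, β, βt⟩ X k (h + 1))⁻¹, (LamT ⟨F, M.H, 1, β, βt⟩ X k (h + 1))⁻¹, ?_,
        fun i i' => (abs_gramMatrix_inv_apply_le i i').trans hR1,
        fun i i' => (abs_gramMatrix_inv_apply_le i i').trans hR1,
        funext fun s => V_eq_bonusValue ⟨F, M.H, 1, β, βt⟩ X k ξ hh1 s (F.wrep j)⟩
      have h1 := (norm_etaT_le_and_abs_inner_sub_le (β := β) (βt := βt) hA hk.le hh1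
        fun τ hτ => hrew τ hτ (h + 1) hh1).1
      obtain ⟨_, ⟨-, h2⟩, -⟩ := hplan (h + 1) hh1
      have h2' : ‖ξ (h + 1)‖ ≤ M.H * √((m : ℝ) * d) := h2
      have h3 := norm_add_le (etaT ⟨F, M.H, 1, β, βt⟩ X k (h + 1)) (ξ (h + 1))
      have h4 : (M.H : ℝ) * √((m : ℝ) * d) ≤ M.H * (m * d) := by gcongr
      nlinarith
    · refine ⟨0, 0, 0, ?_, fun i i' => ?_, fun i i' => ?_, funext fun s => ?_⟩
      · rw [norm_zero]; linarith
      · simp only [Matrix.zero_apply, abs_zero]; linarith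
      · simp only [Matrix.zero_apply, abs_zero]; linarith
      · rw [bonusValue_zero, V_of_le ⟨F, M.H, 1, β, βt⟩ X k ξ hh1]
  have hconf : ∀ j, weightedNorm (Lam ⟨F, M.H, 1, β, βt⟩ X k h)
      (thetaT ⟨F, M.H, 1, β, βt⟩ X k ξ h (F.wrep j) - contractVec x (ρ (F.wrep j))) ≤ β₀ := by
    intro j
    obtain ⟨ν, B, Bt, hν, hB, hBt, hV⟩ := hparams j
    set θ := contractVec x (ρ (F.wrep j)) with hθdef
    set t := thetaT ⟨F, M.H, 1, β, βt⟩ X k ξ h (F.wrep j) with ht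
    have hHpos : (0 : ℝ) < M.H := by linarith
    -- The test direction depends on the data, and uniformity over the ball of radius `R` covers it:
    -- `‖t‖ ≤ k H` and `‖θ‖ ≤ H m d`.
    have hu : ‖(2 * (M.H : ℝ) ^ 2)⁻¹ • (t - θ)‖ ≤ R := by
      have h1 : ‖t‖ ≤ k * M.H := norm_ridge_le hHpos.le (fun τ _ => hA.norm_phi_le _ _)
        fun τ _ => by
          rw [abs_of_nonneg (V_nonneg _ _ _ _ _ _ _)]
          exact V_le ⟨F, M.H, 1, β, βt⟩ X k ξ _ _ _
      have h2 := norm_sub_le t θ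
      have h3 := hθ j
      have h4 : (k : ℝ) ≤ K := by exact_mod_cast hk.le
      rw [norm_smul, Real.norm_eq_abs, abs_of_pos (by positivity), inv_mul_le_iff₀ (by positivity)]
      have h5 : ‖t - θ‖ ≤ M.H * R := by
        have : (k : ℝ) * M.H ≤ K * M.H := by gcongr
        have : (M.H : ℝ) * (K + m * d) ≤ M.H * R := by gcongr
        nlinarith
      have h6 : (M.H : ℝ) * R ≤ 2 * (M.H : ℝ) ^ 2 * R := by
        have : 0 ≤ (M.H : ℝ) * R := by positivity
        nlinarith
      exact h5.trans h6
    have hsum := hnoise h hh j ((2 * (M.H : ℝ) ^ 2)⁻¹ • (t - θ)) ν B Bt hu hν hB hBt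
    rw [← hV] at hsum
    have hmain := weightedNorm_ridge_sub_sq_le (x := phiAt ⟨F, M.H, 1, β, βt⟩ X h)
      (y := fun τ => V ⟨F, M.H, 1, β, βt⟩ X k ξ (h + 1) (X.st τ (h + 1)) (F.wrep j)) (k := k) θ
      (c := M.H) (b := b) hHpos (by
        refine le_trans (le_of_eq ?_) hsum
        refine Finset.sum_congr rfl fun τ _ => ?_
        -- The regression function at the true parameter is the conditional mean of the target, so
        -- the residuals are precisely the noise.
        have e : inner ℝ θ (phiAt ⟨F, M.H, 1, β, βt⟩ X h τ)
            = ∫ s', V ⟨F, M.H, 1, β, βt⟩ X k ξ (h + 1) s' (F.wrep j)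
              ∂(M.P h (X.st τ h, X.ac τ h)) := by
          rw [hback, hρ.kron, inner_kronVec]; rfl
        rw [e]
        rfl)
    have hθ2 : ‖θ‖ ^ 2 ≤ (M.H * (m * d)) ^ 2 := by gcongr; exact hθ j
    exact (sq_le_sq₀ (weightedNorm_nonneg _ _) hβ₀0).1 (hmain.trans (by linarith))
  have h1 := abs_inner_plan_sub_le hA hρ one_pos hplan hh hx hβ₀ hβ₀0 hconf s a w
  have h2 := (norm_etaT_le_and_abs_inner_sub_le (β := β) (βt := βt) hA hk.le hh
    fun τ hτ => hrew τ hτ h hh).2 s a w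
  rw [← hβt] at h2
  have e : inner ℝ (etaT ⟨F, M.H, 1, β, βt⟩ X k h + ξ h) (F.ψ s a w) - (M.r h s a w
      + ∫ s', V ⟨F, M.H, 1, β, βt⟩ X k ξ (h + 1) s' w ∂(M.P h (s, a)))
      = (inner ℝ (ξ h) (F.ψ s a w) - inner ℝ x (F.ψ s a w))
        + (inner ℝ (etaT ⟨F, M.H, 1, β, βt⟩ X k h) (F.ψ s a w) - M.r h s a w) := by
    rw [hback, inner_add_left]; ring
  simp only [e]
  exact (abs_add_le _ _).trans (add_le_add h1 h2)

end UCBlvd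

/-! ### The regret of accurate plans -/

theorem sum_le_sqrt_card_mul {K : ℕ} {f : ℕ → ℝ} {b : ℝ} (h : ∑ k ∈ range K, f k ^ 2 ≤ b) :
    ∑ k ∈ range K, f k ≤ √(K * b) := by
  refine Real.le_sqrt_of_sq_le ?_
  have h1 := sq_sum_le_card_mul_sum_sq (s := range K) (f := f)
  rw [card_range] at h1
  exact h1.trans (by gcongr)

namespace UCBlvd

variable {Ω S A W : Type*} [MeasurableSpace S] [MeasurableSpace A] [MeasurableSpace W]
  [Fintype A] [Nonempty A] [DiscreteMeasurableSpace A] {mΩ : MeasurableSpace Ω} {d m n : ℕ}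
  {F : Features S A W d m n} {β βt β₀ : ℝ}
  {M : ContextualMDP S A W} {K : ℕ} {μ : Measure Ω} [IsProbabilityMeasure μ]
  {𝓕 : Filtration ℕ mΩ} {X : Ω → History S A W}
  {ξ : ℕ → Ω → ℕ → EuclideanSpace ℝ (Fin d × Fin m)} {π : ℕ → Ω → ℕ → S → W → A}

theorem IsRun.measurable_policy {U : UCBlvd S A W d m n} (hR : U.IsRun M K μ 𝓕 X ξ π) {k h : ℕ}
    (hk : k < K) (hh : h < U.H) (ω : Ω) (w : W) : Measurable fun s => π k ω h s w := by
  have h1 : @Measurable S (Ω × (S × W)) _ ((𝓕 (U.clock k 0)).prod inferInstance)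
      fun s => (ω, (s, w)) :=
    (@measurable_prodMk_left Ω (S × W) (𝓕 (U.clock k 0)) _ ω).comp measurable_prodMk_right
  exact (hR.policy_meas k hk h hh).comp h1

/-- The regret in terms of the bonuses along the run and of the noise of the value gaps. -/
theorem IsRun.regret_le_of_isAccurate (hR : IsRun ⟨F, M.H, 1, β, βt⟩ M K μ 𝓕 X ξ π)
    (hA : StandingAssumptions M F) (hd : 0 < d) (hm : 0 < m) (hL : 0 ≤ F.L) (hβ₀0 : 0 ≤ β₀)
    (hβ₀ : β₀ ≤ β) (hβt : 0 ≤ βt) (ω : Ω)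
    (hacc : ∀ k < K, planIndex ⟨F, M.H, 1, β, βt⟩ (X ω) k = k →
      IsAccurate ⟨F, M.H, 1, β, βt⟩ M (X ω) k (ξ k ω) β₀) :
    regret M K (X ω) (fun k => π k ω) ≤
      M.H * (F.L * (3 * β + β₀) * √(K * (27 / 10 * (d * Real.log (1 + K))))
        + 2 * βt * √(K * (27 / 10 * (m * d * Real.log (1 + K)))))
      - ∑ k ∈ range K, ∑ h ∈ range M.H, noise M (X ω) h
        (gap ⟨F, M.H, 1, β, βt⟩ M (X ω) (fun j => ξ j ω) (fun j => π j ω) k (h + 1)) k := by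
  set U : UCBlvd S A W d m n := ⟨F, M.H, 1, β, βt⟩ with hU
  set D := gap U M (X ω) (fun j => ξ j ω) (fun j => π j ω) with hD
  have hβ : 0 ≤ β := hβ₀0.trans hβ₀
  have := Fin.pos_iff_nonempty.1 hd
  have := Fin.pos_iff_nonempty.1 hm
  set wφ : ℕ → ℕ → ℝ := fun k h =>
    weightedNorm (U.Lam (X ω) (U.planIndex (X ω) k) h)⁻¹ (U.phiAt (X ω) h k) with hwφ
  set wψ : ℕ → ℕ → ℝ := fun k h =>
    weightedNorm (U.LamT (X ω) (U.planIndex (X ω) k) h)⁻¹ (U.psiAt (X ω) h k) with hwψ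
  -- Accuracy is available for episodes that are their own plan index, which includes the origin of
  -- every plan in force.
  have hacc' : ∀ k < K, U.IsAccurate M (X ω) (U.planIndex (X ω) k)
      (ξ (U.planIndex (X ω) k) ω) β₀ := fun k hk =>
    hacc _ ((U.planIndex_le (X ω) k).trans_lt hk) (U.planIndex_planIndex (X ω) k)
  have hstep : ∀ k < K, ∀ h < M.H, D k h ((X ω).st k h) ≤
      F.L * (3 * β + β₀) * wφ k h + 2 * βt * wψ k h + D k (h + 1) ((X ω).st k (h + 1))
        - noise M (X ω) h (D k (h + 1)) k := by
    intro k hk h hh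
    have h1 := V_sub_value_le hA (hacc' k hk) hL hβ hβ₀0 hβt (π := π k ω) (w := (X ω).ctx k)
      (fun h hh => hR.measurable_policy hk hh ω _) hh ((X ω).st k h)
      (fun a => hR.greedy ω k hk h hh _ _ a)
    rw [← hR.action ω k hk h hh] at h1
    have h2 : noise M (X ω) h (D k (h + 1)) k = D k (h + 1) ((X ω).st k (h + 1))
      - ∫ s', D k (h + 1) s' ∂(M.P h ((X ω).st k h, (X ω).ac k h)) := rfl
    rw [h2]
    calc D k h ((X ω).st k h) ≤ _ := h1
      _ = F.L * (3 * β + β₀) * wφ k h + 2 * βt * wψ k h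
        + ∫ s', D k (h + 1) s' ∂(M.P h ((X ω).st k h, (X ω).ac k h)) := rfl
      _ = _ := by ring
  have htel : ∀ k < K, ∀ h ≤ M.H, D k 0 ((X ω).st k 0) ≤
      ∑ i ∈ range h, (F.L * (3 * β + β₀) * wφ k i + 2 * βt * wψ k i
        - noise M (X ω) i (D k (i + 1)) k) + D k h ((X ω).st k h) := by
    intro k hk h
    induction h with
    | zero => simp
    | succ h ih =>
      intro hh
      rw [Finset.sum_range_succ]
      have h1 := ih (by omega)
      have h2 := hstep k hk h hh
      linarith
  have hepisode : ∀ k < K, M.optValue 0 ((X ω).st k 0) ((X ω).ctx k)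
      - M.value (π k ω) 0 ((X ω).st k 0) ((X ω).ctx k) ≤
      ∑ i ∈ range M.H, (F.L * (3 * β + β₀) * wφ k i + 2 * βt * wψ k i
        - noise M (X ω) i (D k (i + 1)) k) := by
    intro k hk
    have h1 := htel k hk M.H le_rfl
    have h2 : D k M.H ((X ω).st k M.H) = 0 := by
      simp only [hD, gap]
      rw [M.value_horizon, V_of_le U _ _ _ le_rfl, sub_zero]
    have h3 : M.optValue 0 ((X ω).st k 0) ((X ω).ctx k) ≤ U.V (X ω) (U.planIndex (X ω) k)
        (ξ (U.planIndex (X ω) k) ω) 0 ((X ω).st k 0) ((X ω).ctx k) :=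
      M.optValue_le fun π' hπ' => value_le_V hA hL hβ₀ (hacc' k hk) (fun h _ => hπ' h _)
        (Nat.zero_le _) _
    have h4 : D k 0 ((X ω).st k 0) = U.V (X ω) (U.planIndex (X ω) k)
        (ξ (U.planIndex (X ω) k) ω) 0 ((X ω).st k 0) ((X ω).ctx k)
        - M.value (π k ω) 0 ((X ω).st k 0) ((X ω).ctx k) := rfl
    linarith
  have hφsum : ∀ h < M.H, ∑ k ∈ range K, wφ k h ≤ √(K * (27 / 10 * (d * Real.log (1 + K)))) := by
    intro h hh
    have := U.sum_weightedNorm_sq_le (X ω) (x := U.phiAt (X ω) h)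
      (fun k => hA.norm_phi_le _ _) (fun k => (det_ratio_le (U := U) (X ω) one_pos k hh).1) K
    rw [Fintype.card_fin] at this
    exact sum_le_sqrt_card_mul this
  have hψsum : ∀ h < M.H, ∑ k ∈ range K, wψ k h
      ≤ √(K * (27 / 10 * (m * d * Real.log (1 + K)))) := by
    intro h hh
    have := U.sum_weightedNorm_sq_le (X ω) (x := U.psiAt (X ω) h)
      (fun k => hA.norm_psi_le _ _ _) (fun k => (det_ratio_le (U := U) (X ω) one_pos k hh).2) K
    rw [Fintype.card_prod, Fintype.card_fin, Fintype.card_fin, Nat.cast_mul, mul_comm (d : ℝ)] at this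
    exact sum_le_sqrt_card_mul this
  calc regret M K (X ω) (fun k => π k ω)
      ≤ ∑ k ∈ range K, ∑ i ∈ range M.H, (F.L * (3 * β + β₀) * wφ k i + 2 * βt * wψ k i
        - noise M (X ω) i (D k (i + 1)) k) :=
        Finset.sum_le_sum fun k hk => hepisode k (mem_range.1 hk)
    _ = ∑ i ∈ range M.H, (F.L * (3 * β + β₀) * ∑ k ∈ range K, wφ k i
          + 2 * βt * ∑ k ∈ range K, wψ k i)
        - ∑ k ∈ range K, ∑ i ∈ range M.H, noise M (X ω) i (D k (i + 1)) k := by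
        simp only [Finset.sum_sub_distrib, Finset.sum_add_distrib, Finset.mul_sum]
        rw [Finset.sum_comm (f := fun k i => F.L * (3 * β + β₀) * wφ k i),
          Finset.sum_comm (f := fun k i => 2 * βt * wψ k i)]
    _ ≤ ∑ i ∈ range M.H, (F.L * (3 * β + β₀) * √(K * (27 / 10 * (d * Real.log (1 + K))))
          + 2 * βt * √(K * (27 / 10 * (m * d * Real.log (1 + K)))))
        - ∑ k ∈ range K, ∑ i ∈ range M.H, noise M (X ω) i (D k (i + 1)) k := by
        gcongr with i hi i hi
        · exact hφsum i (mem_range.1 hi)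
        · exact hψsum i (mem_range.1 hi)
    _ = _ := by rw [sum_const, card_range, nsmul_eq_mul]

end UCBlvd

/-! ### Numerical estimates -/

section Numerics

variable {d m H K : ℕ} {L δ : ℝ}

/-- The argument `m d T / δ` of the logarithm in the confidence radius. -/
noncomputable def logArg (d m H K : ℕ) (δ : ℝ) : ℝ := m * d * ((K : ℝ) * H) / δ

theorem two_mul_le_logArg (hδ : 0 < δ) (hδ2 : δ < 1 / 2) :
    2 * ((m : ℝ) * d * (K * H)) ≤ logArg d m H K δ := by
  unfold logArg
  rw [le_div_iff₀ hδ]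
  nlinarith [show (0 : ℝ) ≤ m * d * (K * H) by positivity]

theorem two_le_logArg (hd : 0 < d) (hm : 0 < m) (hH : 0 < H) (hK : 0 < K) (hδ : 0 < δ)
    (hδ2 : δ < 1 / 2) : 2 ≤ logArg d m H K δ := by
  have h := two_mul_le_logArg (d := d) (m := m) (H := H) (K := K) hδ hδ2
  have h1 : (1 : ℝ) ≤ m * d * (K * H) := by
    exact_mod_cast Nat.one_le_iff_ne_zero.2 (by positivity)
  linarith

theorem log_two_le_log_logArg (hd : 0 < d) (hm : 0 < m) (hH : 0 < H) (hK : 0 < K) (hδ : 0 < δ)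
    (hδ2 : δ < 1 / 2) : 69 / 100 ≤ Real.log (logArg d m H K δ) := by
  have h1 := Real.log_two_gt_d9
  have h2 := Real.log_le_log two_pos (two_le_logArg hd hm hH hK hδ hδ2)
  linarith

theorem log_one_add_le_log_logArg (hd : 0 < d) (hm : 0 < m) (hH : 0 < H) (hK : 0 < K) (hδ : 0 < δ)
    (hδ2 : δ < 1 / 2) : Real.log (1 + K) ≤ Real.log (logArg d m H K δ) := by
  have h := two_mul_le_logArg (d := d) (m := m) (H := H) (K := K) hδ hδ2
  have hK1 : (1 : ℝ) ≤ K := by exact_mod_cast hK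
  have h1 : (1 : ℝ) ≤ m * d * H := by
    exact_mod_cast Nat.one_le_iff_ne_zero.2 (by positivity)
  apply Real.log_le_log (by positivity)
  nlinarith

theorem log_two_le_log_one_add (hK : 0 < K) : 69 / 100 ≤ Real.log (1 + K) := by
  have h1 := Real.log_two_gt_d9
  have hK1 : (1 : ℝ) ≤ K := by exact_mod_cast hK
  have h2 := Real.log_le_log two_pos (show (2 : ℝ) ≤ 1 + K by linarith)
  linarith

/-- The rate equals `L m d H² √(d K)` times the logarithm. The term with `β` yields the factor `4 ·
1024 · 2 = 8192`, the other two yield `4 + 16`, and `L ≥ 1` merges them. -/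
theorem regretBound_le_regretRate (hd : 0 < d) (hm : 0 < m) (hH : 0 < H) (hK : 0 < K) (hδ : 0 < δ)
    (hδ2 : δ < 1 / 2) (hL : 1 ≤ L) :
    regretBound d m H K L (1024 * H * (m * d) * √(Real.log (logArg d m H K δ))) (√((m : ℝ) * d)) δ
      ≤ 10000 * regretRate d m H K L δ := by
  have hd1 : (1 : ℝ) ≤ d := by exact_mod_cast hd
  have hm1 : (1 : ℝ) ≤ m := by exact_mod_cast hm
  have hH1 : (1 : ℝ) ≤ H := by exact_mod_cast hH
  have hK1 : (1 : ℝ) ≤ K := by exact_mod_cast hK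
  have hl := log_two_le_log_logArg hd hm hH hK hδ hδ2
  have hlK := log_one_add_le_log_logArg hd hm hH hK hδ hδ2
  have hl0 := log_two_le_log_one_add hK
  have hdT : Real.log (d * (K * H) / δ) ≤ Real.log (logArg d m H K δ) := by
    apply Real.log_le_log (by positivity)
    unfold logArg
    gcongr
    exact le_mul_of_one_le_left (by positivity) hm1
  unfold regretBound regretRate
  change _ ≤ 10000 * (_ * Real.log (logArg d m H K δ))
  set l := Real.log (logArg d m H K δ)
  have hmd1 : (1 : ℝ) ≤ m * d := one_le_mul_of_one_le_of_one_le hm1 hd1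
  have hsl : √l ≤ 2 * l := by
    rw [Real.sqrt_le_left (by linarith)]; nlinarith
  have hsl2 : √l * √l = l := Real.mul_self_sqrt (by linarith)
  have hsK : 0 ≤ √(K : ℝ) := Real.sqrt_nonneg _
  have hsd : 1 ≤ √(d : ℝ) := Real.one_le_sqrt.2 hd1
  have hrate : √((m : ℝ) ^ 2 * (d : ℝ) ^ 3 * (H : ℝ) ^ 3 * (K * H))
      = m * d * H ^ 2 * (√(d : ℝ) * √(K : ℝ)) := by
    rw [show (m : ℝ) ^ 2 * (d : ℝ) ^ 3 * (H : ℝ) ^ 3 * (K * H)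
      = (m * d * H ^ 2) ^ 2 * (d * K) by ring, Real.sqrt_mul (by positivity),
      Real.sqrt_sq (by positivity), Real.sqrt_mul (by positivity)]
  rw [hrate]
  have h1 : √((K : ℝ) * H * Real.log (d * (K * H) / δ)) ≤ √(K : ℝ) * H * (2 * l) := by
    calc _ ≤ √((K : ℝ) * H * l) := by gcongr
      _ = √(K : ℝ) * √(H : ℝ) * √l := by
        rw [Real.sqrt_mul (by positivity), Real.sqrt_mul (by positivity)]
      _ ≤ _ := by
        gcongr
        rw [Real.sqrt_le_left (by positivity)]
        nlinarith
  have hs2 : √(2 : ℝ) ≤ 2 := by rw [Real.sqrt_le_left (by norm_num)]; norm_num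
  have h2 : √(2 * d * Real.log (1 + K)) ≤ 2 * √(d : ℝ) * √l := by
    calc _ ≤ √(2 * d * l) := by gcongr
      _ = √2 * √(d : ℝ) * √l := by
        rw [Real.sqrt_mul (by positivity), Real.sqrt_mul (by positivity)]
      _ ≤ _ := by gcongr
  have h3 : √((m : ℝ) * d) * √(2 * (m * d) * Real.log (1 + K)) ≤ m * d * (2 * (2 * l)) := by
    calc _ ≤ √((m : ℝ) * d) * √(2 * (m * d) * l) := by gcongr
      _ = (√((m : ℝ) * d) * √((m : ℝ) * d)) * (√2 * √l) := by
        rw [Real.sqrt_mul (by positivity : (0 : ℝ) ≤ 2 * (m * d)) l,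
          Real.sqrt_mul (by norm_num : (0 : ℝ) ≤ 2) (m * d : ℝ)]
        ring
      _ ≤ _ := by
        rw [Real.mul_self_sqrt (by positivity)]
        gcongr
  set P := (m : ℝ) * d * H ^ 2 * (√(d : ℝ) * √(K : ℝ)) * l with hP
  have hH2 : (H : ℝ) ≤ H ^ 2 := by nlinarith
  have hb1 : H ^ 2 * √(K : ℝ) * l ≤ P := by
    calc H ^ 2 * √(K : ℝ) * l = 1 * H ^ 2 * (1 * √(K : ℝ)) * l := by ring
      _ ≤ _ := by rw [hP]; gcongr
  have hb2 : m * d * (H * √(K : ℝ)) * l ≤ P := by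
    calc m * d * (H * √(K : ℝ)) * l = m * d * H * (1 * √(K : ℝ)) * l := by ring
      _ ≤ _ := by rw [hP]; gcongr
  have hP0 : 0 ≤ P := by positivity
  calc _ ≤ 2 * H * (√(K : ℝ) * H * (2 * l)) + 4 * H * √(K : ℝ) *
        (L * (1024 * H * (m * d) * √l) * (2 * √(d : ℝ) * √l) + m * d * (2 * (2 * l))) := by gcongr
    _ = 4 * (H ^ 2 * √(K : ℝ) * l) + 8192 * L * (m * d * H ^ 2 * (√(d : ℝ) * √(K : ℝ))
          * (√l * √l)) + 16 * (m * d * (H * √(K : ℝ)) * l) := by ring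
    _ ≤ 4 * P + 8192 * L * P + 16 * P := by rw [hsl2]; gcongr
    _ ≤ 10000 * (L * P) := by nlinarith
    _ = _ := by rw [hP]; ring

/-- The term `4 H √K L β √(2 d log (1 + K))` alone suffices: `√K L ≥ K` and the remaining factors
are at least `1`. -/
theorem mul_le_regretBound_of_sqrt_le (hd : 0 < d) (hm : 0 < m) (hH : 0 < H) (hK : 0 < K)
    (hδ : 0 < δ) (hδ2 : δ < 1 / 2) (hL : √(K : ℝ) ≤ L) :
    (K : ℝ) * H ≤ regretBound d m H K L (1024 * H * (m * d) * √(Real.log (logArg d m H K δ)))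
      (√((m : ℝ) * d)) δ := by
  have hd1 : (1 : ℝ) ≤ d := by exact_mod_cast hd
  have hH1 : (1 : ℝ) ≤ H := by exact_mod_cast hH
  have hmd1 : (1 : ℝ) ≤ m * d := by
    exact_mod_cast Nat.one_le_iff_ne_zero.2 (by positivity)
  have hl := log_two_le_log_logArg hd hm hH hK hδ hδ2
  have hl0 := log_two_le_log_one_add hK
  unfold regretBound
  set l := Real.log (logArg d m H K δ)
  have h1 : 1 / 2 ≤ √l := Real.le_sqrt_of_sq_le (by norm_num; linarith)
  have h2 : 1 ≤ √(2 * d * Real.log (1 + K)) := Real.one_le_sqrt.2 (by nlinarith)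
  have h3 : 1 ≤ 1024 * H * (m * d) * √l := by
    calc (1 : ℝ) ≤ 1024 * 1 * 1 * (1 / 2) := by norm_num
      _ ≤ _ := by gcongr
  have h4 : √(K : ℝ) * √(K : ℝ) = K := Real.mul_self_sqrt (by positivity)
  have h5 : √(K : ℝ) * 1 * 1 ≤ L * (1024 * H * (m * d) * √l) * √(2 * d * Real.log (1 + K)) := by
    have : 0 ≤ L := (Real.sqrt_nonneg _).trans hL
    gcongr
  have h6 : 0 ≤ √((m : ℝ) * d) * √(2 * (m * d) * Real.log (1 + K)) := by positivity
  have h7 : 0 ≤ 2 * H * √(K * H * Real.log (d * (K * H) / δ)) := by positivity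
  calc (K : ℝ) * H = 1 * H * √(K : ℝ) * √(K : ℝ) := by rw [mul_assoc, h4]; ring
    _ ≤ 4 * H * √(K : ℝ) * √(K : ℝ) := by gcongr; norm_num
    _ ≤ 4 * H * √(K : ℝ) * (L * (1024 * H * (m * d) * √l) * √(2 * d * Real.log (1 + K))
        + √((m : ℝ) * d) * √(2 * (m * d) * Real.log (1 + K))) := by gcongr; linarith
    _ ≤ _ := le_add_of_nonneg_left h7

/-- The slack in the explicit bound absorbs the deviation of the martingale of the value gaps. -/
theorem bonus_add_deviation_le_regretBound (hd : 0 < d) (hm : 0 < m) (hH : 0 < H) (hK : 0 < K)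
    (hδ : 0 < δ) (hδ2 : δ < 1 / 2) (hL : 1 ≤ L) {β : ℝ}
    (hβ : β = 1024 * H * (m * d) * √(Real.log (logArg d m H K δ))) :
    H * (L * (3 * β + β / 10) * √(K * (27 / 10 * (d * Real.log (1 + K))))
        + 2 * √((m : ℝ) * d) * √(K * (27 / 10 * (m * d * Real.log (1 + K)))))
      + 2 * H * √(Real.log (logArg d m H K δ)) * √(8 * (K * H))
      ≤ regretBound d m H K L β (√((m : ℝ) * d)) δ := by
  have hd1 : (1 : ℝ) ≤ d := by exact_mod_cast hd
  have hH1 : (1 : ℝ) ≤ H := by exact_mod_cast hH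
  have hmd1 : (1 : ℝ) ≤ m * d := by
    exact_mod_cast Nat.one_le_iff_ne_zero.2 (by positivity)
  have hl0 := log_two_le_log_one_add hK
  unfold regretBound
  set l := Real.log (logArg d m H K δ)
  set g := Real.log (1 + K)
  -- The comparison is `3.1 · √2.7 ≈ 5.09` against `4 √2 ≈ 5.66`. The difference exceeds `1/2`, the
  -- share of `H √K L β √(d log (1 + K))` granted to the martingale in `hmart`.
  have s27 : √(27 / 10 : ℝ) ≤ 1.6432 := by
    rw [Real.sqrt_le_left (by norm_num)]; norm_num
  have s2 : 1.414 ≤ √(2 : ℝ) := Real.le_sqrt_of_sq_le (by norm_num)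
  have s8 : √(8 : ℝ) ≤ 3 := by rw [Real.sqrt_le_left (by norm_num)]; norm_num
  have e1 : √(K * (27 / 10 * (d * g))) = √(K : ℝ) * (√(27 / 10) * √(d * g)) := by
    rw [Real.sqrt_mul (by positivity), Real.sqrt_mul (by positivity)]
  have e2 : √(K * (27 / 10 * (m * d * g))) = √(K : ℝ) * (√(27 / 10) * √(m * d * g)) := by
    rw [Real.sqrt_mul (by positivity), Real.sqrt_mul (by positivity)]
  have e3 : √(2 * d * g) = √2 * √(d * g) := by
    rw [mul_assoc, Real.sqrt_mul (by positivity)]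
  have e4 : √(2 * (m * d) * g) = √2 * √(m * d * g) := by
    rw [mul_assoc, Real.sqrt_mul (by positivity)]
  have e5 : √(8 * (K * H)) ≤ 3 * (√(K : ℝ) * H) := by
    rw [Real.sqrt_mul (by positivity), Real.sqrt_mul (by positivity)]
    gcongr
    rw [Real.sqrt_le_left (by positivity)]
    nlinarith
  rw [e1, e2, e3, e4]
  have hdg : 1 / 2 ≤ √(d * g) := Real.le_sqrt_of_sq_le (by nlinarith)
  set a := √(d * g)
  set b := √(m * d * g)
  set k := √(K : ℝ)
  set t := √((m : ℝ) * d)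
  have hk : 0 ≤ k := Real.sqrt_nonneg _
  have hb : 0 ≤ b := Real.sqrt_nonneg _
  have ht : 0 ≤ t := Real.sqrt_nonneg _
  have hsl : 0 ≤ √l := Real.sqrt_nonneg _
  have hβl : 1024 * H * √l ≤ L * β := by
    rw [hβ]
    calc 1024 * H * √l = 1 * (1024 * H * 1 * √l) := by ring
      _ ≤ _ := by gcongr
  have hβ0 : 0 ≤ L * β := le_trans (by positivity) hβl
  have hmart : 2 * H * √l * √(8 * (K * H)) ≤ H * k * (L * β * a) * (1 / 2) := by
    calc 2 * H * √l * √(8 * (K * H)) ≤ 2 * H * √l * (3 * (k * H)) := by gcongr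
      _ ≤ H * k * ((1024 * H * √l) * (1 / 2)) * (1 / 2) := by
          have : 0 ≤ H * k * (H * √l) := by positivity
          nlinarith
      _ ≤ _ := by gcongr
  have hterm1 : H * (L * (3 * β + β / 10) * (k * (√(27 / 10) * a)))
      ≤ H * k * (L * β * a) * (31 / 10 * 1.6432) := by
    calc _ = H * k * (L * β * a) * (31 / 10 * √(27 / 10)) := by ring
      _ ≤ _ := by gcongr
  have hterm2 : H * (2 * t * (k * (√(27 / 10) * b))) ≤ H * k * (t * b) * (2 * 1.6432) := by
    calc _ = H * k * (t * b) * (2 * √(27 / 10)) := by ring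
      _ ≤ _ := by gcongr
  have hr1 : H * k * (L * β * a) * (4 * 1.414) ≤ 4 * H * k * (L * β * (√2 * a)) := by
    calc _ ≤ H * k * (L * β * a) * (4 * √2) := by gcongr
      _ = _ := by ring
  have hr2 : H * k * (t * b) * (4 * 1.414) ≤ 4 * H * k * (t * (√2 * b)) := by
    calc _ ≤ H * k * (t * b) * (4 * √2) := by gcongr
      _ = _ := by ring
  have h0 : 0 ≤ 2 * H * √(K * H * Real.log (d * (K * H) / δ)) := by positivity
  have hA : 0 ≤ H * k * (L * β * a) := by positivity
  have hB : 0 ≤ H * k * (t * b) := by positivity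
  rw [mul_add, mul_add]
  linarith

/-- With `g = G⁻¹`, the mesh `g ^ 41` leaves `g ^ 40` after the dimension factors, `g ^ 20` after
the square root, and `g ^ 7` after the bonus coefficient `G ^ 13`. The factor `K R` costs two more
powers, and `g ^ 5 ≤ 1/32` outweighs the total coefficient `12`. -/
theorem gridError_le_one_of_le (hd : 0 < d) (hm : 0 < m) (hH : 0 < H) (hK : 0 < K) {G b bt : ℝ}
    (hG2 : 2 ≤ G) (hG : 2 * (m * d * (K * H)) ≤ G) (hb : b ≤ G ^ 13) (hbt : bt ≤ G) :
    UCBlvd.gridError d m H K (2 * G) (G ^ 41)⁻¹ b bt ≤ 1 := by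
  have hd1 : (1 : ℝ) ≤ d := by exact_mod_cast hd
  have hm1 : (1 : ℝ) ≤ m := by exact_mod_cast hm
  have hH1 : (1 : ℝ) ≤ H := by exact_mod_cast hH
  have hK1 : (1 : ℝ) ≤ K := by exact_mod_cast hK
  have hmd1 : (1 : ℝ) ≤ m * d := one_le_mul_of_one_le_of_one_le hm1 hd1
  have hKH1 : (1 : ℝ) ≤ K * H := one_le_mul_of_one_le_of_one_le hK1 hH1
  have hmdG : (m : ℝ) * d ≤ G := by
    have := le_mul_of_one_le_right (by positivity : (0 : ℝ) ≤ m * d) hKH1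
    linarith
  have hdG : (d : ℝ) ≤ G := (le_mul_of_one_le_left (by positivity) hm1).trans hmdG
  have hKHG2 : 2 * ((K : ℝ) * H) ≤ G := by
    have := le_mul_of_one_le_left (by positivity : (0 : ℝ) ≤ K * H) hmd1
    linarith
  have hKHG : (K : ℝ) * H ≤ G := by linarith
  have hK2 : 2 * (K : ℝ) ≤ G := by
    have := le_mul_of_one_le_right (by positivity : (0 : ℝ) ≤ K) hH1
    linarith
  have hHG : (H : ℝ) ≤ G := (le_mul_of_one_le_left (by positivity) hK1).trans hKHG
  have hG0 : 0 < G := by linarith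
  clear hd1 hm1 hH1 hK1 hmd1 hKH1 hG hKHG2
  obtain ⟨g, hg⟩ : ∃ g, g = G⁻¹ := ⟨_, rfl⟩
  have hg0 : 0 < g := hg ▸ inv_pos.2 hG0
  have hg2 : g ≤ 1 / 2 := by rw [hg, one_div]; exact inv_anti₀ two_pos hG2
  have hgG : g * G = 1 := by rw [hg]; exact inv_mul_cancel₀ hG0.ne'
  have hGg : ∀ j, g ^ j * G ^ j = 1 := fun j => by rw [← mul_pow, hgG, one_pow]
  have hε : (G ^ 41)⁻¹ = g * g ^ 40 := by rw [hg, ← inv_pow]; ring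
  have hmul : ∀ x, x ≤ G → x * (G ^ 41)⁻¹ ≤ g ^ 40 := fun x hx => by
    rw [hε]
    calc _ ≤ G * (g * g ^ 40) := by gcongr
      _ = (g * G) * g ^ 40 := by ring
      _ = g ^ 40 := by rw [hgG, one_mul]
  have hdε := hmul d hdG
  have hdmε := hmul (d * m) (by rwa [mul_comm])
  have hsqrt : ∀ x, x ≤ g ^ 40 → √x ≤ g ^ 20 := fun x hx => by
    rw [Real.sqrt_le_left (by positivity), ← pow_mul]; exact hx
  have hγ : (d : ℝ) * m * (G ^ 41)⁻¹ + b * √((d : ℝ) * (G ^ 41)⁻¹)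
      + bt * √((d : ℝ) * m * (G ^ 41)⁻¹) ≤ 3 * g ^ 7 := by
    have t1 : g ^ 40 ≤ g ^ 7 := pow_le_pow_of_le_one hg0.le (by linarith) (by norm_num)
    have t2 : b * √((d : ℝ) * (G ^ 41)⁻¹) ≤ g ^ 7 := by
      calc _ ≤ G ^ 13 * g ^ 20 := mul_le_mul hb (hsqrt _ hdε) (Real.sqrt_nonneg _) (by positivity)
        _ = (g ^ 13 * G ^ 13) * g ^ 7 := by ring
        _ = g ^ 7 := by rw [hGg, one_mul]
    have t3 : bt * √((d : ℝ) * m * (G ^ 41)⁻¹) ≤ g ^ 7 := by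
      calc _ ≤ G * g ^ 20 := mul_le_mul hbt (hsqrt _ hdmε) (Real.sqrt_nonneg _) hG0.le
        _ = (g * G) * g ^ 19 := by ring
        _ = g ^ 19 := by rw [hgG, one_mul]
        _ ≤ g ^ 7 := pow_le_pow_of_le_one hg0.le (by linarith) (by norm_num)
    linarith
  unfold UCBlvd.gridError
  generalize (d : ℝ) * m * (G ^ 41)⁻¹ + b * √((d : ℝ) * (G ^ 41)⁻¹)
      + bt * √((d : ℝ) * m * (G ^ 41)⁻¹) = γ at *
  have he0 : 0 ≤ (d : ℝ) * (G ^ 41)⁻¹ := by positivity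
  generalize (d : ℝ) * (G ^ 41)⁻¹ = e at *
  clear hdmε hsqrt hmul hε hb hbt
  have hg5 : g ^ 5 ≤ (1 / 2) ^ 5 := by gcongr
  have hpow : ∀ j, 5 ≤ j → g ^ j ≤ (1 / 2) ^ 5 := fun j hj =>
    (pow_le_pow_of_le_one hg0.le (by linarith) hj).trans hg5
  have u1 : K * (e * H) ≤ (1 / 2) ^ 5 := by
    calc K * (e * H) = e * (K * H) := by ring
      _ ≤ g ^ 40 * G := by gcongr
      _ = (g * G) * g ^ 39 := by ring
      _ ≤ _ := by rw [hgG, one_mul]; exact hpow 39 (by norm_num)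
  have u2 : K * (2 * (2 * G) * γ) ≤ 6 * (1 / 2) ^ 5 := by
    calc K * (2 * (2 * G) * γ) ≤ K * (2 * (2 * G) * (3 * g ^ 7)) := by gcongr
      _ = (2 * K) * G * g ^ 7 * 6 := by ring
      _ ≤ G * G * g ^ 7 * 6 := by gcongr
      _ = (g ^ 2 * G ^ 2) * g ^ 5 * 6 := by ring
      _ ≤ _ := by rw [hGg, one_mul, mul_comm]; gcongr
  have u3 : K * (H ^ 2 * (e * (2 * (2 * G) + e))) ≤ 5 * (1 / 2) ^ 5 := by
    have he1 : e ≤ G := hdε.trans ((pow_le_one₀ hg0.le (by linarith)).trans (by linarith))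
    calc K * (H ^ 2 * (e * (2 * (2 * G) + e))) = (K * H) * H * e * (2 * (2 * G) + e) := by ring
      _ ≤ G * G * g ^ 40 * (2 * (2 * G) + G) := by gcongr
      _ = (g ^ 3 * G ^ 3) * g ^ 37 * 5 := by ring
      _ ≤ _ := by rw [hGg, one_mul, mul_comm]; gcongr; exact hpow 37 (by norm_num)
  rw [mul_add, mul_add]
  norm_num at u1 u2 u3 ⊢
  linarith

theorem gridError_le_one (hd : 0 < d) (hm : 0 < m) (hH : 0 < H) (hK : 0 < K) (hδ : 0 < δ)
    (hδ2 : δ < 1 / 2) (hL : L ≤ √(K : ℝ)) {β : ℝ}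
    (hβ : β = 1024 * H * (m * d) * √(Real.log (logArg d m H K δ))) :
    UCBlvd.gridError d m H K (2 * logArg d m H K δ) ((logArg d m H K δ) ^ 41)⁻¹ (2 * L * β)
      (√((m : ℝ) * d)) ≤ 1 := by
  have hK1 : (1 : ℝ) ≤ K := by exact_mod_cast hK
  have hKH1 : (1 : ℝ) ≤ K * H := by exact_mod_cast Nat.one_le_iff_ne_zero.2 (by positivity)
  have hmd1 : (1 : ℝ) ≤ m * d := by exact_mod_cast Nat.one_le_iff_ne_zero.2 (by positivity)
  have hG := two_mul_le_logArg (d := d) (m := m) (H := H) (K := K) hδ hδ2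
  have hG2 := two_le_logArg hd hm hH hK hδ hδ2
  have hlog := Real.log_le_self (show 0 ≤ logArg d m H K δ by linarith)
  generalize logArg d m H K δ = G at *
  have hG0 : 0 < G := by linarith
  have hsl : √(Real.log G) ≤ G := by
    rw [Real.sqrt_le_left hG0.le]; nlinarith
  have hmdG := le_mul_of_one_le_right (by positivity : (0 : ℝ) ≤ m * d) hKH1
  -- The bonus coefficient contains `L`; only the assumption `L ≤ √K` makes it polynomial in `G`.
  have hLK : L ≤ K := hL.trans (by rw [Real.sqrt_le_left (by positivity)]; nlinarith)
  refine gridError_le_one_of_le hd hm hH hK hG2 hG ?_ ?_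
  · rw [hβ]
    calc 2 * L * (1024 * H * (m * d) * √(Real.log G))
        ≤ 2 * K * (1024 * H * (m * d) * G) := by gcongr
      _ = 2 ^ 10 * (2 * (m * d * (K * H))) * G := by ring
      _ ≤ G ^ 10 * G * G := by gcongr
      _ = G ^ 12 := by ring
      _ ≤ G ^ 13 := pow_le_pow_right₀ (by linarith) (by norm_num)
  · rw [Real.sqrt_le_left hG0.le]
    calc (m : ℝ) * d ≤ G := by linarith
      _ ≤ G ^ 2 := le_self_pow₀ (by linarith) (by norm_num)

/-- The logarithm of the inverse failure probability for a single point of the grid. -/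
noncomputable def gridLog (d m H K : ℕ) (δ : ℝ) : ℝ :=
  (1 + 180 * ((m : ℝ) * d) ^ 2) * Real.log (logArg d m H K δ)

/-- Each grid factor is at most `4 G ^ 42 + 3 ≤ G ^ 45` and the dimension is at most `4 (m d)²`,
which explains `180` in `gridLog`. The additional `log G` there pays for the `K H n` indices. -/
theorem union_bound_le (hd : 0 < d) (hm : 0 < m) (hH : 0 < H) (hK : 0 < K) (hδ : 0 < δ)
    (hδ2 : δ < 1 / 2) {n : ℕ} (hn : n ≤ m) :
    K * H * n * (2 * (2 * logArg d m H K δ) / ((logArg d m H K δ) ^ 41)⁻¹ + 3)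
      ^ (d + d * m + d * d + d * m * (d * m)) * Real.exp (-gridLog d m H K δ) ≤ δ := by
  have hd1 : (1 : ℝ) ≤ d := by exact_mod_cast hd
  have hG2 := two_le_logArg hd hm hH hK hδ hδ2
  have hGδ : K * H * m / logArg d m H K δ ≤ δ := by
    unfold logArg
    have : (0 : ℝ) < m := by exact_mod_cast hm
    have : (0 : ℝ) < K := by exact_mod_cast hK
    have : (0 : ℝ) < H := by exact_mod_cast hH
    rw [div_div_eq_mul_div, div_le_iff₀ (by positivity)]
    nlinarith [show 0 ≤ δ * (K * H * m) by positivity]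
  unfold gridLog
  set G := logArg d m H K δ
  have hG0 : 0 < G := by linarith
  have hbase : 2 * (2 * G) / (G ^ 41)⁻¹ + 3 ≤ G ^ 45 := by
    have h1 : 2 * (2 * G) / (G ^ 41)⁻¹ = 4 * G ^ 42 := by rw [div_inv_eq_mul]; ring
    have h2 : 1 ≤ G ^ 42 := one_le_pow₀ (by linarith)
    have h3 : (2 : ℝ) ^ 3 ≤ G ^ 3 := by gcongr
    calc _ ≤ 2 ^ 3 * G ^ 42 := by rw [h1]; linarith
      _ ≤ G ^ 3 * G ^ 42 := by gcongr
      _ = _ := by ring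
  have hexp : d + d * m + d * d + d * m * (d * m) ≤ 4 * (m * d) ^ 2 := by
    have a1 : 1 ≤ m * d := Nat.one_le_iff_ne_zero.2 (by positivity)
    have a2 : d ≤ m * d := Nat.le_mul_of_pos_left _ hm
    have a3 : m * d ≤ (m * d) ^ 2 := Nat.le_self_pow (by norm_num) _
    have a4 : d * d ≤ (m * d) ^ 2 := by rw [sq]; exact Nat.mul_le_mul a2 a2
    have a5 : d * m * (d * m) = (m * d) ^ 2 := by ring
    have a6 : d * m = m * d := mul_comm _ _
    omega
  have hpow : (2 * (2 * G) / (G ^ 41)⁻¹ + 3) ^ (d + d * m + d * d + d * m * (d * m))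
      ≤ Real.exp (180 * ((m : ℝ) * d) ^ 2 * Real.log G) := by
    calc _ ≤ (G ^ 45) ^ (d + d * m + d * d + d * m * (d * m)) := by gcongr
      _ ≤ (G ^ 45) ^ (4 * (m * d) ^ 2) :=
        pow_le_pow_right₀ (one_le_pow₀ (by linarith)) hexp
      _ = G ^ (180 * (m * d) ^ 2) := by rw [← pow_mul]; ring_nf
      _ = _ := by
        rw [← Real.exp_log (pow_pos hG0 _), Real.log_pow]
        push_cast
        rfl
  calc _ ≤ K * H * m * Real.exp (180 * ((m : ℝ) * d) ^ 2 * Real.log G)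
        * Real.exp (-((1 + 180 * ((m : ℝ) * d) ^ 2) * Real.log G)) := by gcongr
    _ = K * H * m * Real.exp (-Real.log G) := by
        rw [mul_assoc, ← Real.exp_add]; ring_nf
    _ = K * H * m / G := by rw [Real.exp_neg, Real.exp_log hG0, div_eq_mul_inv]
    _ ≤ δ := hGδ

/-- Fixes the constant `1024`: the radius `β / 10` must dominate the logarithm of the grid, of order
`(m d)² log G`, and the bias `H m d`. -/
theorem confidence_radius_le (hd : 0 < d) (hm : 0 < m) (hH : 0 < H) (hK : 0 < K) (hδ : 0 < δ)
    (hδ2 : δ < 1 / 2) {β : ℝ}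
    (hβ : β = 1024 * H * (m * d) * √(Real.log (logArg d m H K δ))) :
    4 * (H : ℝ) ^ 2 * (gridLog d m H K δ + 1) + (H * (m * d)) ^ 2 ≤ (β / 10) ^ 2 := by
  have hl := log_two_le_log_logArg hd hm hH hK hδ hδ2
  have hmd1 : (1 : ℝ) ≤ m * d := by
    exact_mod_cast Nat.one_le_iff_ne_zero.2 (by positivity)
  unfold gridLog
  set l := Real.log (logArg d m H K δ)
  have e : (β / 10) ^ 2 = 1024 ^ 2 / 100 * (H ^ 2 * ((m * d) ^ 2 * l)) := by
    rw [hβ, div_pow, mul_pow, mul_pow, mul_pow, Real.sq_sqrt (by linarith)]; ring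
  rw [e]
  have h1 : (1 : ℝ) ≤ (m * d) ^ 2 := one_le_pow₀ hmd1
  set q := ((m : ℝ) * d) ^ 2 with hq
  have h2 : l ≤ q * l := le_mul_of_one_le_left (by linarith) h1
  have h3 : q * (69 / 100) ≤ q * l := by gcongr
  have h4 : 4 * ((1 + 180 * q) * l + 1) + q ≤ 1024 ^ 2 / 100 * (q * l) := by nlinarith
  calc 4 * (H : ℝ) ^ 2 * ((1 + 180 * q) * l + 1) + (H * (m * d)) ^ 2
      = H ^ 2 * (4 * ((1 + 180 * q) * l + 1) + q) := by rw [hq]; ring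
    _ ≤ H ^ 2 * (1024 ^ 2 / 100 * (q * l)) := by gcongr
    _ = _ := by ring

end Numerics

/-! ### The regret bound -/

namespace UCBlvd

variable {Ω S A W : Type*} [MeasurableSpace S] [MeasurableSpace A] [MeasurableSpace W]
  [Fintype A] [Nonempty A] [DiscreteMeasurableSpace A] {mΩ : MeasurableSpace Ω} {d m n : ℕ}
  {F : Features S A W d m n} {δ β βt : ℝ}
  {M : ContextualMDP S A W} {K : ℕ} {μ : Measure Ω} [IsProbabilityMeasure μ]
  {𝓕 : Filtration ℕ mΩ} {X : Ω → History S A W}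
  {ξ : ℕ → Ω → ℕ → EuclideanSpace ℝ (Fin d × Fin m)} {π : ℕ → Ω → ℕ → S → W → A}

/-- Outside an event of probability at most `δ`, all plans are accurate. -/
theorem IsRun.exists_isAccurate_event (hR : IsRun ⟨F, M.H, 1, β, βt⟩ M K μ 𝓕 X ξ π)
    (hA : StandingAssumptions M F) (hd : 0 < d) (hm : 0 < m) (hH : 0 < M.H) (hK : 0 < K)
    (hδ : 0 < δ) (hδ2 : δ < 1 / 2)
    (hβ : β = 1024 * M.H * (m * d) * √(Real.log (logArg d m M.H K δ)))
    (hβt : βt = √((m : ℝ) * d)) (hL0 : 0 ≤ F.L) (hL : F.L ≤ √(K : ℝ)) :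
    ∃ E : Set Ω, μ.real Eᶜ ≤ δ ∧ ∀ ω ∈ E, ∀ k < K,
      planIndex ⟨F, M.H, 1, β, βt⟩ (X ω) k = k →
        IsAccurate ⟨F, M.H, 1, β, βt⟩ M (X ω) k (ξ k ω) (β / 10) := by
  obtain ⟨ρ, hρ⟩ := hA.mapping
  have hG := two_mul_le_logArg (d := d) (m := m) (H := M.H) (K := K) hδ hδ2
  have hG2 := two_le_logArg hd hm hH hK hδ hδ2
  have hβ0 : 0 ≤ β := by rw [hβ]; positivity
  have hgrid := gridError_le_one hd hm hH hK hδ hδ2 hL hβ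
  have hunion := union_bound_le hd hm hH hK hδ hδ2 hρ.card_le
  have hradius := confidence_radius_le hd hm hH hK hδ hδ2 hβ
  obtain ⟨E, hE, hnoise⟩ := hR.exists_confidence_event hA.phi_meas hA.psi_meas hA.norm_phi_le
    hA.norm_psi_le (R := 2 * logArg d m M.H K δ) (ε := ((logArg d m M.H K δ) ^ 41)⁻¹)
    (b := 2 * F.L * β) (bt := βt) (by linarith) (by positivity) (by positivity)
    (by rw [hβt]; positivity) (gridLog d m M.H K δ)
  refine ⟨E, hE.trans hunion, fun ω hω k hk hplan => ?_⟩
  have hK1 : (1 : ℝ) ≤ K := by exact_mod_cast hK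
  have hH1 : (1 : ℝ) ≤ M.H := by exact_mod_cast hH
  have hmd1 : (1 : ℝ) ≤ m * d := by exact_mod_cast Nat.one_le_iff_ne_zero.2 (by positivity)
  have h1 : (K : ℝ) ≤ m * d * (K * M.H) := by
    calc (K : ℝ) = 1 * (K * 1) := by ring
      _ ≤ _ := by gcongr
  have h2 : (m : ℝ) * d ≤ m * d * (K * M.H) :=
    le_mul_of_one_le_right (by positivity) (one_le_mul_of_one_le_of_one_le hK1 hH1)
  have h3 : (M.H : ℝ) * (m * d) ≤ m * d * (K * M.H) := by
    calc (M.H : ℝ) * (m * d) = m * d * (1 * M.H) := by ring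
      _ ≤ _ := by gcongr
  refine isAccurate_of_compensatedNoise_le hA hd hm hH hk hβt (hR.reward ω) (hR.plan ω k hk hplan)
    (R := 2 * logArg d m M.H K δ) (b := gridLog d m M.H K δ + 1) (by linarith) (by linarith)
    (by linarith) (by linarith) hradius fun h hh j x ν B Bt hx hν hB hBt => ?_
  refine (hnoise ω hω k hk h hh j x ν B Bt hx hν hB hBt).trans ?_
  rw [hβt]
  exact add_le_add_right hgrid _

/-- Outside an event of probability at most `δ`, the noise of the gaps is at least
`-2 H √(log (m d T / δ)) √(8 T)`. -/
theorem IsRun.exists_gap_noise_event (hR : IsRun ⟨F, M.H, 1, β, βt⟩ M K μ 𝓕 X ξ π)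
    (hA : StandingAssumptions M F) (hd : 0 < d) (hm : 0 < m) (hH : 0 < M.H) (hK : 0 < K)
    (hδ : 0 < δ) (hδ2 : δ < 1 / 2) :
    ∃ E : Set Ω, μ.real Eᶜ ≤ δ ∧ ∀ ω ∈ E,
      -∑ k ∈ range K, ∑ h ∈ range M.H, noise M (X ω) h
        (gap ⟨F, M.H, 1, β, βt⟩ M (X ω) (fun j => ξ j ω) (fun j => π j ω) k (h + 1)) k
      ≤ 2 * M.H * √(Real.log (logArg d m M.H K δ)) * √(8 * (K * M.H)) := by
  have hG := two_mul_le_logArg (d := d) (m := m) (H := M.H) (K := K) hδ hδ2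
  have hG2 := two_le_logArg hd hm hH hK hδ hδ2
  have hℓ := log_two_le_log_logArg hd hm hH hK hδ hδ2
  have hK1 : (1 : ℝ) ≤ K := by exact_mod_cast hK
  have hH1 : (1 : ℝ) ≤ M.H := by exact_mod_cast hH
  have hexp : Real.exp (-Real.log (logArg d m M.H K δ)) ≤ δ := by
    have h1 : (1 : ℝ) ≤ m * d * (K * M.H) := by
      exact_mod_cast Nat.one_le_iff_ne_zero.2 (by positivity)
    rw [Real.exp_neg, Real.exp_log (by linarith), logArg, inv_div]
    exact div_le_self hδ.le h1
  set ℓ := Real.log (logArg d m M.H K δ)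
  obtain ⟨s, hs⟩ : ∃ s, s = √ℓ := ⟨_, rfl⟩
  obtain ⟨q, hq⟩ : ∃ q, q = √(8 * (K * M.H : ℝ)) := ⟨_, rfl⟩
  have hs0 : 0 < s := hs ▸ Real.sqrt_pos.2 (by linarith)
  have hq0 : 0 < q := hq ▸ Real.sqrt_pos.2 (by positivity)
  have hs2 : s ^ 2 = ℓ := hs ▸ Real.sq_sqrt (by linarith)
  have hq2 : q ^ 2 = 8 * (K * M.H) := hq ▸ Real.sq_sqrt (by positivity)
  -- The parameter `√ℓ / (H √(8 T))` is chosen so that, by `H + 1 ≤ 2 H`, the compensator is at most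
  -- `ℓ`, the same as the deviation level.
  have hl0 : 0 < s / (M.H * q) := by positivity
  refine ⟨_, ?_, fun ω (hω : ω ∈ {ω | ℓ + K * (M.H + 1) * (2 * M.H * (s / (M.H * q))) ^ 2 <
    -(s / (M.H * q)) * ∑ k ∈ range K, ∑ h ∈ range M.H, noise M (X ω) h
      (gap ⟨F, M.H, 1, β, βt⟩ M (X ω) (fun j => ξ j ω) (fun j => π j ω) k (h + 1)) k}ᶜ) => ?_⟩
  · rw [compl_compl]
    exact (hR.measureReal_lt_gap_noise_le rfl hA.phi_meas hA.psi_meas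
      (fun h hh a => hA.measurable_reward measurable_fst measurable_snd hh a) hl0.le ℓ).trans hexp
  · rw [Set.mem_compl_iff, Set.mem_ofPred_eq, not_lt] at hω
    rw [← hs, ← hq]
    generalize ∑ k ∈ range K, ∑ h ∈ range M.H, noise M (X ω) h
      (gap ⟨F, M.H, 1, β, βt⟩ M (X ω) (fun j => ξ j ω) (fun j => π j ω) k (h + 1)) k = N at *
    have hquad : K * (M.H + 1) * (2 * M.H * (s / (M.H * q))) ^ 2 ≤ s ^ 2 := by
      calc _ = (K * (M.H + 1) * 4) * (s / q) ^ 2 := by field_simp; ring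
        _ ≤ q ^ 2 * (s / q) ^ 2 := by
          gcongr
          rw [hq2]
          nlinarith
        _ = s ^ 2 := by field_simp
    refine le_of_mul_le_mul_left ?_ hl0
    calc s / (M.H * q) * -N ≤ 2 * s ^ 2 := by linarith
      _ = s / (M.H * q) * (2 * M.H * s * q) := by field_simp

theorem IsRun.measureReal_regret_le (hR : IsRun ⟨F, M.H, 1, β, βt⟩ M K μ 𝓕 X ξ π)
    (hA : StandingAssumptions M F) (hd : 0 < d) (hm : 0 < m) (hH : 0 < M.H) (hK : 0 < K)
    (hδ : 0 < δ) (hδ2 : δ < 1 / 2)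
    (hβ : β = 1024 * M.H * (m * d) * √(Real.log (logArg d m M.H K δ)))
    (hβt : βt = √((m : ℝ) * d)) (hL : 1 ≤ F.L) :
    1 - 2 * δ ≤ μ.real {ω | regret M K (X ω) (fun k => π k ω) ≤
      regretBound d m M.H K F.L β βt δ} := by
  rcases le_total √(K : ℝ) F.L with hKL | hKL
  · have : {ω | regret M K (X ω) (fun k => π k ω) ≤ regretBound d m M.H K F.L β βt δ} = Set.univ :=
      Set.eq_univ_of_forall fun ω => (regret_le_mul M K (X ω) _).trans
        (by rw [hβ, hβt]; exact mul_le_regretBound_of_sqrt_le hd hm hH hK hδ hδ2 hKL)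
    rw [this, probReal_univ]
    linarith
  have hL0 : 0 ≤ F.L := by linarith
  have hβ0 : 0 ≤ β := by rw [hβ]; positivity
  obtain ⟨E₁, hE₁, hacc⟩ := hR.exists_isAccurate_event hA hd hm hH hK hδ hδ2 hβ hβt hL0 hKL
  obtain ⟨E₂, hE₂, hdev⟩ := hR.exists_gap_noise_event hA hd hm hH hK hδ hδ2
  set B := {ω | regret M K (X ω) (fun k => π k ω) ≤ regretBound d m M.H K F.L β βt δ}
  have hsub : E₁ ∩ E₂ ⊆ B := fun ω hω => by
    have h1 := hR.regret_le_of_isAccurate hA hd hm hL0 (β₀ := β / 10) (by positivity)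
      (by linarith) (by rw [hβt]; positivity) ω (hacc ω hω.1)
    have h2 := hdev ω hω.2
    have h3 := bonus_add_deviation_le_regretBound hd hm hH hK hδ hδ2 hL hβ
    rw [← hβt] at h3
    have h4 : regret M K (X ω) (fun k => π k ω) ≤ regretBound d m M.H K F.L β βt δ := by linarith
    exact h4
  -- The regret involves a supremum over all policies, and `B` is not known to be measurable.
  -- Subadditivity on a cover of the whole space avoids taking its complement.
  have hcover : Set.univ ⊆ B ∪ (E₁ᶜ ∪ E₂ᶜ) := fun ω _ => by
    by_cases h1 : ω ∈ E₁
    · by_cases h2 : ω ∈ E₂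
      · exact Or.inl (hsub ⟨h1, h2⟩)
      · exact Or.inr (Or.inr h2)
    · exact Or.inr (Or.inl h1)
  have h1 := measureReal_mono (μ := μ) hcover
  rw [probReal_univ] at h1
  have h2 := measureReal_union_le (μ := μ) B (E₁ᶜ ∪ E₂ᶜ)
  have h3 := measureReal_union_le (μ := μ) E₁ᶜ E₂ᶜ
  linarith

end UCBlvd

theorem mainTheorem3 :
    ∃ c : ℝ, 0 < c ∧ ∃ C : ℝ, 0 < C ∧
      ∀ (S A W : Type*) [MeasurableSpace S] [MeasurableSpace A] [MeasurableSpace W]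
        [Fintype A] [Nonempty A] [DiscreteMeasurableSpace A]
        (d m n K : ℕ) (M : ContextualMDP S A W) (F : Features S A W d m n),
        0 < d → 0 < m → 0 < M.H → 0 < K → StandingAssumptions M F →
        -- the number of planning calls
        (∀ lam β βt : ℝ, 0 < lam →
          ∀ (Ω : Type*) [mΩ : MeasurableSpace Ω] (μ : Measure Ω) [IsProbabilityMeasure μ]
            (𝓕 : Filtration ℕ mΩ) (X : Ω → History S A W)
            (ξ : ℕ → Ω → ℕ → EuclideanSpace ℝ (Fin d × Fin m)) (π : ℕ → Ω → ℕ → S → W → A),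
            UCBlvd.IsRun ⟨F, M.H, lam, β, βt⟩ M K μ 𝓕 X ξ π →
            ∀ ω, (UCBlvd.numPlanningCalls ⟨F, M.H, lam, β, βt⟩ (X ω) K : ℝ) ≤
              d * M.H * Real.log (1 + K / (d * lam))
                + m * d * M.H * Real.log (1 + K / (m * d * lam))) ∧
        -- the regret
        (∀ δ β βt : ℝ, 0 < δ → δ < 1 / 2 →
          β = c * M.H * (m * d) * √(Real.log (m * d * ((K : ℝ) * M.H) / δ)) →
          βt = √((m : ℝ) * d) →
          (1 ≤ F.L → regretBound d m M.H K F.L β βt δ ≤ C * regretRate d m M.H K F.L δ) ∧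
          ∀ (Ω : Type*) [mΩ : MeasurableSpace Ω] (μ : Measure Ω) [IsProbabilityMeasure μ]
            (𝓕 : Filtration ℕ mΩ) (X : Ω → History S A W)
            (ξ : ℕ → Ω → ℕ → EuclideanSpace ℝ (Fin d × Fin m)) (π : ℕ → Ω → ℕ → S → W → A),
            UCBlvd.IsRun ⟨F, M.H, 1, β, βt⟩ M K μ 𝓕 X ξ π →
            1 - 2 * δ ≤ μ.real {ω |
              regret M K (X ω) (fun k => π k ω) ≤ regretBound d m M.H K F.L β βt δ ∧
              regret M K (X ω) (fun k => π k ω) ≤ C * regretRate d m M.H K F.L δ}) := by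
  refine ⟨1024, by norm_num, 10000, by norm_num, ?_⟩
  intro S A W _ _ _ _ _ _ d m n K M F hd hm hH hK hA
  refine ⟨fun lam β βt hlam Ω _ μ _ 𝓕 X ξ π _ ω => ?_, fun δ β βt hδ hδ2 hβ hβt => ?_⟩
  · exact UCBlvd.numPlanningCalls_le (U := ⟨F, M.H, lam, β, βt⟩) (X ω) hd hm hlam hA.norm_phi_le
      hA.norm_psi_le K
  have hrate : 1 ≤ F.L → regretBound d m M.H K F.L β βt δ ≤ 10000 * regretRate d m M.H K F.L δ :=
    fun hL => by
      rw [hβ, hβt]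
      exact regretBound_le_regretRate hd hm hH hK hδ hδ2 hL
  refine ⟨hrate, fun Ω _ μ _ 𝓕 X ξ π hR => ?_⟩
  -- For `L < 1` the map `ρ` vanishes, hence so do `ψ` and the rewards. The regret is then
  -- nonpositive, while both bounds are nonnegative.
  rcases le_or_gt 1 F.L with hL | hL
  · refine (hR.measureReal_regret_le hA hd hm hH hK hδ hδ2 hβ hβt hL).trans
      (measureReal_mono fun ω hω => ⟨hω, hω.trans (hrate hL)⟩)
  · obtain ⟨ρ, hρ⟩ := hA.mapping
    obtain ⟨η, hη⟩ := hA.exists_reward_eq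
    have hr : ∀ h < M.H, ∀ s a w, M.r h s a w = 0 := fun h hh s a w => by
      have h0 : kronVec (F.φ s a) (0 : EuclideanSpace ℝ (Fin m)) = 0 := by
        ext p
        simp [kronVec]
      rw [(hη h hh).2, hρ.kron, hρ.rho_eq_zero_of_L_lt_one hL, h0, inner_zero_right]
    have huniv : {ω | regret M K (X ω) (fun k => π k ω) ≤ regretBound d m M.H K F.L β βt δ ∧
        regret M K (X ω) (fun k => π k ω) ≤ 10000 * regretRate d m M.H K F.L δ} = Set.univ := by
      refine Set.eq_univ_of_forall fun ω => ?_
      -- A context of the history shows that `W` is inhabited, which is needed for `L ≥ 0`.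
      have : Nonempty W := ⟨(X ω).ctx 0⟩
      have hL0 := hρ.L_nonneg
      have hreg := regret_nonpos_of_reward_eq_zero M K (X ω) (fun k => π k ω) hr
      have hlog := log_two_le_log_logArg hd hm hH hK hδ hδ2
      have hβ0 : 0 ≤ β := by rw [hβ]; positivity
      have hβt0 : 0 ≤ βt := by rw [hβt]; positivity
      refine ⟨hreg.trans ?_, hreg.trans ?_⟩
      · unfold regretBound
        positivity
      · unfold regretRate
        unfold logArg at hlog
        have hlog0 : 0 ≤ Real.log (m * d * (K * M.H) / δ) := by linarith
        positivity
    rw [huniv, probReal_univ]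
    linarith
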